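/- Let $\mathcal B_n=\mathbb F_2[x_1,\dots,x_n]/(x_1^2+x_1,\dots,x_n^2+x_n)$ be the ring of Boolean polynomials, and let $\mathcal B_{j,n}$ be its subring generated by $x_j,\dots,x_n$ (so $\mathcal B_{n+1,n}=\mathbb F_2$). A literal is $x_i$ or $x_i+1$, a clause is a constant or a product of literals, and $\mathcal C_n^d$ is the set of sums of $d$ clauses ($d\ge 1$; $0$ is a clause). A system $\Lambda=(p_1,\dots,p_m)$, $m\ge 1$, stands for the equations $p_1=\dots=p_m=0$; it is satisfiable if it has a solution in $\mathbb F_2^n$. It is given by writing each $p_i$ as a sum of at most $d$ clauses, each with at most $k\ge 1$ literals (in particular $p_i\in\mathcal C_n^d$ has degree at most $k$). Let $0\le R\le n$, and suppose that among $p_1,\dots,p_m$ there are non-constant polynomials $f_1,\dots,f_R$ such that, for every $j$, the least index of a variable that occurs in $f_j$ is $j$, and $f_j+x_j\in\mathcal B_{j+1,n}\cap\mathcal C_n^d$. Time is the number of steps of a deterministic random access machine whose unit-cost operations are increment, decrement, copying, comparison and indirect memory access; in each part one program and one constant in $O(\cdot)$ serve all inputs. (i) Given $\Lambda$ and the positions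 of $f_1,\dots,f_R$ in it, one can decide whether $\Lambda$ is satisfiable in time $O(d\,k\,m\,2^{\,n-R})$. The same holds when only $\Lambda$ is given, provided that each $f_j$ is written as one of the single literals $x_j$, $x_j+1$ plus clauses in variables after $x_j$ only. (ii) If $\Lambda$ is a linear system, that is, $k=1$ and $d=n\ge 1$, then, given $\Lambda$ only, one can decide whether $\Lambda$ is satisfiable in time $O(m\,n\,(n+1-R))$. -/

import Mathlib

open MvPolynomial

/-! ### Boolean polynomials -/

/-- The ideal generated by the polynomials `x_i ^ 2 + x_i`. -/
noncomputable def boolIdeal (n : ℕ) : Ideal (MvPolynomial (Fin n) (ZMod 2)) :=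
  Ideal.span (Set.range fun i : Fin n => X i ^ 2 + X i)

/-- The ring of Boolean polynomials in `n` variables. The variables are numbered from `0`, so that
`0, …, n - 1` stand for the subscripts `1, …, n`. -/
abbrev BoolPoly (n : ℕ) : Type := MvPolynomial (Fin n) (ZMod 2) ⧸ boolIdeal n

namespace BoolPoly

variable {n : ℕ}

/-- The variable `x_i`. -/
noncomputable def var (i : Fin n) : BoolPoly n := Ideal.Quotient.mk (boolIdeal n) (X i)

theorem eval_eq_zero (α : Fin n → ZMod 2) :
    ∀ q ∈ boolIdeal n, MvPolynomial.eval α q = 0 := by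
  intro q hq
  have hle : boolIdeal n ≤ RingHom.ker (MvPolynomial.eval α) := by
    unfold boolIdeal
    rw [Ideal.span_le]
    rintro _ ⟨i, rfl⟩
    have h : ∀ a : ZMod 2, a ^ 2 + a = 0 := by decide
    have h' := h (α i)
    simpa only [SetLike.mem_coe, RingHom.mem_ker, map_add, map_pow, MvPolynomial.eval_X] using h'
  exact hle hq

/-- Evaluation of Boolean polynomials at a point `α` of `𝔽₂ⁿ`. -/
noncomputable def eval (α : Fin n → ZMod 2) : BoolPoly n →+* ZMod 2 :=
  Ideal.Quotient.lift (boolIdeal n) (MvPolynomial.eval α) (eval_eq_zero α)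

/-- The subring generated by the variables with index in `s`. -/
noncomputable def polysIn (s : Set (Fin n)) : Subalgebra (ZMod 2) (BoolPoly n) :=
  Algebra.adjoin (ZMod 2) (var '' s)

/-- `x_i` occurs in `p`, that is, in the unique expression of `p` as a sum of squarefree
monomials: `p` is not a polynomial in the other variables. -/
def Occurs (p : BoolPoly n) (i : Fin n) : Prop := p ∉ polysIn {l : Fin n | l ≠ i}

/-- The least index of a variable that occurs in `p`; it is `n` if `p` is constant. -/
noncomputable def minVar (p : BoolPoly n) : ℕ :=
  sInf {v : ℕ | (∃ i : Fin n, i.val = v ∧ Occurs p i) ∨ v = n}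

/-- The literals `x_i` and `x_i + 1`. -/
def IsLiteral (l : BoolPoly n) : Prop := ∃ i : Fin n, l = var i ∨ l = var i + 1

/-- The clauses: the constants and the products of one or more literals. -/
def clauses (n : ℕ) : Set (BoolPoly n) :=
  {c | c = 0 ∨ c = 1 ∨ ∃ L : List (BoolPoly n), L ≠ [] ∧ (∀ l ∈ L, IsLiteral l) ∧ c = L.prod}

/-- The sums of `d` clauses. -/
def clauseSums (n d : ℕ) : Set (BoolPoly n) :=
  {p | ∃ c : Fin d → BoolPoly n, (∀ i, c i ∈ clauses n) ∧ p = ∑ i, c i}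

/-- The condition on the polynomial `f_j`: it is not constant, its least variable is `x_j`, and
`f_j + x_j` is a polynomial in the variables after `x_j` and a sum of `d` clauses. -/
def IsPivot (d : ℕ) (f : BoolPoly n) (j : Fin n) : Prop :=
  f ≠ 0 ∧ f ≠ 1 ∧ minVar f = j.val ∧
    f + var j ∈ polysIn {i : Fin n | j < i} ∧ f + var j ∈ clauseSums n d

end BoolPoly

/-! ### Systems, as they are written down -/

/-- A literal: `(i, false)` is `x_i`, and `(i, true)` is `x_i + 1`. -/
abbrev LitExpr (n : ℕ) : Type := Fin n × Bool

/-- A clause, as the list of its literals; the empty list is the constant `1`. -/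
abbrev ClauseExpr (n : ℕ) : Type := List (LitExpr n)

/-- A polynomial, as a list of clauses that sum up to it; the empty list is the constant `0`. -/
abbrev PolyExpr (n : ℕ) : Type := List (ClauseExpr n)

/-- A system `p_1 = ⋯ = p_m = 0`. -/
abbrev SystemExpr (n : ℕ) : Type := List (PolyExpr n)

namespace SystemExpr

variable {n : ℕ}

noncomputable def litVal (l : LitExpr n) : BoolPoly n := BoolPoly.var l.1 + if l.2 then 1 else 0

noncomputable def clauseVal (c : ClauseExpr n) : BoolPoly n := (c.map litVal).prod

/-- The Boolean polynomial given by an expression. -/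
noncomputable def polyVal (p : PolyExpr n) : BoolPoly n := (p.map clauseVal).sum

/-- The set of solutions of the system. -/
def solutions (S : SystemExpr n) : Set (Fin n → ZMod 2) :=
  {α | ∀ p ∈ S, BoolPoly.eval α (polyVal p) = 0}

def Satisfiable (S : SystemExpr n) : Prop := (solutions S).Nonempty

/-- Every polynomial of the system is written with at most `d` clauses, and every clause with at
most `k` literals. -/
def Bounded (S : SystemExpr n) (d k : ℕ) : Prop :=
  ∀ p ∈ S, p.length ≤ d ∧ ∀ c ∈ p, c.length ≤ k

/-- The expression shows `x_j` as the leading variable: it consists of the single literal `x_j` or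
`x_j + 1`, once, and of clauses in the variables after `x_j`. -/
def ShowsPivot (p : PolyExpr n) (j : Fin n) : Prop :=
  ∃ (p₁ p₂ : PolyExpr n) (b : Bool), p = p₁ ++ [(j, b)] :: p₂ ∧
    ∀ c ∈ p₁ ++ p₂, ∀ l ∈ c, j < l.1

/-- Encodings by sequences of natural numbers; a list is preceded by its length. -/
def encLit (l : LitExpr n) : List ℕ := [l.1.val, if l.2 then 1 else 0]

def encClause (c : ClauseExpr n) : List ℕ := c.length :: c.flatMap encLit

def encPoly (p : PolyExpr n) : List ℕ := p.length :: p.flatMap encClause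

def enc (S : SystemExpr n) : List ℕ := n :: S.length :: S.flatMap encPoly

/-- The encoding of a list of positions in a list of length `m`. -/
def encIndices {R m : ℕ} (f : Fin R → Fin m) : List ℕ := R :: List.ofFn fun j => (f j).val

end SystemExpr

/-! ### The machine model

A deterministic random access machine with indirect addressing, programmed with conditionals and
loops. A program uses finitely many registers and finitely many arrays, each of unbounded length.
The only arithmetic is counting up and down by one, so the numbers that occur never exceed the
largest input number or constant of the program by more than the number of steps. -/

namespace RAM

structure State where
  reg : ℕ → ℕ
  mem : ℕ → ℕ → ℕ

def State.setReg (s : State) (x v : ℕ) : State := ⟨Function.update s.reg x v, s.mem⟩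

def State.setMem (s : State) (a i v : ℕ) : State :=
  ⟨s.reg, Function.update s.mem a (Function.update (s.mem a) i v)⟩

inductive Program : Type where
  /-- register `x` := the constant `c` -/
  | const (x c : ℕ)
  /-- register `x` := register `y` -/
  | copy (x y : ℕ)
  /-- register `x` := register `x` plus one -/
  | inc (x : ℕ)
  /-- register `x` := register `x` minus one (`0` stays `0`) -/
  | dec (x : ℕ)
  /-- register `x` := the entry of array `a` at the position held by register `y` -/
  | load (x a y : ℕ)
  /-- the entry of array `a` at the position held by register `y` := register `x` -/
  | store (a y x : ℕ)
  /-- first `P`, then `Q` -/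
  | seq (P Q : Program)
  /-- `P` if register `x` is less than register `y`, otherwise `Q` -/
  | ifLt (x y : ℕ) (P Q : Program)
  /-- repeat `P` as long as register `x` is less than register `y` -/
  | whileLt (x y : ℕ) (P : Program)

/-- `Exec P s t s'`: started in the state `s`, the program `P` halts after `t` steps in the state
`s'`. Every assignment and every test is one step. -/
inductive Exec : Program → State → ℕ → State → Prop where
  | const (s : State) (x c : ℕ) : Exec (.const x c) s 1 (s.setReg x c)
  | copy (s : State) (x y : ℕ) : Exec (.copy x y) s 1 (s.setReg x (s.reg y))
  | inc (s : State) (x : ℕ) : Exec (.inc x) s 1 (s.setReg x (s.reg x + 1))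
  | dec (s : State) (x : ℕ) : Exec (.dec x) s 1 (s.setReg x (s.reg x - 1))
  | load (s : State) (x a y : ℕ) : Exec (.load x a y) s 1 (s.setReg x (s.mem a (s.reg y)))
  | store (s : State) (a y x : ℕ) : Exec (.store a y x) s 1 (s.setMem a (s.reg y) (s.reg x))
  | seq {P Q : Program} {s s₁ s₂ : State} {t₁ t₂ : ℕ} :
      Exec P s t₁ s₁ → Exec Q s₁ t₂ s₂ → Exec (.seq P Q) s (t₁ + t₂) s₂
  | ifTrue {x y : ℕ} {P Q : Program} {s s' : State} {t : ℕ} :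
      s.reg x < s.reg y → Exec P s t s' → Exec (.ifLt x y P Q) s (t + 1) s'
  | ifFalse {x y : ℕ} {P Q : Program} {s s' : State} {t : ℕ} :
      ¬ s.reg x < s.reg y → Exec Q s t s' → Exec (.ifLt x y P Q) s (t + 1) s'
  | whileTrue {x y : ℕ} {P : Program} {s s₁ s₂ : State} {t₁ t₂ : ℕ} :
      s.reg x < s.reg y → Exec P s t₁ s₁ → Exec (.whileLt x y P) s₁ t₂ s₂ →
      Exec (.whileLt x y P) s (t₁ + t₂ + 1) s₂
  | whileFalse {x y : ℕ} {P : Program} {s : State} :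
      ¬ s.reg x < s.reg y → Exec (.whileLt x y P) s 1 s

/-- The initial state: the list `A` in array `0`, the list `B` in array `1`, and `0` elsewhere. -/
def init (A B : List ℕ) : State where
  reg := fun _ => 0
  mem := fun a i => if a = 0 then A.getD i 0 else if a = 1 then B.getD i 0 else 0

/-- Started on the input `(A, B)`, the program halts within `T` steps, with `1` in register `0` if
`Q` is true and `0` if `Q` is false. -/
def DecidesWithin (P : Program) (A B : List ℕ) (Q : Prop) (T : ℕ) : Prop :=
  ∃ (t : ℕ) (s : State), Exec P (init A B) t s ∧ t ≤ T ∧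
    (Q → s.reg 0 = 1) ∧ (¬ Q → s.reg 0 = 0)

end RAM

/-! The equation `f_j = 0` expresses the variable `x_j` through later variables. Hence every
assignment of the `n - R` free variables (those after the first `R`) extends in exactly one way to a
common zero of `f_1, …, f_R`, found by back substitution, and the system is satisfiable if and only
if one of these `2 ^ (n - R)` extensions solves it (`runs_backSubst`, `eq_of_leads`). A polynomial
has at most one leading variable, so the `f_j` are distinct and `R ≤ m` (`Ready.cnt_le`). Completing
and testing one assignment therefore takes at most `2m` evaluations, each linear in the length `O(d
k)` of the polynomial. The assignments are enumerated by a binary counter, whose increments take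
constant amortized time (`runs_nextPoint`, `runs_search`).

Without the positions of the `f_j`, each polynomial is scanned for a leading variable. The number
`R` remains unknown to the program; it works with the longest initial run of variables for which a
leading polynomial was found. This run has length at least `R`, and the time bounds decrease in `R`.

In the linear case all polynomials are affine. The `n + 1 - R` completed points whose free part is a
unit vector or zero span all common zeros of the `f_j` affinely. To each of them belongs the vector
of values `(p_1, …, p_m, 1)`. A combination of such vectors with last entry `1` is an affine
combination, hence again the vector of values at a point. So the system is satisfiable if and only
if `(0, …, 0, 1)` lies in the span (`mem_span_pointValues_of_satisfiable`,
`satisfiable_of_mem_span`). The span is built up by elimination with pivots among the first `m`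
entries. Reducing one vector takes at most `n` additions of vectors of length `m + 1`, that is `O(m
n)`, the same order as evaluating the system at one point (`runs_solveLinear`).

Running times are derived in a calculus of postconditions on step count and final state, in which
loops are paid for by a potential (`runs_while_amortized`). -/

namespace RAM

/-! ### A program logic with step counting -/

/-- Some run of `P` from `s` ends after `t` steps in a state `s'` with `K t s'`. -/
def Runs (P : Program) (s : State) (K : ℕ → State → Prop) : Prop :=
  ∃ t s', Exec P s t s' ∧ K t s'

theorem Runs.mono {P : Program} {s : State} {K K' : ℕ → State → Prop} (h : Runs P s K)
    (hK : ∀ t s', K t s' → K' t s') : Runs P s K' := by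
  obtain ⟨t, s', he, hk⟩ := h
  exact ⟨t, s', he, hK t s' hk⟩

/-- The rules for assignments, sequences and branches are equivalences, so rewriting with them
executes loop-free code symbolically. -/
theorem runs_const {x c : ℕ} {s : State} {K : ℕ → State → Prop} :
    Runs (.const x c) s K ↔ K 1 (s.setReg x c) :=
  ⟨by rintro ⟨_, _, ⟨⟩, h⟩; exact h, fun h => ⟨_, _, .const .., h⟩⟩

theorem runs_copy {x y : ℕ} {s : State} {K : ℕ → State → Prop} :
    Runs (.copy x y) s K ↔ K 1 (s.setReg x (s.reg y)) :=
  ⟨by rintro ⟨_, _, ⟨⟩, h⟩; exact h, fun h => ⟨_, _, .copy .., h⟩⟩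

theorem runs_inc {x : ℕ} {s : State} {K : ℕ → State → Prop} :
    Runs (.inc x) s K ↔ K 1 (s.setReg x (s.reg x + 1)) :=
  ⟨by rintro ⟨_, _, ⟨⟩, h⟩; exact h, fun h => ⟨_, _, .inc .., h⟩⟩

theorem runs_dec {x : ℕ} {s : State} {K : ℕ → State → Prop} :
    Runs (.dec x) s K ↔ K 1 (s.setReg x (s.reg x - 1)) :=
  ⟨by rintro ⟨_, _, ⟨⟩, h⟩; exact h, fun h => ⟨_, _, .dec .., h⟩⟩

theorem runs_load {x a y : ℕ} {s : State} {K : ℕ → State → Prop} :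
    Runs (.load x a y) s K ↔ K 1 (s.setReg x (s.mem a (s.reg y))) :=
  ⟨by rintro ⟨_, _, ⟨⟩, h⟩; exact h, fun h => ⟨_, _, .load .., h⟩⟩

theorem runs_store {a y x : ℕ} {s : State} {K : ℕ → State → Prop} :
    Runs (.store a y x) s K ↔ K 1 (s.setMem a (s.reg y) (s.reg x)) :=
  ⟨by rintro ⟨_, _, ⟨⟩, h⟩; exact h, fun h => ⟨_, _, .store .., h⟩⟩

theorem runs_seq {P Q : Program} {s : State} {K : ℕ → State → Prop} :
    Runs (.seq P Q) s K ↔ Runs P s fun t₁ s₁ => Runs Q s₁ fun t₂ s₂ => K (t₁ + t₂) s₂ := by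
  constructor
  · rintro ⟨_, _, ⟨⟩, h⟩
    exact ⟨_, _, ‹_›, _, _, ‹_›, h⟩
  · rintro ⟨_, _, h₁, _, _, h₂, h⟩
    exact ⟨_, _, .seq h₁ h₂, h⟩

theorem runs_ifLt {x y : ℕ} {P Q : Program} {s : State} {K : ℕ → State → Prop} :
    Runs (.ifLt x y P Q) s K ↔
      if s.reg x < s.reg y then Runs P s fun t s' => K (t + 1) s'
      else Runs Q s fun t s' => K (t + 1) s' := by
  split_ifs with hlt
  · constructor
    · rintro ⟨_, _, ⟨⟩, h⟩
      · exact ⟨_, _, ‹_›, h⟩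
      · exact absurd hlt ‹_›
    · rintro ⟨_, _, h₁, h⟩
      exact ⟨_, _, .ifTrue hlt h₁, h⟩
  · constructor
    · rintro ⟨_, _, ⟨⟩, h⟩
      · exact absurd ‹_› hlt
      · exact ⟨_, _, ‹_›, h⟩
    · rintro ⟨_, _, h₁, h⟩
      exact ⟨_, _, .ifFalse hlt h₁, h⟩

/-- The rule for loops: `I` is an invariant with a parameter `g`, and `B g` is a potential that
pays for the iterations. -/
theorem runs_while_amortized {σ : Type*} {x y : ℕ} {P : Program} (I : σ → State → Prop)
    (B : σ → ℕ)
    (hstep : ∀ g s, I g s → s.reg x < s.reg y →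
      Runs P s fun t s' => ∃ g', I g' s' ∧ t + 1 + B g' ≤ B g)
    {g : σ} {s : State} (h0 : I g s) :
    Runs (.whileLt x y P) s fun t s' =>
      ∃ g', I g' s' ∧ ¬ s'.reg x < s'.reg y ∧ t + B g' ≤ B g + 1 := by
  -- The test alone costs one step, so every iteration lowers the potential, and termination comes
  -- for free.
  induction hb : B g using Nat.strong_induction_on generalizing g s with
  | _ b ih =>
    by_cases hlt : s.reg x < s.reg y
    · obtain ⟨t₁, s₁, h₁, g', hI, ht⟩ := hstep g s h0 hlt
      obtain ⟨t₂, s₂, h₂, g'', hI', hx, ht'⟩ := ih (B g') (by omega) hI rfl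
      exact ⟨_, _, .whileTrue hlt h₁ h₂, g'', hI', hx, by omega⟩
    · exact ⟨_, _, .whileFalse hlt, g, h0, hlt, by omega⟩

/-- A potential that never drops below `1` still has a unit left for the final, failing test. -/
theorem runs_while {σ : Type*} {x y : ℕ} {P : Program} (I : σ → State → Prop) (B : σ → ℕ)
    (hB : ∀ g, 1 ≤ B g)
    (hstep : ∀ g s, I g s → s.reg x < s.reg y →
      Runs P s fun t s' => ∃ g', I g' s' ∧ t + 1 + B g' ≤ B g)
    {g : σ} {s : State} (h0 : I g s) :
    Runs (.whileLt x y P) s fun t s' => ∃ g', I g' s' ∧ ¬ s'.reg x < s'.reg y ∧ t ≤ B g :=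
  (runs_while_amortized I B hstep h0).mono fun t _ ⟨g', h, h', ht⟩ =>
    ⟨g', h, h', by have := hB g'; omega⟩

/-! ### State updates, frame conditions and array contents -/

@[simp] theorem reg_setReg (s : State) (x v y : ℕ) :
    (s.setReg x v).reg y = if y = x then v else s.reg y := by
  simp [State.setReg, Function.update_apply]

@[simp] theorem mem_setReg (s : State) (x v : ℕ) : (s.setReg x v).mem = s.mem := rfl

@[simp] theorem reg_setMem (s : State) (a i v : ℕ) : (s.setMem a i v).reg = s.reg := rfl

@[simp] theorem mem_setMem (s : State) (a i v b : ℕ) :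
    (s.setMem a i v).mem b = if b = a then Function.update (s.mem a) i v else s.mem b := by
  simp [State.setMem, Function.update_apply]

/-- Only registers with numbers in `[lo, hi)` have changed. -/
def SameRegs (lo hi : ℕ) (s s' : State) : Prop := ∀ r, r < lo ∨ hi ≤ r → s'.reg r = s.reg r

/-- Only the arrays in `A` have changed. -/
def SameMem (A : List ℕ) (s s' : State) : Prop := ∀ a, a ∉ A → s'.mem a = s.mem a

@[simp] theorem sameRegs_refl (lo hi : ℕ) (s : State) : SameRegs lo hi s s := fun _ _ => rfl

@[simp] theorem sameMem_refl (A : List ℕ) (s : State) : SameMem A s s := fun _ _ => rfl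

theorem SameRegs.trans {lo hi lo' hi' : ℕ} {s s' s'' : State} (h : SameRegs lo hi s s')
    (h' : SameRegs lo' hi' s' s'') (hl : lo ≤ lo') (hh : hi' ≤ hi) : SameRegs lo hi s s'' :=
  fun r hr => (h' r (by omega)).trans (h r hr)

theorem SameRegs.mono {lo hi lo' hi' : ℕ} {s s' : State} (h : SameRegs lo' hi' s s')
    (hl : lo ≤ lo') (hh : hi' ≤ hi) : SameRegs lo hi s s' :=
  fun r hr => h r (by omega)

theorem SameMem.trans {A A' : List ℕ} {s s' s'' : State} (h : SameMem A s s')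
    (h' : SameMem A' s' s'') (hA : A' ⊆ A) : SameMem A s s'' :=
  fun a ha => (h' a fun h => ha (hA h)).trans (h a ha)

@[simp] theorem sameRegs_setReg {lo hi x v : ℕ} {s s' : State} (h₁ : lo ≤ x) (h₂ : x < hi) :
    SameRegs lo hi s (s'.setReg x v) ↔ SameRegs lo hi s s' := by
  refine forall₂_congr fun r hr => ?_
  rw [reg_setReg, if_neg (by omega)]

@[simp] theorem sameRegs_setMem {lo hi a i v : ℕ} {s s' : State} :
    SameRegs lo hi s (s'.setMem a i v) ↔ SameRegs lo hi s s' := Iff.rfl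

@[simp] theorem sameMem_setReg {A : List ℕ} {x v : ℕ} {s s' : State} :
    SameMem A s (s'.setReg x v) ↔ SameMem A s s' := Iff.rfl

@[simp] theorem sameMem_setMem {A : List ℕ} {a i v : ℕ} {s s' : State} (h : a ∈ A) :
    SameMem A s (s'.setMem a i v) ↔ SameMem A s s' := by
  refine forall₂_congr fun b hb => ?_
  rw [mem_setMem, if_neg (by rintro rfl; exact hb h)]

/-- The array `M` holds the list `l` from position `p` on. -/
def At (M : ℕ → ℕ) : ℕ → List ℕ → Prop
  | _, [] => True
  | p, a :: l => M p = a ∧ At M (p + 1) l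

@[simp] theorem at_nil (M : ℕ → ℕ) (p : ℕ) : At M p [] := trivial

@[simp] theorem at_cons {M : ℕ → ℕ} {p a : ℕ} {l : List ℕ} :
    At M p (a :: l) ↔ M p = a ∧ At M (p + 1) l := Iff.rfl

@[simp] theorem at_append {M : ℕ → ℕ} {p : ℕ} {l l' : List ℕ} :
    At M p (l ++ l') ↔ At M p l ∧ At M (p + l.length) l' := by
  induction l generalizing p with
  | nil => simp
  | cons a l ih =>
    rw [List.cons_append, at_cons, at_cons, ih, and_assoc, List.length_cons,
      show p + 1 + l.length = p + (l.length + 1) by omega]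

theorem at_of_getD {M : ℕ → ℕ} {l : List ℕ} {p : ℕ} (h : ∀ i, M (p + i) = l.getD i 0) :
    At M p l := by
  induction l generalizing p with
  | nil => simp
  | cons a l ih =>
    refine ⟨by simpa using h 0, ih fun i => ?_⟩
    have := h (i + 1)
    rw [add_assoc, add_comm 1 i]
    simpa using this

end RAM

namespace SystemExpr

variable {n : ℕ}

/-! ### Evaluation of expressions -/

/-- The value of a literal under an assignment to variables `0, 1, 2, …`. -/
def litEval (a : ℕ → ZMod 2) (l : LitExpr n) : ZMod 2 := a l.1 + if l.2 then 1 else 0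

def clauseEval (a : ℕ → ZMod 2) (c : ClauseExpr n) : ZMod 2 := (c.map (litEval a)).prod

def polyEval (a : ℕ → ZMod 2) (p : PolyExpr n) : ZMod 2 := (p.map (clauseEval a)).sum

@[simp] theorem _root_.BoolPoly.eval_var (α : Fin n → ZMod 2) (i : Fin n) :
    BoolPoly.eval α (BoolPoly.var i) = α i := by
  simp [BoolPoly.eval, BoolPoly.var]

theorem eval_polyVal {α : Fin n → ZMod 2} {a : ℕ → ZMod 2} (h : ∀ i : Fin n, a i = α i)
    (p : PolyExpr n) : BoolPoly.eval α (polyVal p) = polyEval a p := by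
  simp only [polyVal, polyEval, map_list_sum, List.map_map]
  congr 1
  refine List.map_congr_left fun c _ => ?_
  simp only [Function.comp_apply, clauseVal, clauseEval, map_list_prod, List.map_map]
  congr 1
  refine List.map_congr_left fun l _ => ?_
  simp only [Function.comp_apply, litVal, litEval, map_add, BoolPoly.eval_var, h]
  split_ifs <;> simp

theorem polyEval_congr {a b : ℕ → ZMod 2} (h : ∀ i < n, a i = b i) (p : PolyExpr n) :
    polyEval a p = polyEval b p := by
  rw [← eval_polyVal (α := fun i => a i) (fun _ => rfl),
    ← eval_polyVal (α := fun i => a i) fun i => (h i i.2).symm]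

/-- Assignments are functions on all of `ℕ`, like the contents of an array; the entries from `n` on
do not matter, and a solution is extended by `0`. -/
theorem satisfiable_iff {S : SystemExpr n} :
    S.Satisfiable ↔ ∃ a : ℕ → ZMod 2, ∀ p ∈ S, polyEval a p = 0 := by
  constructor
  · rintro ⟨α, hα⟩
    refine ⟨fun i => if h : i < n then α ⟨i, h⟩ else 0, fun p hp => ?_⟩
    rw [← eval_polyVal (α := α) (by simp)]
    exact hα p hp
  · rintro ⟨a, ha⟩
    exact ⟨fun i => a i, fun p hp => by rw [eval_polyVal (a := a) fun _ => rfl]; exact ha p hp⟩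

/-- `p` is `x_j` plus a function of the variables after `x_j`. -/
def Leads (p : PolyExpr n) (j : ℕ) : Prop :=
  j < n ∧ ∀ a b : ℕ → ZMod 2, (∀ i, j < i → i < n → a i = b i) →
    polyEval a p + a j = polyEval b p + b j

theorem _root_.BoolPoly.eval_eq_of_mem_polysIn {s : Set (Fin n)} {α β : Fin n → ZMod 2}
    (h : ∀ i ∈ s, α i = β i) {q : BoolPoly n} (hq : q ∈ BoolPoly.polysIn s) :
    BoolPoly.eval α q = BoolPoly.eval β q := by
  induction hq using Algebra.adjoin_induction with
  | mem x hx =>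
    obtain ⟨i, hi, rfl⟩ := hx
    rw [BoolPoly.eval_var, BoolPoly.eval_var, h i hi]
  | algebraMap r =>
    have : ∀ γ : Fin n → ZMod 2, BoolPoly.eval γ (algebraMap (ZMod 2) _ r) = r := fun γ =>
      RingHom.congr_fun (RingHom.ext_zmod ((BoolPoly.eval γ).comp (algebraMap _ _))
        (RingHom.id _)) r
    rw [this, this]
  | add x y _ _ hx hy => rw [map_add, map_add, hx, hy]
  | mul x y _ _ hx hy => rw [map_mul, map_mul, hx, hy]

/-- From here on pivots matter only through `Leads`, a condition on values. It follows because an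
element of the subring of the later variables takes equal values at points that agree on these
variables. -/
theorem leads_of_isPivot {d : ℕ} {p : PolyExpr n} {j : Fin n}
    (h : BoolPoly.IsPivot d (polyVal p) j) : Leads p j := by
  refine ⟨j.2, fun a b hab => ?_⟩
  have := BoolPoly.eval_eq_of_mem_polysIn (α := fun i => a i) (β := fun i => b i)
    (fun i hi => hab i hi i.2) h.2.2.2.1
  simpa only [map_add, BoolPoly.eval_var, eval_polyVal (α := fun i => a i) (a := a) fun _ => rfl,
    eval_polyVal (α := fun i => b i) (a := b) fun _ => rfl] using this

theorem clauseEval_congr {a b : ℕ → ZMod 2} {c : ClauseExpr n}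
    (h : ∀ l ∈ c, a l.1 = b l.1) : clauseEval a c = clauseEval b c := by
  unfold clauseEval
  congr 1
  refine List.map_congr_left fun l hl => ?_
  simp [litEval, h l hl]

/-- For `i < j`, switching on the variable `i` alone, starting from zero, would change the value of
`p` because `i` leads, and keep it because `j` does. -/
theorem Leads.unique {p : PolyExpr n} {i j : ℕ} (hi : Leads p i) (hj : Leads p j) : i = j := by
  have key : ∀ {i j : ℕ}, Leads p i → Leads p j → ¬ i < j := fun {i j} hi hj hij => by
    have h1 := hi.2 (Pi.single i 1) 0 fun l hl _ => by simp [hl.ne']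
    have h2 := hj.2 (Pi.single i 1) 0 fun l hl _ => by simp [(hij.trans hl).ne']
    simp [hij.ne'] at h1 h2
    rw [h2] at h1
    simp at h1
  rcases lt_trichotomy i j with h | h | h
  exacts [absurd h (key hi hj), h, absurd h (key hj hi)]

/-- Solutions of a triangular system are determined by the free variables. -/
theorem eq_of_leads {R : ℕ} {g : ℕ → PolyExpr n} (hg : ∀ j < R, Leads (g j) j)
    {a b : ℕ → ZMod 2} (ha : ∀ j < R, polyEval a (g j) = 0) (hb : ∀ j < R, polyEval b (g j) = 0)
    (hab : ∀ i, R ≤ i → i < n → a i = b i) : ∀ i < n, a i = b i := by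
  -- Downward induction on the variable, with `e` its distance from `n`: `Leads` determines it from
  -- the variables after it.
  have : ∀ e i, n - i = e → i < n → a i = b i := by
    intro e
    induction e using Nat.strong_induction_on with
    | _ e ih =>
      intro i he hi
      by_cases hR : i < R
      · have := (hg i hR).2 a b fun l hl hln => ih (n - l) (by omega) l rfl hln
        simpa [ha i hR, hb i hR] using this
      · exact hab i (by omega) hi
  exact fun i hi => this _ i rfl hi

end SystemExpr

theorem ZMod.eq_zero_or_one (v : ZMod 2) : v = 0 ∨ v = 1 := by
  revert v; decide

@[simp] theorem ZMod.val_one_two : (1 : ZMod 2).val = 1 := rfl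

namespace RAM

open SystemExpr

variable {n : ℕ}

/-! ### Evaluating a polynomial

Array `0` holds the system, and array `3` holds an assignment. -/

/-- Multiply register `15` by the literal at position `10`. -/
def litStep : Program :=
  .seq (.load 13 0 10) <| .seq (.inc 10) <| .seq (.load 14 0 10) <| .seq (.inc 10) <|
  .seq (.load 13 3 13) <|
  -- The literal vanishes exactly when its variable equals its sign bit, that is, when both
  -- comparisons fail; only then the product becomes `0`.
  .seq (.ifLt 13 14 (.const 13 0) <| .ifLt 14 13 (.const 13 0) <| .const 15 0) <| .dec 12

/-- Add the clause at position `10` to register `11`. -/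
def clauseStep : Program :=
  .seq (.load 12 0 10) <| .seq (.inc 10) <| .seq (.const 15 1) <|
  .seq (.whileLt 19 12 litStep) <|
  .seq (.ifLt 19 15 (.ifLt 19 11 (.const 11 0) (.const 11 1)) (.const 13 0)) <| .dec 16

/-- Evaluate the polynomial at position `10`; the value goes to register `11`. -/
def evalPoly : Program :=
  .seq (.const 19 0) <| .seq (.const 11 0) <| .seq (.load 16 0 10) <| .seq (.inc 10) <|
  .whileLt 19 16 clauseStep

theorem runs_litStep {a : ℕ → ZMod 2} {l : LitExpr n} {w : ZMod 2} {s : State}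
    (hl : At (s.mem 0) (s.reg 10) (encLit l)) (ha : s.mem 3 = fun i => (a i).val)
    (hw : s.reg 15 = w.val) :
    Runs litStep s fun t s' => t ≤ 10 ∧ s'.reg 10 = s.reg 10 + 2 ∧
      s'.reg 15 = (w * litEval a l).val ∧ s'.reg 12 = s.reg 12 - 1 ∧ s'.reg 11 = s.reg 11 ∧
      s'.reg 16 = s.reg 16 ∧ s'.reg 19 = s.reg 19 ∧ s'.mem = s.mem ∧ SameRegs 10 20 s s' := by
  obtain ⟨x, b⟩ := l
  simp only [encLit, at_cons, at_nil, and_true] at hl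
  simp only [litStep, runs_seq, runs_const, runs_load, runs_inc, runs_dec, runs_ifLt, litEval]
  rcases ZMod.eq_zero_or_one (a x) with h | h <;> cases b <;>
    simp [hl, ha, hw, h, CharTwo.add_self_eq_zero]

/-- Time is measured by the length of the encoding: such bounds add up over clauses and polynomials,
and an empty clause is paid for by its length entry. -/
theorem runs_clauseStep {a : ℕ → ZMod 2} {c : ClauseExpr n} {v : ZMod 2} {s : State}
    (hc : At (s.mem 0) (s.reg 10) (encClause c)) (ha : s.mem 3 = fun i => (a i).val)
    (hv : s.reg 11 = v.val) (h0 : s.reg 19 = 0) :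
    Runs clauseStep s fun t s' => t ≤ 10 * (encClause c).length ∧
      s'.reg 10 = s.reg 10 + (encClause c).length ∧
      s'.reg 11 = (v + clauseEval a c).val ∧ s'.reg 16 = s.reg 16 - 1 ∧ s'.reg 19 = 0 ∧
      s'.mem = s.mem ∧ SameRegs 10 20 s s' := by
  simp only [encClause, at_cons] at hc
  simp only [clauseStep, runs_seq, runs_const, runs_load, runs_inc]
  -- The loop parameter consists of the literals still to be read and the product of those already
  -- read. Later loops over lists follow this pattern.
  refine (runs_while (σ := List (LitExpr n) × ZMod 2)
    (fun g s' => At (s'.mem 0) (s'.reg 10) (g.1.flatMap encLit) ∧ s'.reg 12 = g.1.length ∧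
      s'.reg 15 = g.2.val ∧ g.2 * clauseEval a g.1 = clauseEval a c ∧
      s'.reg 10 + (g.1.flatMap encLit).length = s.reg 10 + (encClause c).length ∧
      s'.reg 11 = v.val ∧ s'.reg 16 = s.reg 16 ∧ s'.reg 19 = 0 ∧
      s'.mem = s.mem ∧ SameRegs 10 20 s s')
    (fun g => 11 * g.1.length + 1) (fun g => by omega) ?_ (g := (c, 1)) ?_).mono ?_
  · rintro ⟨L, w⟩ s₁ ⟨h1, h2, h3, h4, h5, h6, h7, h8, h9, h10⟩ hlt
    cases L with
    | nil => simp [h2, h8] at hlt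
    | cons l L =>
      simp only [List.flatMap_cons, at_append, List.length_append, List.length_cons] at *
      refine (runs_litStep h1.1 (by rw [h9, ha]) h3).mono ?_
      rintro t s₂ ⟨k1, k2, k3, k4, k5, k6, k7, k8, k9⟩
      refine ⟨(L, w * litEval a l), ⟨?_, by dsimp only; omega, k3, ?_, ?_, by omega, by omega,
        by omega, k8.trans h9, h10.trans k9 le_rfl le_rfl⟩, by dsimp only; omega⟩
      · rw [k8, k2]
        exact h1.2
      · rw [← h4]
        simp [clauseEval, mul_assoc]
      · simp only [encLit, List.length_cons, List.length_nil] at *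
        omega
  · simp [hc, hv, h0, encClause]
    omega
  · rintro t s₁ ⟨⟨L, w⟩, ⟨h1, h2, h3, h4, h5, h6, h7, h8, h9, h10⟩, hlt, ht⟩
    obtain rfl : L = [] := by
      rw [← List.length_eq_zero_iff]
      simp only at *
      omega
    simp only [List.length_nil, clauseEval, List.map_nil, List.prod_nil, mul_one,
      List.flatMap_nil] at *
    have hlen : (encClause c).length = 2 * c.length + 1 := by
      simp [List.length_flatMap, encClause, encLit, mul_comm]
    simp only [runs_ifLt, runs_const, runs_dec, ← h4]
    rcases ZMod.eq_zero_or_one w with h | h <;> rcases ZMod.eq_zero_or_one v with h' | h' <;>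
      simp [h, h', h3, h6, h7, h8, h9, h10, CharTwo.add_self_eq_zero] <;> omega

/-- Register `10` ends right behind the polynomial, so repeated calls walk through the whole system.
-/
theorem runs_evalPoly {a : ℕ → ZMod 2} {p : PolyExpr n} {s : State}
    (hp : At (s.mem 0) (s.reg 10) (encPoly p)) (ha : s.mem 3 = fun i => (a i).val) :
    Runs evalPoly s fun t s' => t ≤ 20 * (encPoly p).length ∧
      s'.reg 10 = s.reg 10 + (encPoly p).length ∧ s'.reg 11 = (polyEval a p).val ∧
      s'.mem = s.mem ∧ SameRegs 10 20 s s' := by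
  simp only [encPoly, at_cons] at hp
  simp only [evalPoly, runs_seq, runs_const, runs_load, runs_inc]
  refine (runs_while (σ := List (ClauseExpr n) × ZMod 2)
    (fun g s' => At (s'.mem 0) (s'.reg 10) (g.1.flatMap encClause) ∧ s'.reg 16 = g.1.length ∧
      s'.reg 11 = g.2.val ∧ g.2 + polyEval a g.1 = polyEval a p ∧
      s'.reg 10 + (g.1.flatMap encClause).length = s.reg 10 + (encPoly p).length ∧
      s'.reg 19 = 0 ∧ s'.mem = s.mem ∧ SameRegs 10 20 s s')
    (fun g => 11 * (g.1.flatMap encClause).length + 1) (fun g => by omega) ?_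
    (g := (p, 0)) ?_).mono ?_
  · rintro ⟨L, w⟩ s₁ ⟨h1, h2, h3, h4, h5, h6, h7, h8⟩ hlt
    cases L with
    | nil => simp [h2, h6] at hlt
    | cons c L =>
      simp only [List.flatMap_cons, at_append, List.length_append, List.length_cons] at *
      refine (runs_clauseStep h1.1 (by rw [h7, ha]) h3 h6).mono ?_
      rintro t s₂ ⟨k1, k2, k3, k4, k5, k6, k7⟩
      refine ⟨(L, w + clauseEval a c), ⟨?_, by dsimp only; omega, k3, ?_, by dsimp only; omega, k5,
        k6.trans h7, h8.trans k7 le_rfl le_rfl⟩, ?_⟩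
      · rw [k6, k2]
        exact h1.2
      · rw [← h4]
        simp [polyEval, add_assoc]
      · have : 1 ≤ (encClause c).length := by simp [encClause]
        simp only
        omega
  · simp [hp, encPoly]
    omega
  · rintro t s₁ ⟨⟨L, w⟩, ⟨h1, h2, h3, h4, h5, h6, h7, h8⟩, hlt, ht⟩
    obtain rfl : L = [] := by
      rw [← List.length_eq_zero_iff]
      simp only at *
      omega
    have hlen : (encPoly p).length = (p.flatMap encClause).length + 1 := by simp [encPoly]
    simp only [List.length_nil, polyEval, List.map_nil, List.sum_nil, add_zero,
      List.flatMap_nil] at *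
    exact ⟨by omega, h5, by rw [h3, h4], h7, h8⟩

/-! ### Completing an assignment and evaluating the system -/

/-- Array `0` holds the system `S`, and array `4` holds the positions of polynomials `g 0, …,
g (R - 1)` of `S` that lead with the variables `0, …, R - 1`. -/
structure Ready (S : SystemExpr n) (R : ℕ) (g : ℕ → PolyExpr n) (s : State) : Prop where
  sys : At (s.mem 0) 2 (S.flatMap encPoly)
  len : s.reg 41 = S.length
  cnt : s.reg 42 = R
  le : R ≤ n
  leads : ∀ j < R, Leads (g j) j
  mem : ∀ j < R, g j ∈ S
  pos : ∀ j < R, At (s.mem 0) (s.mem 4 j) (encPoly (g j))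

theorem Ready.of_same {S : SystemExpr n} {R : ℕ} {g : ℕ → PolyExpr n} {s s' : State}
    (h : Ready S R g s) (h41 : s'.reg 41 = s.reg 41) (h42 : s'.reg 42 = s.reg 42)
    (h0 : s'.mem 0 = s.mem 0) (h4 : s'.mem 4 = s.mem 4) : Ready S R g s' where
  sys := h0 ▸ h.sys
  len := h41.trans h.len
  cnt := h42.trans h.cnt
  le := h.le
  leads := h.leads
  mem := h.mem
  pos := by rw [h0, h4]; exact h.pos

/-- By `Leads.unique`, polynomials that lead with different variables are different, so the map `g`
is injective on the first `R` indices. This is what bounds the cost of back substitution by that of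
evaluating the system. -/
theorem Ready.cnt_le {S : SystemExpr n} {R : ℕ} {g : ℕ → PolyExpr n} {s : State}
    (h : Ready S R g s) : R ≤ S.length := by
  classical
  calc R = ((Finset.range R).image g).card := by
        rw [Finset.card_image_of_injOn, Finset.card_range]
        intro i hi j hj hij
        have hi' := h.leads i (by simpa using hi)
        rw [hij] at hi'
        exact hi'.unique (h.leads j (by simpa using hj))
    _ ≤ S.toFinset.card := Finset.card_le_card fun p hp => by
        obtain ⟨j, hj, rfl⟩ := Finset.mem_image.1 hp
        exact List.mem_toFinset.2 (h.mem j (by simpa using hj))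
    _ ≤ S.length := S.toFinset_card_le

/-- Compute the variables before the one in register `42` from the later ones. -/
def backSubst : Program :=
  .seq (.const 29 0) <| .seq (.copy 20 42) <| .whileLt 29 20 <|
  .seq (.dec 20) <| .seq (.store 3 20 29) <| .seq (.load 10 4 20) <| .seq evalPoly <|
  .store 3 20 11

/-- Evaluate the system and write the values to array `5`; register `27` becomes `0` if all values
are `0`. -/
def evalSystem : Program :=
  .seq (.const 29 0) <| .seq (.const 10 2) <| .seq (.const 20 0) <| .seq (.const 27 0) <|
  .whileLt 20 41 <|
  .seq evalPoly <| .seq (.store 5 20 11) <|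
  .seq (.ifLt 29 11 (.const 27 1) (.const 28 0)) <| .inc 20

/-- With `x_j` set to `0`, the polynomial `g j` takes the value of its part in later variables, and
this is the value that `x_j` must receive. The equations solved before have later leading variables,
so their values do not depend on `x_j`. -/
theorem runs_backSubst {S : SystemExpr n} {R : ℕ} {g : ℕ → PolyExpr n} {s : State} {E : ℕ}
    (hE : ∀ p ∈ S, (encPoly p).length ≤ E) (hs : Ready S R g s) {a : ℕ → ZMod 2}
    (ha : s.mem 3 = fun i => (a i).val) :
    Runs backSubst s fun t s' => t ≤ R * (20 * E + 5) + 3 ∧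
      (∃ b : ℕ → ZMod 2, s'.mem 3 = (fun i => (b i).val) ∧ (∀ i, R ≤ i → b i = a i) ∧
        ∀ j < R, polyEval b (g j) = 0) ∧
      SameRegs 10 30 s s' ∧ SameMem [3] s s' := by
  simp only [backSubst, runs_seq, runs_const, runs_copy]
  refine (runs_while (σ := ℕ)
    (fun j s' => j ≤ R ∧ s'.reg 29 = 0 ∧ s'.reg 20 = j ∧
      (∃ b : ℕ → ZMod 2, s'.mem 3 = (fun i => (b i).val) ∧ (∀ i, R ≤ i → b i = a i) ∧
        ∀ l, j ≤ l → l < R → polyEval b (g l) = 0) ∧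
      SameRegs 10 30 s s' ∧ SameMem [3] s s')
    (fun j => j * (20 * E + 5) + 1) (fun g => by omega) ?_ (g := R) ?_).mono ?_
  · rintro j s₁ ⟨h1, h2, h3, ⟨b, h4, h5, h6⟩, h7, h8⟩ hlt
    obtain ⟨j, rfl⟩ : ∃ j', j = j' + 1 := ⟨j - 1, by omega⟩
    have hjR : j < R := by omega
    simp only [runs_seq, runs_dec, runs_store, runs_load]
    have hM : s₁.mem 0 = s.mem 0 := h8 0 (by simp)
    have hM4 : s₁.mem 4 = s.mem 4 := h8 4 (by simp)
    refine (runs_evalPoly (a := Function.update b j 0) (p := g j) ?_ ?_).mono ?_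
    · simpa [hM, hM4, h3] using hs.pos j hjR
    · ext i
      simp [h2, h3, h4, Function.update_apply]
      split_ifs <;> simp
    · rintro t s₂ ⟨k1, k2, k3, k4, k5⟩
      have h20 : s₂.reg 20 = j := by
        rw [k5 20 (by omega)]
        simp [h3]
      have h29 : s₂.reg 29 = 0 := by
        rw [k5 29 (by omega)]
        simp [h2]
      refine ⟨j, ⟨hjR.le, h29, h20,
        ⟨Function.update b j (polyEval (Function.update b j 0) (g j)), ?_, ?_, ?_⟩, ?_, ?_⟩, ?_⟩
      · ext i
        simp [k4, h3, h2, h4, h20, k3, Function.update_apply]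
        split_ifs <;> simp
      · intro i hi
        rw [Function.update_of_ne (by omega), h5 i hi]
      · intro l hl hlR
        rcases hl.eq_or_lt with rfl | hl
        · have := (hs.leads j hjR).2
            (Function.update b j (polyEval (Function.update b j 0) (g j)))
            (Function.update b j 0) fun i hi _ => by
              rw [Function.update_of_ne hi.ne', Function.update_of_ne hi.ne']
          simpa using this
        · have := (hs.leads l hlR).2
            (Function.update b j (polyEval (Function.update b j 0) (g j))) b fun i hi _ => by
              rw [Function.update_of_ne (by omega)]
          rw [Function.update_of_ne (by omega), h6 l hl hlR] at this
          simpa using this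
      · rw [sameRegs_setMem]
        exact SameRegs.trans (by simpa using h7) k5 (by norm_num) (by norm_num)
      · rw [sameMem_setMem (by simp)]
        intro c hc
        simp only [List.mem_singleton] at hc
        simp [k4, hc, h8 c (by simpa using hc)]
      · have := hE _ (hs.mem j hjR)
        rw [add_mul]
        omega
  · refine ⟨le_rfl, by simp, by simp [hs.cnt], ⟨a, by simpa using ha, fun _ _ => rfl, ?_⟩,
      by simp, by simp⟩
    intro l hl hl'
    omega
  · rintro t s₁ ⟨j, ⟨h1, h2, h3, ⟨b, h4, h5, h6⟩, h7, h8⟩, hlt, ht⟩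
    obtain rfl : j = 0 := by omega
    have : 0 * (20 * E + 5) ≤ R * (20 * E + 5) := by simp
    exact ⟨by omega, ⟨b, h4, h5, fun l hl => h6 l (Nat.zero_le l) hl⟩, h7, h8⟩

/-- Exhaustive search reads only register `27`; the values in array `5` serve the elimination for
linear systems. -/
theorem runs_evalSystem {S : SystemExpr n} {s : State} {E : ℕ}
    (hE : ∀ p ∈ S, (encPoly p).length ≤ E) (hS : At (s.mem 0) 2 (S.flatMap encPoly))
    (hm : s.reg 41 = S.length) {a : ℕ → ZMod 2}
    (ha : s.mem 3 = fun i => (a i).val) :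
    Runs evalSystem s fun t s' => t ≤ S.length * (20 * E + 5) + 5 ∧
      (∀ i < S.length, s'.mem 5 i = (polyEval a (S.getD i [])).val) ∧
      (∀ i, S.length ≤ i → s'.mem 5 i = s.mem 5 i) ∧
      (s'.reg 27 = 0 ↔ ∀ p ∈ S, polyEval a p = 0) ∧
      SameRegs 10 30 s s' ∧ SameMem [5] s s' := by
  simp only [evalSystem, runs_seq, runs_const]
  refine (runs_while (σ := SystemExpr n × SystemExpr n)
    (fun g s' => g.1 ++ g.2 = S ∧ s'.reg 29 = 0 ∧ s'.reg 20 = g.1.length ∧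
      At (s'.mem 0) (s'.reg 10) (g.2.flatMap encPoly) ∧
      (∀ i < g.1.length, s'.mem 5 i = (polyEval a (S.getD i [])).val) ∧
      (∀ i, g.1.length ≤ i → s'.mem 5 i = s.mem 5 i) ∧
      (s'.reg 27 = 0 ↔ ∀ p ∈ g.1, polyEval a p = 0) ∧
      SameRegs 10 30 s s' ∧ SameMem [5] s s')
    (fun g => g.2.length * (20 * E + 5) + 1) (fun g => by omega) ?_ (g := ([], S)) ?_).mono ?_
  · rintro ⟨pre, L⟩ s₁ ⟨h1, h2, h3, h4, h5, h6, h7, h8, h9⟩ hlt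
    dsimp only at *
    cases L with
    | nil =>
      rw [h8 41 (by omega), h3, hm, ← h1] at hlt
      simp at hlt
    | cons p L =>
      have hpS : p ∈ S := by simp [← h1]
      have hget : S.getD pre.length [] = p := by simp [← h1]
      simp only [List.flatMap_cons, at_append] at h4
      simp only [runs_seq, runs_store, runs_ifLt, runs_const, runs_inc]
      refine (runs_evalPoly h4.1 (by rw [h9 3 (by simp), ha])).mono ?_
      rintro t s₂ ⟨k1, k2, k3, k4, k5⟩
      have h20 : s₂.reg 20 = pre.length := by rw [k5 20 (by omega), h3]
      have h29 : s₂.reg 29 = 0 := by rw [k5 29 (by omega), h2]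
      have h27 : s₂.reg 27 = s₁.reg 27 := k5 27 (by omega)
      have hE' := hE p hpS
      have hR := h8.trans k5 (by norm_num) (by norm_num)
      have hM := h9.trans (A' := []) (fun a _ => by rw [k4]) (by simp)
      have hg : (L.length + 1) * (20 * E + 5) = L.length * (20 * E + 5) + (20 * E + 5) := by ring
      have hat : At (s₂.mem 0) (s₂.reg 10) (L.flatMap encPoly) := by
        rw [k4, k2]
        exact h4.2
      have ha5 : ∀ i < pre.length + 1,
          Function.update (s₂.mem 5) pre.length (polyEval a p).val i =
            (polyEval a (S.getD i [])).val := fun i hi => by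
        rw [Function.update_apply]
        split_ifs with hi'
        · rw [hi', hget]
        · rw [k4, h5 i (by omega)]
      have hb5 : ∀ i, pre.length + 1 ≤ i →
          Function.update (s₂.mem 5) pre.length (polyEval a p).val i = s.mem 5 i := fun i hi => by
        rw [Function.update_of_ne (by omega), k4, h6 i (by omega)]
      have hS' : (pre ++ [p]) ++ L = S := by simp [← h1]
      rw [reg_setMem, h29, k3, h20]
      rcases ZMod.eq_zero_or_one (polyEval a p) with hv | hv
      · rw [hv] at ha5 hb5
        simp only [hv, ZMod.val_zero, lt_irrefl, if_false]
        refine ⟨(pre ++ [p], L), ⟨hS', ?_, ?_, ?_, ?_, ?_, ?_, ?_, ?_⟩, ?_⟩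
        · simp [h29]
        · simp [h20]
        · simpa using hat
        · simpa using ha5
        · simpa using hb5
        · simpa [h27, or_imp, forall_and, hv] using h7
        · simpa using hR
        · simpa using hM
        · simp only [List.length_cons] at *
          omega
      · rw [hv] at ha5 hb5
        simp only [hv, ZMod.val_one_two, Nat.zero_lt_one, if_true]
        refine ⟨(pre ++ [p], L), ⟨hS', ?_, ?_, ?_, ?_, ?_, ?_, ?_, ?_⟩, ?_⟩
        · simp [h29]
        · simp [h20]
        · simpa using hat
        · simpa using ha5
        · simpa using hb5
        · simp [or_imp, forall_and, hv]
        · simpa using hR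
        · simpa using hM
        · simp only [List.length_cons] at *
          omega
  · simp [hS]
  · rintro t s₁ ⟨⟨pre, L⟩, ⟨h1, h2, h3, h4, h5, h6, h7, h8, h9⟩, hlt, ht⟩
    dsimp only at *
    rw [h8 41 (by omega), h3, hm, ← h1] at hlt
    obtain rfl : L = [] := by
      rw [← List.length_eq_zero_iff]
      simp only [List.length_append] at hlt
      omega
    obtain rfl : pre = S := by simpa using h1
    refine ⟨?_, h5, h6, h7, h8, h9⟩
    omega

/-- Compute the variables before the one in register `42` from the later ones, and evaluate the
system. -/
def evalAt : Program := .seq backSubst evalSystem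

/-- Since `R ≤ S.length`, back substitution and test together evaluate at most `2 * S.length`
polynomials. The old contents of the first `R` variables play no role. -/
theorem runs_evalAt {S : SystemExpr n} {R : ℕ} {g : ℕ → PolyExpr n} {s : State} {E : ℕ}
    (hm : 1 ≤ S.length) (hE1 : 1 ≤ E) (hE : ∀ p ∈ S, (encPoly p).length ≤ E)
    (hs : Ready S R g s) {a : ℕ → ZMod 2} (ha : s.mem 3 = fun i => (a i).val) :
    Runs evalAt s fun t s' => t ≤ 60 * (S.length * E) ∧
      ∃ b : ℕ → ZMod 2, s'.mem 3 = (fun i => (b i).val) ∧ (∀ i, R ≤ i → b i = a i) ∧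
        (∀ j < R, polyEval b (g j) = 0) ∧
        (∀ i < S.length, s'.mem 5 i = (polyEval b (S.getD i [])).val) ∧
        (∀ i, S.length ≤ i → s'.mem 5 i = s.mem 5 i) ∧
        (s'.reg 27 = 0 ↔ ∀ p ∈ S, polyEval b p = 0) ∧
        SameRegs 10 30 s s' ∧ SameMem [3, 5] s s' := by
  rw [evalAt, runs_seq]
  refine (runs_backSubst hE hs ha).mono ?_
  rintro t₁ s₁ ⟨h1, ⟨b, h2, h3, h4⟩, h5, h6⟩
  refine (runs_evalSystem hE (by rw [h6 0 (by simp)]; exact hs.sys)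
    (by rw [h5 41 (by omega), hs.len]) h2).mono ?_
  rintro t₂ s₂ ⟨k1, k2, k3, k4, k5, k6⟩
  refine ⟨?_, b, by rw [k6 3 (by simp), h2], h3, h4, k2, fun i hi => ?_, k4,
    h5.trans k5 le_rfl le_rfl, SameMem.trans (A := [3, 5]) (fun a ha => h6 a ?_) k6 (by simp)⟩
  · have hR := Nat.mul_le_mul_right (20 * E + 5) hs.cnt_le
    have h' : S.length ≤ S.length * E := Nat.le_mul_of_pos_right _ hE1
    have h'' : S.length * (20 * E + 5) = 20 * (S.length * E) + 5 * S.length := by ring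
    omega
  · rw [k3 i hi, h6 5 (by simp)]
  · simp only [List.mem_cons, List.not_mem_nil, or_false] at *
    omega

end RAM

/-! ### Binary numbers and their digits -/

/-- The weighted number of ones among `a R, …, a (R + q - 1)`. -/
def bitSum (w : ℕ → ℕ) (R q : ℕ) (a : ℕ → ZMod 2) : ℕ :=
  ∑ i ∈ Finset.range q, (a (R + i)).val * w i

/-- Two weights are used: `2 ^ ·` gives the number with these binary digits, which measures
progress, and `1` gives the number of ones, which serves as potential. -/
theorem bitSum_update (w : ℕ → ℕ) {R q k : ℕ} (hk : k < q) (a : ℕ → ZMod 2) (v : ZMod 2) :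
    bitSum w R q (Function.update a (R + k) v) + (a (R + k)).val * w k =
      bitSum w R q a + v.val * w k := by
  have hk' : k ∈ Finset.range q := by simpa using hk
  unfold bitSum
  rw [← Finset.add_sum_erase _ _ hk', ← Finset.add_sum_erase _ _ hk',
    Finset.sum_congr rfl (g := fun i => (a (R + i)).val * w i) fun i hi => by
      rw [Function.update_of_ne (by have := Finset.ne_of_mem_erase hi; omega)]]
  rw [Function.update_self]
  ring

theorem bitSum_congr (w : ℕ → ℕ) {R q : ℕ} {a b : ℕ → ZMod 2}
    (h : ∀ i < q, a (R + i) = b (R + i)) : bitSum w R q a = bitSum w R q b :=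
  Finset.sum_congr rfl fun i hi => by rw [h i (by simpa using hi)]

theorem bitSum_two_pow_lt (R q : ℕ) (a : ℕ → ZMod 2) : bitSum (2 ^ ·) R q a < 2 ^ q := by
  induction q with
  | zero => simp [bitSum]
  | succ q ih =>
    have h1 : (a (R + q)).val ≤ 1 := Nat.lt_succ_iff.1 (ZMod.val_lt _)
    have h2 := Nat.mul_le_mul_right (2 ^ q) h1
    unfold bitSum at *
    rw [Finset.sum_range_succ, pow_succ]
    dsimp only at *
    omega

theorem eq_of_bitSum_two_pow_eq {R q : ℕ} {a b : ℕ → ZMod 2}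
    (h : bitSum (2 ^ ·) R q a = bitSum (2 ^ ·) R q b) : ∀ i < q, a (R + i) = b (R + i) := by
  induction q with
  | zero => simp
  | succ q ih =>
    have ha := bitSum_two_pow_lt R q a
    have hb := bitSum_two_pow_lt R q b
    have hs : ∀ c : ℕ → ZMod 2, bitSum (2 ^ ·) R (q + 1) c =
        bitSum (2 ^ ·) R q c + (c (R + q)).val * 2 ^ q := fun c => by
      unfold bitSum
      rw [Finset.sum_range_succ]
    rw [hs, hs] at h
    have hq : a (R + q) = b (R + q) := by
      rcases ZMod.eq_zero_or_one (a (R + q)) with h1 | h1 <;>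
        rcases ZMod.eq_zero_or_one (b (R + q)) with h2 | h2 <;>
        simp only [h1, h2, ZMod.val_zero, ZMod.val_one_two] at h ⊢ <;> omega
    intro i hi
    rcases (Nat.lt_succ_iff.1 hi).eq_or_lt with rfl | hi
    · exact hq
    · exact ih (by rw [hq] at h; omega) i hi

namespace RAM

open SystemExpr

variable {n : ℕ}

/-! ### Exhaustive search over the free variables -/

/-- Go to the next assignment of the variables from the one in register `42` on; register `33`
becomes `0` if there is none. -/
def nextPoint : Program :=
  .seq (.copy 30 42) <| .seq (.const 39 0) <| .seq (.const 38 1) <| .seq (.const 33 1) <|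
  .seq (.const 31 1) <| .whileLt 39 31 <|
  .ifLt 30 40
    (.seq (.load 32 3 30) <| .ifLt 39 32
      (.seq (.store 3 30 39) <| .inc 30)
      (.seq (.store 3 30 38) <| .const 31 0))
    (.seq (.const 31 0) <| .const 33 0)

/-- Each round of the carry loop turns a one into a zero and so releases `7` units of potential,
which cover the round. Beyond the change of potential an increment thus costs at most a constant. -/
theorem runs_nextPoint {R q : ℕ} {s : State} {a : ℕ → ZMod 2}
    (ha : s.mem 3 = fun i => (a i).val) (hR : s.reg 42 = R) (hn : s.reg 40 = R + q) :
    Runs nextPoint s fun t s' => ∃ b : ℕ → ZMod 2, s'.mem 3 = (fun i => (b i).val) ∧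
      t + 7 * bitSum 1 R q b ≤ 7 * bitSum 1 R q a + 30 ∧
      (s'.reg 33 = 1 ∧ bitSum (2 ^ ·) R q b = bitSum (2 ^ ·) R q a + 1 ∨
        s'.reg 33 = 0 ∧ bitSum (2 ^ ·) R q a + 1 = 2 ^ q) ∧
      s'.reg 39 = 0 ∧ SameRegs 30 40 s s' ∧ SameMem [3] s s' := by
  simp only [nextPoint, runs_seq, runs_const, runs_copy]
  refine (runs_while_amortized (σ := ℕ × (ℕ → ZMod 2) × Bool)
    (fun g s' => s'.mem 3 = (fun i => (g.2.1 i).val) ∧ s'.reg 39 = 0 ∧ s'.reg 38 = 1 ∧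
      SameRegs 30 40 s s' ∧ SameMem [3] s s' ∧
      if g.2.2 then
        s'.reg 31 = 1 ∧ s'.reg 33 = 1 ∧ s'.reg 30 = R + g.1 ∧ g.1 ≤ q ∧
          (∀ l < g.1, g.2.1 (R + l) = 0) ∧
          -- The carry: the first `g.1` digits have been cleared, and `2 ^ g.1` has yet to be added.
          bitSum (2 ^ ·) R q g.2.1 + 2 ^ g.1 = bitSum (2 ^ ·) R q a + 1
      else s'.reg 31 = 0 ∧
        (s'.reg 33 = 1 ∧ bitSum (2 ^ ·) R q g.2.1 = bitSum (2 ^ ·) R q a + 1 ∨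
          s'.reg 33 = 0 ∧ bitSum (2 ^ ·) R q a + 1 = 2 ^ q))
    (fun g => 7 * bitSum 1 R q g.2.1 + if g.2.2 then 20 else 0) ?_ (g := (0, a, true)) ?_).mono ?_
  · rintro ⟨k, b, go⟩ s₁ ⟨h1, h2, h3, h4, h5, h6⟩ hlt
    dsimp only at *
    cases go with
    | false => simp [h2, h6.1] at hlt
    | true =>
      obtain ⟨h6, h7, h8, h9, h10, h11⟩ := h6
      have h40 : s₁.reg 40 = R + q := by rw [h4 40 (by omega), hn]
      simp only [runs_ifLt, runs_seq, runs_store, runs_load, runs_const, runs_inc]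
      rw [h8, h40]
      rcases h9.eq_or_lt with rfl | hk
      · rw [if_neg (by omega)]
        -- The carry has passed the last digit, so all digits are `0` now and the old number was `2
        -- ^ q - 1`.
        have h0 : bitSum (2 ^ ·) R k b = 0 :=
          Finset.sum_eq_zero fun i hi => by rw [h10 i (by simpa using hi)]; simp
        refine ⟨(k, b, false), ⟨by simpa using h1, by simpa using h2, by simpa using h3,
          by simpa using h4, by simpa using h5, ?_⟩, by simp; omega⟩
        simp
        omega
      · rw [if_pos (by omega)]
        have hu1 := bitSum_update 1 hk b (R := R)
        have hu2 := bitSum_update (2 ^ ·) hk b (R := R)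
        rcases ZMod.eq_zero_or_one (b (R + k)) with hb | hb
        · have hif : ¬ (s₁.setReg 32 (s₁.mem 3 (R + k))).reg 39 <
              (s₁.setReg 32 (s₁.mem 3 (R + k))).reg 32 := by simp [h1, hb]
          rw [if_neg hif]
          refine ⟨(k, Function.update b (R + k) 1, false), ⟨?_, by simpa using h2,
            by simpa using h3, by simpa using h4, by simpa using h5, ?_⟩, ?_⟩
          · ext i
            simp [h1, h3, h8, Function.update_apply]
            split_ifs <;> simp
          · have := hu2 1
            simp [hb] at this
            simp [h7]
            omega
          · have := hu1 1
            simp [hb] at this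
            simp
            omega
        · have hif : (s₁.setReg 32 (s₁.mem 3 (R + k))).reg 39 <
              (s₁.setReg 32 (s₁.mem 3 (R + k))).reg 32 := by simp [h1, h2, hb]
          rw [if_pos hif]
          refine ⟨(k + 1, Function.update b (R + k) 0, true), ⟨?_, by simpa using h2,
            by simpa using h3, by simpa using h4, by simpa using h5, ?_⟩, ?_⟩
          · ext i
            simp [h1, h2, h8, Function.update_apply]
            split_ifs <;> simp
          · have := hu2 0
            simp [hb] at this
            simp only [if_true]
            refine ⟨by simpa using h6, by simpa using h7, by simp [h8, add_assoc], hk, ?_, ?_⟩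
            · intro l hl
              rcases (Nat.lt_succ_iff.1 hl).eq_or_lt with rfl | hl
              · simp
              · rw [Function.update_of_ne (by omega), h10 l hl]
            · rw [pow_succ]
              omega
          · have := hu1 0
            simp [hb] at this
            simp
            omega
  · simp [ha, hR]
  · rintro t s₁ ⟨⟨k, b, go⟩, ⟨h1, h2, h3, h4, h5, h6⟩, hlt, ht⟩
    dsimp only at *
    cases go with
    | true => exact absurd (by rw [h2, h6.1]; norm_num) hlt
    | false =>
      simp at ht h6
      exact ⟨b, h1, by omega, h6.2, h2, h4, h5⟩

/-- Complete and test all assignments of the variables from the one in register `42` on. -/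
def search : Program :=
  .seq (.const 0 0) <| .seq (.const 33 1) <| .seq (.const 39 0) <| .whileLt 39 33 <|
  .seq evalAt <| .seq (.ifLt 39 27 (.const 38 0) (.const 0 1)) nextPoint

theorem runs_search {S : SystemExpr n} {R q : ℕ} {g : ℕ → PolyExpr n} {s : State} {E : ℕ}
    (hm : 1 ≤ S.length) (hE1 : 1 ≤ E) (hE : ∀ p ∈ S, (encPoly p).length ≤ E)
    (hs : Ready S R g s) (hn : s.reg 40 = n) (hq : n = R + q) (ha : s.mem 3 = fun _ => 0) :
    Runs search s fun t s' => t ≤ 100 * (S.length * E) * 2 ^ q + 4 ∧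
      (S.Satisfiable → s'.reg 0 = 1) ∧ (¬ S.Satisfiable → s'.reg 0 = 0) := by
  rw [satisfiable_iff]
  simp only [search, runs_seq, runs_const]
  refine (runs_while_amortized (σ := (ℕ → ZMod 2) × Bool)
    (fun g' s' => s'.mem 3 = (fun i => (g'.1 i).val) ∧ s'.reg 39 = 0 ∧
      s'.reg 33 = (if g'.2 then 1 else 0) ∧ s'.reg 40 = n ∧ Ready S R g s' ∧
      -- As long as no solution was met, every solution has a counter value that is not yet tested.
      -- After the overflow it would have to be at least `2 ^ q`, which is impossible.
      (s'.reg 0 = 1 ∧ (∃ a : ℕ → ZMod 2, ∀ p ∈ S, polyEval a p = 0) ∨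
        s'.reg 0 = 0 ∧ ∀ a : ℕ → ZMod 2, (∀ p ∈ S, polyEval a p = 0) →
          (if g'.2 then bitSum (2 ^ ·) R q g'.1 else 2 ^ q) ≤ bitSum (2 ^ ·) R q a))
    -- Each remaining counter value is worth one evaluation and one increment; the ones among the
    -- digits pay for the carries.
    (fun g' => 7 * bitSum 1 R q g'.1 + if g'.2 then
      (60 * (S.length * E) + 35) * (2 ^ q - bitSum (2 ^ ·) R q g'.1) else 0) ?_
    (g := (0, true)) ?_).mono ?_
  · rintro ⟨a, more⟩ s₁ ⟨h1, h2, h3, h4, h5, h6⟩ hlt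
    dsimp only at *
    cases more with
    | false => simp [h2, h3] at hlt
    | true =>
      simp only [runs_seq, runs_ifLt, runs_const, if_true] at *
      refine (runs_evalAt hm hE1 hE h5 h1).mono ?_
      rintro t₁ s₂ ⟨k1, b, k2, k3, k4, k5, k6, k7, k8, k9⟩
      have hw : ∀ w, bitSum w R q b = bitSum w R q a := fun w =>
        bitSum_congr w fun i _ => k3 _ (by omega)
      have e39 : s₂.reg 39 = 0 := by rw [k8 39 (by omega), h2]
      have e40 : s₂.reg 40 = R + q := by rw [k8 40 (by omega), h4, hq]
      have e0 : s₂.reg 0 = s₁.reg 0 := k8 0 (by omega)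
      have hs₂ : Ready S R g s₂ := h5.of_same (k8 41 (by omega)) (k8 42 (by omega))
        (k9 0 (by simp)) (k9 4 (by simp))
      have hlt' := bitSum_two_pow_lt R q a
      -- Both outcomes of the test are followed by the same increment; `key` treats what they have
      -- in common.
      have key : ∀ (s₃ s₄ : State) (t₂ t₃ : ℕ),
          (s₃.reg 0 = 1 ∧ (∃ a : ℕ → ZMod 2, ∀ p ∈ S, polyEval a p = 0) ∨
            s₃.reg 0 = 0 ∧ ∀ a' : ℕ → ZMod 2, (∀ p ∈ S, polyEval a' p = 0) →
              bitSum (2 ^ ·) R q a + 1 ≤ bitSum (2 ^ ·) R q a') →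
          t₂ = 2 → Ready S R g s₃ → s₃.reg 40 = n →
          (∃ b' : ℕ → ZMod 2, s₄.mem 3 = (fun i => (b' i).val) ∧
            t₃ + 7 * bitSum 1 R q b' ≤ 7 * bitSum 1 R q b + 30 ∧
            (s₄.reg 33 = 1 ∧ bitSum (2 ^ ·) R q b' = bitSum (2 ^ ·) R q b + 1 ∨
              s₄.reg 33 = 0 ∧ bitSum (2 ^ ·) R q b + 1 = 2 ^ q) ∧
            s₄.reg 39 = 0 ∧ SameRegs 30 40 s₃ s₄ ∧ SameMem [3] s₃ s₄) →
          ∃ g' : (ℕ → ZMod 2) × Bool, (s₄.mem 3 = (fun i => (g'.1 i).val) ∧ s₄.reg 39 = 0 ∧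
            s₄.reg 33 = (if g'.2 then 1 else 0) ∧ s₄.reg 40 = n ∧ Ready S R g s₄ ∧
            (s₄.reg 0 = 1 ∧ (∃ a : ℕ → ZMod 2, ∀ p ∈ S, polyEval a p = 0) ∨
              s₄.reg 0 = 0 ∧ ∀ a : ℕ → ZMod 2, (∀ p ∈ S, polyEval a p = 0) →
                (if g'.2 then bitSum (2 ^ ·) R q g'.1 else 2 ^ q) ≤ bitSum (2 ^ ·) R q a)) ∧
            t₁ + (t₂ + t₃) + 1 + (7 * bitSum 1 R q g'.1 + if g'.2 then
              (60 * (S.length * E) + 35) * (2 ^ q - bitSum (2 ^ ·) R q g'.1) else 0) ≤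
            7 * bitSum 1 R q a +
              (60 * (S.length * E) + 35) * (2 ^ q - bitSum (2 ^ ·) R q a) := by
        rintro s₃ s₄ t₂ t₃ hA rfl hs₃ hn₃ ⟨b', l1, l2, l3, l4, l5, l6⟩
        rw [hw] at l2 l3
        have hs₄ : Ready S R g s₄ := hs₃.of_same (l5 41 (by omega)) (l5 42 (by omega))
          (l6 0 (by simp)) (l6 4 (by simp))
        have hn₄ : s₄.reg 40 = n := by rw [l5 40 (by omega), hn₃]
        rw [← l5 0 (by omega)] at hA
        obtain ⟨d, hd⟩ : ∃ d, 2 ^ q = bitSum (2 ^ ·) R q a + 1 + d :=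
          ⟨2 ^ q - (bitSum (2 ^ ·) R q a + 1), by omega⟩
        have hd' : 2 ^ q - bitSum (2 ^ ·) R q a = d + 1 := by omega
        rw [hd', mul_add]
        rcases l3 with ⟨l3, l3'⟩ | ⟨l3, l3'⟩
        · refine ⟨(b', true), ⟨l1, l4, by simpa using l3, hn₄, hs₄, ?_⟩, ?_⟩
          · simpa only [if_true, l3'] using hA
          · have hd'' : 2 ^ q - bitSum (2 ^ ·) R q b' = d := by omega
            simp only [if_true, hd'']
            omega
        · refine ⟨(b', false), ⟨l1, l4, by simpa using l3, hn₄, hs₄, ?_⟩, ?_⟩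
          · simpa [l3'] using hA
          · simp
            omega
      by_cases hsol : ∀ p ∈ S, polyEval b p = 0
      · rw [if_neg (by rw [e39, k7.2 hsol]; omega)]
        refine (runs_nextPoint (a := b) (R := R) (q := q) (by simpa using k2)
          (by simpa using hs₂.cnt) (by simpa using e40)).mono fun t₃ s₄ hs₄ =>
            key _ s₄ 2 t₃ ?_ rfl ?_ ?_ hs₄
        · exact Or.inl ⟨by simp, b, hsol⟩
        · exact hs₂.of_same (by simp) (by simp) (by simp) (by simp)
        · simp [e40, hq]
      · rw [if_pos (by rw [e39]; exact Nat.pos_of_ne_zero fun h => hsol (k7.1 h))]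
        refine (runs_nextPoint (a := b) (R := R) (q := q) (by simpa using k2)
          (by simpa using hs₂.cnt) (by simpa using e40)).mono fun t₃ s₄ hs₄ =>
            key _ s₄ 2 t₃ ?_ rfl ?_ ?_ hs₄
        · refine h6.imp (fun h => ⟨by simp [e0, h.1], h.2⟩) fun h =>
            ⟨by simp [e0, h.1], fun a' ha' => ?_⟩
          -- A solution with the current counter value has the same free variables as the completed
          -- point `b`, hence agrees with `b` on all variables, and `b` would be a solution as well.
          refine lt_of_le_of_ne (h.2 a' ha') fun heq => hsol fun p hp => ?_
          rw [← hw] at heq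
          have := eq_of_bitSum_two_pow_eq heq
          rw [polyEval_congr (eq_of_leads hs₂.leads k4 (fun j hj => ha' _ (hs₂.mem j hj))
            fun i hi hin => ?_) p, ha' p hp]
          have := this (i - R) (by omega)
          rwa [show R + (i - R) = i by omega] at this
        · exact hs₂.of_same (by simp) (by simp) (by simp) (by simp)
        · simp [e40, hq]
  · refine ⟨by simp [ha], by simp, by simp, by simp [hn],
      hs.of_same (by simp) (by simp) (by simp) (by simp), Or.inr ⟨by simp, fun a _ => ?_⟩⟩
    simp [bitSum]
  · rintro t s₁ ⟨⟨a, more⟩, ⟨h1, h2, h3, h4, h5, h6⟩, hlt, ht⟩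
    dsimp only at *
    cases more with
    | true => simp [h2, h3] at hlt
    | false =>
      have h0 : ∀ w, bitSum w R q 0 = 0 := fun w => by simp [bitSum]
      have hpos : 1 ≤ S.length * E := Nat.mul_pos hm hE1
      have hle : (60 * (S.length * E) + 35) * 2 ^ q ≤ 100 * (S.length * E) * 2 ^ q :=
        Nat.mul_le_mul_right _ (by omega)
      simp only [h0, if_true, Nat.sub_zero] at ht
      refine ⟨by omega, fun hsat => ?_, fun hsat => ?_⟩
      · rcases h6 with h6 | h6
        · exact h6.1
        · obtain ⟨b, hb⟩ := hsat
          have := h6.2 b hb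
          have := bitSum_two_pow_lt R q b
          simp at *
          omega
      · rcases h6 with h6 | h6
        · exact absurd h6.2 hsat
        · exact h6.1

end RAM

namespace SystemExpr

variable {n : ℕ}

/-! ### Reading off leading variables -/

/-- Update the least variable seen so far and the flag telling whether it occurs only once, as a
clause of its own. -/
def scanLit (single : Bool) (st : ℕ × Bool) (l : LitExpr n) : ℕ × Bool :=
  if l.1 < st.1 then (l.1, single) else if st.1 < l.1 then st else (st.1, false)

def scanClause (st : ℕ × Bool) (c : ClauseExpr n) : ℕ × Bool :=
  c.foldl (scanLit (c.length = 1)) st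

theorem foldl_scanLit_of_lt {b : Bool} {st : ℕ × Bool} {c : ClauseExpr n}
    (h : ∀ l ∈ c, st.1 < l.1) : c.foldl (scanLit b) st = st := by
  induction c generalizing st with
  | nil => rfl
  | cons l c ih =>
    have hl := h l (by simp)
    rw [List.foldl_cons, scanLit, if_neg (by omega), if_pos hl]
    exact ih fun l' hl' => h l' (by simp [hl'])

theorem lt_foldl_scanLit {b : Bool} {j : ℕ} {st : ℕ × Bool} {c : ClauseExpr n} (hst : j < st.1)
    (h : ∀ l ∈ c, j < l.1) : j < (c.foldl (scanLit b) st).1 := by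
  induction c generalizing st with
  | nil => exact hst
  | cons l c ih =>
    have hl := h l (by simp)
    refine ih ?_ fun l' hl' => h l' (by simp [hl'])
    unfold scanLit
    split_ifs <;> simpa

/-- In a clause not consisting of one literal, a variable at or before the current least one clears
the flag, and nothing there sets it again. A flag that survives therefore means that nothing
changed. -/
theorem foldl_scanLit_false (c : ClauseExpr n) (st : ℕ × Bool) :
    (∀ l ∈ c, (c.foldl (scanLit false) st).1 ≤ l.1) ∧ (c.foldl (scanLit false) st).1 ≤ st.1 ∧
      ((c.foldl (scanLit false) st).2 = true →
        c.foldl (scanLit false) st = st ∧ ∀ l ∈ c, st.1 < l.1) := by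
  induction c generalizing st with
  | nil => simp
  | cons l c ih =>
    obtain ⟨h1, h2, h3⟩ := ih (scanLit false st l)
    have hle : (scanLit false st l).1 ≤ st.1 ∧ (scanLit false st l).1 ≤ l.1 ∧
        ((scanLit false st l).2 = true → scanLit false st l = st ∧ st.1 < l.1) := by
      unfold scanLit
      split_ifs <;> simp <;> omega
    rw [List.foldl_cons]
    refine ⟨?_, h2.trans hle.1, fun h => ?_⟩
    · intro l' hl'
      rcases List.mem_cons.1 hl' with rfl | hl'
      · exact h2.trans hle.2.1
      · exact h1 l' hl'
    · obtain ⟨h4, h5⟩ := h3 h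
      obtain ⟨h6, h7⟩ := hle.2.2 (h4 ▸ h)
      rw [h6] at h4 h5 ⊢
      refine ⟨h4, fun l' hl' => ?_⟩
      rcases List.mem_cons.1 hl' with rfl | hl'
      exacts [h7, h5 l' hl']

/-- The flag is never set wrongly, whatever the polynomial: a new least variable from a single
literal leads because all earlier clauses contain only later variables, and the flag survives only
clauses in later variables. -/
theorem leads_of_foldl_scanClause (p : PolyExpr n) :
    (p.foldl scanClause (n, false)).1 ≤ n ∧
    (∀ c ∈ p, ∀ l ∈ c, (p.foldl scanClause (n, false)).1 ≤ l.1) ∧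
      ((p.foldl scanClause (n, false)).2 = true →
        Leads p (p.foldl scanClause (n, false)).1) := by
  induction p using List.reverseRecOn with
  | nil => simp
  | append_singleton p c ih =>
    rw [List.foldl_append, List.foldl_cons, List.foldl_nil]
    generalize p.foldl scanClause (n, false) = st at ih
    obtain ⟨h0, h1, h2⟩ := ih
    have happ : ∀ a : ℕ → ZMod 2, polyEval a (p ++ [c]) = polyEval a p + clauseEval a c :=
      fun a => by simp [polyEval]
    have hkeep : (∀ l ∈ c, st.1 < l.1) → st.2 = true → Leads (p ++ [c]) st.1 := fun hlt hst => by
      refine ⟨(h2 hst).1, fun a b hab => ?_⟩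
      have := (h2 hst).2 a b hab
      rw [happ, happ, clauseEval_congr fun l hl => hab l.1 (hlt l hl) l.1.2]
      linear_combination this
    by_cases hc : c.length = 1
    · obtain ⟨l, rfl⟩ := List.length_eq_one_iff.1 hc
      simp only [scanClause, List.length_singleton, decide_true, List.foldl_cons, List.foldl_nil,
        List.mem_append, List.mem_singleton, scanLit]
      split_ifs with hl hl'
      · refine ⟨l.1.2.le, ?_, fun _ => ⟨l.1.2, fun a b hab => ?_⟩⟩
        · rintro c (hc | rfl) l' hl'
          · exact hl.le.trans (h1 c hc l' hl')
          · obtain rfl := List.mem_singleton.1 hl'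
            exact le_rfl
        · have hp : polyEval a p = polyEval b p := by
            unfold polyEval
            congr 1
            refine List.map_congr_left fun c hc => clauseEval_congr fun l' hl' => ?_
            exact hab _ (hl.trans_le (h1 c hc l' hl')) l'.1.2
          have ha := CharTwo.add_self_eq_zero (a l.1)
          have hb := CharTwo.add_self_eq_zero (b l.1)
          rw [happ, happ, hp]
          simp only [clauseEval, litEval, List.map_cons, List.map_nil, List.prod_cons,
            List.prod_nil, mul_one]
          linear_combination ha - hb
      · refine ⟨h0, ?_, hkeep (by simpa using hl')⟩
        rintro c (hc | rfl) l' hl''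
        · exact h1 c hc l' hl''
        · obtain rfl := List.mem_singleton.1 hl''
          exact hl'.le
      · refine ⟨h0, ?_, by simp⟩
        rintro c (hc | rfl) l' hl''
        · exact h1 c hc l' hl''
        · obtain rfl := List.mem_singleton.1 hl''
          simp only
          omega
    · simp only [scanClause, hc, decide_false]
      obtain ⟨k1, k2, k3⟩ := foldl_scanLit_false c st
      refine ⟨k2.trans h0, ?_, fun h => ?_⟩
      · simp only [List.mem_append, List.mem_singleton]
        rintro c' (hc | rfl) l' hl'
        · exact k2.trans (h1 c' hc l' hl')
        · exact k1 l' hl'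
      · obtain ⟨h4, h5⟩ := k3 h
        rw [h4] at h ⊢
        exact hkeep h5 h

/-- Before the literal of `x_j` the least variable exceeds `j`; the literal then sets the state to
`(j, true)`, and clauses in later variables leave it alone. -/
theorem foldl_scanClause_of_showsPivot {p : PolyExpr n} {j : Fin n} (h : ShowsPivot p j) :
    p.foldl scanClause (n, false) = (j.val, true) := by
  obtain ⟨p₁, p₂, b, rfl, h⟩ := h
  have h₁ : ∀ (q : PolyExpr n) (st : ℕ × Bool), (∀ c ∈ q, ∀ l ∈ c, j < l.1) → j < st.1 →
      j < (q.foldl scanClause st).1 := fun q => by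
    induction q with
    | nil => exact fun st _ h => h
    | cons c q ih =>
      exact fun st hq hst => ih _ (fun c hc => hq c (by simp [hc]))
        (lt_foldl_scanLit hst (hq c (by simp)))
  have h₂ : ∀ q : PolyExpr n, (∀ c ∈ q, ∀ l ∈ c, j < l.1) →
      q.foldl scanClause (j.val, true) = (j.val, true) := fun q => by
    induction q with
    | nil => simp
    | cons c q ih =>
      intro hq
      rw [List.foldl_cons, scanClause, foldl_scanLit_of_lt fun l hl => hq c (by simp) l hl]
      exact ih fun c hc => hq c (by simp [hc])
  rw [List.foldl_append, List.foldl_cons]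
  have hlt := h₁ p₁ (n, false) (fun c hc => h c (by simp [hc])) j.2
  have hstep : scanClause (p₁.foldl scanClause (n, false)) [(j, b)] = (j.val, true) := by
    simp [scanClause, scanLit, hlt]
  rw [hstep]
  exact h₂ p₂ fun c hc => h c (by simp [hc])

/-! ### Coefficients of linear polynomials -/

/-- The number of occurrences of every variable in a clause, modulo `2`. -/
def clauseCoef (c : ClauseExpr n) : ℕ → ZMod 2 := (c.map fun l => Pi.single l.1.val 1).sum

/-- The number of occurrences of every variable in a polynomial, modulo `2`. -/
def polyCoef (p : PolyExpr n) : ℕ → ZMod 2 := (p.map clauseCoef).sum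

/-- The sign bits enter only the constant term `polyEval 0 p`, so the coefficients can be counted
without them. -/
theorem polyEval_eq_of_linear {p : PolyExpr n} (hp : ∀ c ∈ p, c.length ≤ 1) (a : ℕ → ZMod 2) :
    polyEval a p = polyEval 0 p + ∑ i ∈ Finset.range n, polyCoef p i * a i := by
  induction p with
  | nil => simp [polyEval, polyCoef]
  | cons c p ih =>
    have hc : clauseEval a c =
        clauseEval 0 c + ∑ i ∈ Finset.range n, clauseCoef c i * a i := by
      match c, hp c (by simp) with
      | [], _ => simp [clauseEval, clauseCoef]
      | [(x, b)], _ =>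
        simp [clauseEval, clauseCoef, litEval, Pi.single_apply, add_comm]
    have hs : ∀ b : ℕ → ZMod 2, polyEval b (c :: p) = clauseEval b c + polyEval b p := fun b => by
      simp [polyEval]
    have hs' : ∀ i, polyCoef (c :: p) i = clauseCoef c i + polyCoef p i := fun i => by
      simp [polyCoef]
    simp only [hs, hs', add_mul, Finset.sum_add_distrib]
    rw [hc, ih fun c hc => hp c (by simp [hc])]
    ring

theorem polyCoef_eq_one_of_leads {p : PolyExpr n} (hp : ∀ c ∈ p, c.length ≤ 1) {j : ℕ}
    (h : Leads p j) : polyCoef p j = 1 := by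
  have h1 := h.2 (Pi.single j 1) 0 fun i hi _ => by simp [hi.ne']
  rw [polyEval_eq_of_linear hp] at h1
  simp only [Pi.single_apply, mul_ite, mul_one, mul_zero, Finset.sum_ite_eq', Finset.mem_range,
    h.1, if_true, Pi.zero_apply, add_zero] at h1
  have h2 := CharTwo.add_self_eq_zero (1 : ZMod 2)
  linear_combination h1 - h2

theorem leads_of_polyCoef {p : PolyExpr n} (hp : ∀ c ∈ p, c.length ≤ 1) {j : ℕ} (hj : j < n)
    (h1 : polyCoef p j = 1) (h0 : ∀ i < j, polyCoef p i = 0) : Leads p j := by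
  refine ⟨hj, fun a b hab => ?_⟩
  have key : ∀ c : ℕ → ZMod 2, polyEval c p + c j =
      polyEval 0 p + ∑ i ∈ (Finset.range n).erase j, polyCoef p i * c i := fun c => by
    have := CharTwo.add_self_eq_zero (c j)
    rw [polyEval_eq_of_linear hp, ← Finset.add_sum_erase _ _ (Finset.mem_range.2 hj), h1]
    linear_combination this
  rw [key, key]
  congr 1
  refine Finset.sum_congr rfl fun i hi => ?_
  rw [Finset.mem_erase, Finset.mem_range] at hi
  rcases lt_or_gt_of_ne hi.1 with h | h
  · rw [h0 i h, zero_mul, zero_mul]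
  · rw [hab i h hi.2]

end SystemExpr

/-! ### The pivots found and their number -/

namespace RAM

open SystemExpr

variable {n : ℕ}

/-- The system is in array `0`, the assignment in array `3` is zero, and array `4` holds, for some
variables including the first `R` ones, the position of a polynomial led by the variable. -/
structure Found (S : SystemExpr n) (R : ℕ) (s : State) : Prop where
  sys : At (s.mem 0) 2 (S.flatMap encPoly)
  num : s.reg 40 = n
  len : s.reg 41 = S.length
  zero : s.mem 3 = fun _ => 0
  -- The polynomials start at position `2` of the encoding, so `0` can stand for a missing
  -- polynomial.
  pos : ∀ j, s.mem 4 j = 0 ∨ ∃ p ∈ S, Leads p j ∧ At (s.mem 0) (s.mem 4 j) (encPoly p)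
  ne : ∀ j < R, s.mem 4 j ≠ 0

/-- Count the initial variables for which a polynomial has been found. -/
def countPivots : Program :=
  .seq (.const 42 0) <| .seq (.const 39 0) <| .seq (.const 38 1) <| .whileLt 39 38 <|
  .ifLt 42 40
    (.seq (.load 37 4 42) <| .ifLt 39 37 (.inc 42) (.const 38 0))
    (.const 38 0)

theorem runs_countPivots {S : SystemExpr n} {R : ℕ} {s : State} (hR : R ≤ n) (hs : Found S R s) :
    Runs countPivots s fun t s' => t ≤ 6 * S.length + 10 ∧ s'.reg 40 = n ∧
      s'.mem 3 = (fun _ => 0) ∧ s'.mem 5 = s.mem 5 ∧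
      ∃ R' g, R ≤ R' ∧ R' ≤ n ∧ Ready S R' g s' := by
  have hex : ∀ j, ∃ p : PolyExpr n, s.mem 4 j = 0 ∨
      p ∈ S ∧ Leads p j ∧ At (s.mem 0) (s.mem 4 j) (encPoly p) := fun j =>
    (hs.pos j).elim (fun h => ⟨[], Or.inl h⟩) fun ⟨p, h⟩ => ⟨p, Or.inr h⟩
  choose g hg using hex
  have hready : ∀ j ≤ n, (∀ l < j, s.mem 4 l ≠ 0) → ∀ s' : State, s'.mem = s.mem →
      s'.reg 41 = S.length → s'.reg 42 = j → Ready S j g s' := fun j hj hne s' hm h41 h42 =>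
    { sys := hm ▸ hs.sys
      len := h41
      cnt := h42
      le := hj
      leads := fun l hl => ((hg l).resolve_left (hne l hl)).2.1
      mem := fun l hl => ((hg l).resolve_left (hne l hl)).1
      pos := fun l hl => hm ▸ ((hg l).resolve_left (hne l hl)).2.2 }
  simp only [countPivots, runs_seq, runs_const]
  refine (runs_while (σ := ℕ × Bool)
    (fun g' s' => s'.mem = s.mem ∧ s'.reg 39 = 0 ∧ s'.reg 38 = (if g'.2 then 1 else 0) ∧
      s'.reg 42 = g'.1 ∧ s'.reg 40 = n ∧ s'.reg 41 = S.length ∧ g'.1 ≤ n ∧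
      (∀ j < g'.1, s.mem 4 j ≠ 0) ∧ (g'.2 = false → R ≤ g'.1))
    (fun g' => 6 * (S.length - g'.1) + if g'.2 then 7 else 1) (fun g' => by split_ifs <;> omega) ?_
    (g := (0, true)) ?_).mono ?_
  · rintro ⟨j, go⟩ s₁ ⟨h1, h2, h3, h4, h5, h6, h7, h8, h9⟩ hlt
    dsimp only at *
    cases go with
    | false => simp [h2, h3] at hlt
    | true =>
      simp only [runs_ifLt, runs_seq, runs_const, runs_load, runs_inc]
      rw [h4, h5]
      split_ifs with hjn hj0
      · have hj : s.mem 4 j ≠ 0 := by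
          simp [h1, h2] at hj0
          omega
        have h8' : ∀ l < j + 1, s.mem 4 l ≠ 0 := fun l hl => by
          rcases (Nat.lt_succ_iff.1 hl).eq_or_lt with rfl | hl
          exacts [hj, h8 l hl]
        -- An auxiliary state that does not occur in the run: `Ready.cnt_le` for it gives `j + 1 ≤
        -- S.length`, so the potential really drops in this round.
        have hle := (hready (j + 1) hjn h8' ((s.setReg 41 S.length).setReg 42 (j + 1)) (by simp)
          (by simp) (by simp)).cnt_le
        exact ⟨(j + 1, true), ⟨by simpa using h1, by simpa using h2, by simpa using h3,
          by simp [h4], by simpa using h5, by simpa using h6, hjn, h8', by simp⟩,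
          by simp; omega⟩
      · refine ⟨(j, false), ⟨by simpa using h1, by simpa using h2, by simp,
          by simpa using h4, by simpa using h5, by simpa using h6, h7, h8, fun _ => ?_⟩,
          by simp; omega⟩
        by_contra hlt'
        have := hs.ne j (by omega)
        simp [h1, h2] at hj0
        exact this hj0
      · exact ⟨(j, false), ⟨by simpa using h1, by simpa using h2, by simp,
          by simpa using h4, by simpa using h5, by simpa using h6, h7, h8,
          fun _ => by dsimp only; omega⟩, by simp; omega⟩
  · simp [hs.num, hs.len]
  · rintro t s₁ ⟨⟨j, go⟩, ⟨h1, h2, h3, h4, h5, h6, h7, h8, h9⟩, hlt, ht⟩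
    dsimp only at *
    cases go with
    | true => simp [h2, h3] at hlt
    | false =>
      simp only [if_true] at ht
      exact ⟨by omega, h5, by rw [h1, hs.zero], by rw [h1], j, g, h9 rfl, h7,
        hready j h7 h8 s₁ h1 h6 h4⟩

/-- The part of `enc` before the polynomials. -/
theorem At.of_enc {S : SystemExpr n} {M : ℕ → ℕ} (h : At M 0 S.enc) :
    M 0 = n ∧ M 1 = S.length ∧ At M 2 (S.flatMap encPoly) := by
  simpa only [enc, at_cons, zero_add] using h

theorem at_init (A B : List ℕ) : At ((init A B).mem 0) 0 A :=
  at_of_getD fun i => by simp [init]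

/-! ### Finding the leading polynomials in a given list of positions -/

/-- Write the positions of the polynomials to array `2`. -/
def indexPolys : Program :=
  .seq (.const 30 0) <| .seq (.load 40 0 30) <| .seq (.inc 30) <| .seq (.load 41 0 30) <|
  .seq (.const 30 0) <| .seq (.const 10 2) <| .whileLt 30 41 <|
  -- The value is discarded; `evalPoly` serves only to move register `10` to the next polynomial.
  .seq (.store 2 30 10) <| .seq evalPoly <| .inc 30

/-- Look up the positions of the polynomials listed in array `1`. -/
def loadPivots : Program :=
  .seq (.const 30 0) <| .seq (.const 31 0) <| .seq (.load 32 1 30) <| .whileLt 30 32 <|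
  -- Entry `0` of array `1` is the number `R`, so the position for the variable `j` is entry `j +
  -- 1`.
  .seq (.inc 31) <| .seq (.load 33 1 31) <| .seq (.load 34 2 33) <| .seq (.store 4 30 34) <|
  .inc 30

theorem runs_indexPolys {S : SystemExpr n} {s : State} {E : ℕ}
    (hE : ∀ p ∈ S, (encPoly p).length ≤ E) (hS : At (s.mem 0) 0 S.enc)
    (hz : s.mem 3 = fun _ => 0) :
    Runs indexPolys s fun t s' => t ≤ S.length * (20 * E + 3) + 7 ∧ s'.reg 40 = n ∧
      s'.reg 41 = S.length ∧ SameMem [2] s s' ∧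
      ∀ i < S.length, s'.mem 2 i ≠ 0 ∧ At (s.mem 0) (s'.mem 2 i) (encPoly (S.getD i [])) := by
  obtain ⟨hS0, hS1, hS⟩ := hS.of_enc
  simp only [indexPolys, runs_seq, runs_const, runs_load, runs_inc]
  refine (runs_while (σ := SystemExpr n × SystemExpr n)
    (fun g s' => g.1 ++ g.2 = S ∧ s'.reg 40 = n ∧ s'.reg 41 = S.length ∧
      s'.reg 30 = g.1.length ∧ s'.reg 10 ≠ 0 ∧ At (s.mem 0) (s'.reg 10) (g.2.flatMap encPoly) ∧
      SameMem [2] s s' ∧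
      ∀ i < g.1.length, s'.mem 2 i ≠ 0 ∧ At (s.mem 0) (s'.mem 2 i) (encPoly (S.getD i [])))
    (fun g => g.2.length * (20 * E + 3) + 1) (fun g => by omega) ?_ (g := ([], S)) ?_).mono ?_
  · rintro ⟨pre, L⟩ s₁ ⟨h1, h2, h3, h4, h5, h6, h7, h8⟩ hlt
    dsimp only at *
    cases L with
    | nil =>
      rw [h3, h4, ← h1] at hlt
      simp at hlt
    | cons p L =>
      have hpS : p ∈ S := by simp [← h1]
      have hget : S.getD pre.length [] = p := by simp [← h1]
      simp only [List.flatMap_cons, at_append] at h6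
      simp only [runs_seq, runs_store, runs_inc]
      have h3' : s₁.mem 3 = fun i => ((0 : ℕ → ZMod 2) i).val := by rw [h7 3 (by simp), hz]; simp
      refine (runs_evalPoly (a := 0) (p := p) (by simpa [h7 0] using h6.1)
        (by simpa using h3')).mono ?_
      rintro t s₂ ⟨k1, k2, k3, k4, k5⟩
      have hE' := hE p hpS
      have hg : (L.length + 1) * (20 * E + 3) = L.length * (20 * E + 3) + (20 * E + 3) := by ring
      rw [reg_setMem] at k2
      have e40 : s₂.reg 40 = n := by rw [k5 40 (by omega), reg_setMem, h2]
      have e41 : s₂.reg 41 = S.length := by rw [k5 41 (by omega), reg_setMem, h3]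
      have e30 : s₂.reg 30 = pre.length := by rw [k5 30 (by omega), reg_setMem, h4]
      refine ⟨(pre ++ [p], L), ⟨by simp [← h1], by simpa using e40, by simpa using e41,
        by simp [e30], by simp [k2, h5], ?_, ?_, ?_⟩, ?_⟩
      · simpa [k2] using h6.2
      · intro a ha
        rw [mem_setReg, k4, mem_setMem, if_neg (by simpa using ha), h7 a ha]
      · intro i hi
        rw [mem_setReg, k4, mem_setMem, if_pos rfl, h4, Function.update_apply]
        split_ifs with hi'
        · rw [hi', hget]
          exact ⟨h5, h6.1⟩
        · exact h8 i (by simp at hi; omega)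
      · simp only [List.length_cons]
        omega
  · simp [hS0, hS1, hS]
  · rintro t s₁ ⟨⟨pre, L⟩, ⟨h1, h2, h3, h4, h5, h6, h7, h8⟩, hlt, ht⟩
    dsimp only at *
    rw [h3, h4, ← h1] at hlt
    obtain rfl : L = [] := by
      rw [← List.length_eq_zero_iff]
      simp only [List.length_append] at hlt
      omega
    obtain rfl : pre = S := by simpa using h1
    exact ⟨by omega, h2, h3, h7, h8⟩

theorem runs_loadPivots {S : SystemExpr n} {R : ℕ} {f : Fin R → Fin S.length} {s : State}
    (hn : s.reg 40 = n) (hm : s.reg 41 = S.length)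
    (hS : At (s.mem 0) 2 (S.flatMap encPoly)) (hz : s.mem 3 = fun _ => 0)
    (hz4 : ∀ i, s.mem 4 i = 0) (h1 : ∀ i, s.mem 1 i = (encIndices f).getD i 0)
    (h2 : ∀ i < S.length, s.mem 2 i ≠ 0 ∧ At (s.mem 0) (s.mem 2 i) (encPoly (S.getD i [])))
    (hf : ∀ j, Leads (S.get (f j)) j) :
    Runs loadPivots s fun t s' => t ≤ 6 * R + 4 ∧ Found S R s' := by
  have hR : s.mem 1 0 = R := by simp [h1, encIndices]
  have hfj : ∀ j (hj : j < R), s.mem 1 (j + 1) = f ⟨j, hj⟩ := fun j hj => by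
    simp [h1, encIndices, List.getD, hj]
  simp only [loadPivots, runs_seq, runs_const, runs_load]
  refine (runs_while (σ := ℕ)
    (fun j s' => s'.reg 40 = n ∧ s'.reg 41 = S.length ∧ s'.reg 30 = j ∧ s'.reg 31 = j ∧
      s'.reg 32 = R ∧ SameMem [4] s s' ∧ j ≤ R ∧ (∀ l, j ≤ l → s'.mem 4 l = 0) ∧
      ∀ l (hl : l < R), l < j → s'.mem 4 l = s.mem 2 (f ⟨l, hl⟩))
    (fun j => 6 * (R - j) + 1) (fun j => by omega) ?_ (g := 0) ?_).mono ?_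
  · rintro j s₁ ⟨k1, k2, k3, k4, k5, k6, k7, k8, k9⟩ hlt
    simp only [runs_seq, runs_inc, runs_load, runs_store]
    have hj : j < R := by omega
    refine ⟨j + 1, ⟨by simpa using k1, by simpa using k2, by simp [k3], by simp [k4],
      by simpa using k5, by simpa using k6, hj, ?_, ?_⟩, by omega⟩
    · intro l hl
      simp [k3, Function.update_of_ne (show l ≠ j by omega), k8 l (by omega)]
    · intro l hl hlj
      rcases (Nat.lt_succ_iff.1 hlj).eq_or_lt with rfl | hlj
      · simp [k3, k4, k6 1, k6 2, hfj _ hj]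
      · simp [k3, Function.update_of_ne hlj.ne, k9 l hl hlj]
  · simp [hn, hm, hR, hz4]
  · rintro t s₁ ⟨j, ⟨k1, k2, k3, k4, k5, k6, k7, k8, k9⟩, hlt, ht⟩
    obtain rfl : j = R := by omega
    refine ⟨by omega, ⟨by rw [k6 0 (by simp)]; exact hS, k1, k2, by rw [k6 3 (by simp), hz],
      fun l => ?_, fun l hl => ?_⟩⟩
    · by_cases hl : l < j
      · right
        refine ⟨S.get (f ⟨l, hl⟩), List.get_mem _ _, hf ⟨l, hl⟩, ?_⟩
        rw [k9 l hl hl, k6 0 (by simp)]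
        have := (h2 (f ⟨l, hl⟩) (f ⟨l, hl⟩).2).2
        simpa using this
      · exact Or.inl (k8 l (by omega))
    · rw [k9 l hl hl]
      exact (h2 _ (f ⟨l, hl⟩).2).1

/-! ### Finding leading polynomials without help -/

/-- Record the polynomials for which `D` writes the leading variable to register `11`. -/
def findPivots (D : Program) : Program :=
  .seq (.const 30 0) <| .seq (.load 40 0 30) <| .seq (.inc 30) <| .seq (.load 41 0 30) <|
  .seq (.const 30 0) <| .seq (.const 10 2) <| .whileLt 30 41 <|
  .seq (.copy 31 10) <| .seq D <| .seq (.ifLt 11 40 (.store 4 11 31) (.const 32 0)) <| .inc 30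

/-- Within `T` steps, `D` reads the polynomial `p` at position `10` and writes the index of its
leading variable to register `11`, or another number if the leading variable is not found; an
index with the property `W` is found. -/
def Detects (D : Program) (p : PolyExpr n) (T : ℕ) (W : ℕ → Prop) : Prop :=
  ∀ s : State, At (s.mem 0) (s.reg 10) (encPoly p) → s.reg 40 = n →
    s.mem 8 = (fun _ => 0) →
    Runs D s fun t s' => t ≤ T ∧ s'.reg 10 = s.reg 10 + (encPoly p).length ∧
      (s'.reg 11 < n → Leads p (s'.reg 11)) ∧ (∀ j, W j → s'.reg 11 = j) ∧
      s'.mem 8 = (fun _ => 0) ∧ SameRegs 10 30 s s' ∧ SameMem [8] s s'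

/-- An entry of array `4` may be overwritten by another polynomial with the same leading variable,
but it never becomes `0` again, since positions of polynomials are nonzero. -/
theorem runs_findPivots {D : Program} {S : SystemExpr n} {R T : ℕ} {W : PolyExpr n → ℕ → Prop}
    (hD : ∀ p ∈ S, Detects D p T (W p)) (hR : R ≤ n) (hW : ∀ j < R, ∃ p ∈ S, W p j) {s : State}
    (hS : At (s.mem 0) 0 S.enc) (hz3 : s.mem 3 = fun _ => 0) (hz4 : s.mem 4 = fun _ => 0)
    (hz8 : s.mem 8 = fun _ => 0) :
    Runs (findPivots D) s fun t s' => t ≤ S.length * (T + 6) + 7 ∧ Found S R s' ∧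
      s'.mem 5 = s.mem 5 := by
  obtain ⟨hS0, hS1, hS⟩ := hS.of_enc
  simp only [findPivots, runs_seq, runs_const, runs_load, runs_inc]
  refine (runs_while (σ := SystemExpr n × SystemExpr n)
    (fun g s' => g.1 ++ g.2 = S ∧ s'.reg 40 = n ∧ s'.reg 41 = S.length ∧
      s'.reg 30 = g.1.length ∧ s'.reg 10 ≠ 0 ∧ At (s.mem 0) (s'.reg 10) (g.2.flatMap encPoly) ∧
      SameMem [4, 8] s s' ∧ s'.mem 8 = (fun _ => 0) ∧
      (∀ j, s'.mem 4 j = 0 ∨ ∃ p ∈ S, Leads p j ∧ At (s.mem 0) (s'.mem 4 j) (encPoly p)) ∧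
      ∀ j < R, (∃ p ∈ g.1, W p j) → s'.mem 4 j ≠ 0)
    (fun g => g.2.length * (T + 6) + 1) (fun g => by omega) ?_ (g := ([], S)) ?_).mono ?_
  · rintro ⟨pre, L⟩ s₁ ⟨h1, h2, h3, h4, h5, h6, h7, h8, h9, h10⟩ hlt
    dsimp only at *
    cases L with
    | nil =>
      rw [h3, h4, ← h1] at hlt
      simp at hlt
    | cons p L =>
      have hpS : p ∈ S := by simp [← h1]
      simp only [List.flatMap_cons, at_append] at h6
      simp only [runs_seq, runs_copy, runs_ifLt, runs_store, runs_inc, runs_const]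
      refine (hD p hpS (s₁.setReg 31 (s₁.reg 10)) (by simpa [h7 0] using h6.1) (by simpa using h2)
        (by simpa using h8)).mono ?_
      rintro t s₂ ⟨k1, k2, k3, k4, k5, k6, k7⟩
      have hg : (L.length + 1) * (T + 6) = L.length * (T + 6) + (T + 6) := by ring
      simp only [reg_setReg] at k2
      have e40 : s₂.reg 40 = n := by rw [k6 40 (by omega)]; simpa using h2
      have e41 : s₂.reg 41 = S.length := by rw [k6 41 (by omega)]; simpa using h3
      have e30 : s₂.reg 30 = pre.length := by rw [k6 30 (by omega)]; simpa using h4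
      have e31 : s₂.reg 31 = s₁.reg 10 := by rw [k6 31 (by omega)]; simp
      have e4 : s₂.mem 4 = s₁.mem 4 := by rw [k7 4 (by simp), mem_setReg]
      have hM : SameMem [4, 8] s s₂ := fun a ha => by
        rw [k7 a (by simp at ha ⊢; exact ha.2), mem_setReg, h7 a ha]
      have hat : At (s.mem 0) (s₂.reg 10) (L.flatMap encPoly) := by simpa [k2] using h6.2
      have hS' : (pre ++ [p]) ++ L = S := by simp [← h1]
      have h10' : s₂.reg 10 ≠ 0 := by simp at k2; omega
      rw [e40]
      split_ifs with hlead
      · refine ⟨(pre ++ [p], L), ⟨hS', by simpa using e40, by simpa using e41,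
          by simp [e30], by simpa using h10', by simpa using hat, by simpa using hM,
          by simpa using k5, ?_, ?_⟩, by simp only [List.length_cons]; omega⟩
        · intro j
          simp only [mem_setReg, mem_setMem, if_true, e31, e4, Function.update_apply]
          split_ifs with hj
          · exact Or.inr ⟨p, hpS, hj ▸ k3 hlead, h6.1⟩
          · exact h9 j
        · rintro j hj ⟨q, hq, hqj⟩
          simp only [mem_setReg, mem_setMem, if_true, e31, e4, Function.update_apply]
          split_ifs with hj'
          · exact h5
          · rcases List.mem_append.1 hq with hq | hq
            · exact h10 j hj ⟨q, hq, hqj⟩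
            · obtain rfl := List.mem_singleton.1 hq
              exact absurd (k4 j hqj).symm hj'
      · refine ⟨(pre ++ [p], L), ⟨hS', by simpa using e40, by simpa using e41,
          by simp [e30], by simpa using h10', by simpa using hat, by simpa using hM,
          by simpa using k5, by simpa [e4] using h9, ?_⟩,
          by simp only [List.length_cons]; omega⟩
        rintro j hj ⟨q, hq, hqj⟩
        rcases List.mem_append.1 hq with hq | hq
        · simpa [e4] using h10 j hj ⟨q, hq, hqj⟩
        · obtain rfl := List.mem_singleton.1 hq
          exact absurd ((k4 j hqj).trans_lt (hj.trans_le hR)) hlead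
  · simp [hS0, hS1, hS, hz4, hz8]
  · rintro t s₁ ⟨⟨pre, L⟩, ⟨h1, h2, h3, h4, h5, h6, h7, h8, h9, h10⟩, hlt, ht⟩
    dsimp only at *
    rw [h3, h4, ← h1] at hlt
    obtain rfl : L = [] := by
      rw [← List.length_eq_zero_iff]
      simp only [List.length_append] at hlt
      omega
    obtain rfl : pre = S := by simpa using h1
    exact ⟨by omega, ⟨by rw [h7 0 (by simp)]; exact hS, h2, h3, by rw [h7 3 (by simp), hz3],
      by rw [h7 0 (by simp)]; exact h9, fun j hj => h10 j hj (hW j hj)⟩, h7 5 (by simp)⟩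

/-- Registers `11` and `14` hold the state of the scan, and register `17` tells whether the clause
has one literal. -/
def scanLitStep : Program :=
  .seq (.load 13 0 10) <| .seq (.inc 10) <| .seq (.inc 10) <|
  .seq (.ifLt 13 11 (.seq (.copy 11 13) (.copy 14 17)) <|
    .ifLt 11 13 (.const 13 0) (.const 14 0)) <| .dec 12

def scanClauseStep : Program :=
  .seq (.load 12 0 10) <| .seq (.inc 10) <| .seq (.const 17 0) <|
  .seq (.ifLt 12 18 (.ifLt 19 12 (.const 17 1) (.const 13 0)) (.const 13 0)) <|
  .seq (.whileLt 19 12 scanLitStep) <| .dec 16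

/-- Find the leading variable of a polynomial that shows it. -/
def detectShown : Program :=
  .seq (.const 19 0) <| .seq (.const 18 2) <| .seq (.copy 11 40) <| .seq (.const 14 0) <|
  .seq (.load 16 0 10) <| .seq (.inc 10) <| .seq (.whileLt 19 16 scanClauseStep) <|
  .ifLt 19 14 (.const 13 0) (.copy 11 40)

theorem runs_scanLitStep {l : LitExpr n} {st : ℕ × Bool} {b : Bool} {s : State}
    (hl : At (s.mem 0) (s.reg 10) (encLit l)) (h11 : s.reg 11 = st.1)
    (h14 : s.reg 14 = st.2.toNat) (h17 : s.reg 17 = b.toNat) :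
    Runs scanLitStep s fun t s' => t ≤ 10 ∧ s'.reg 10 = s.reg 10 + 2 ∧
      s'.reg 11 = (scanLit b st l).1 ∧ s'.reg 14 = (scanLit b st l).2.toNat ∧
      s'.reg 12 = s.reg 12 - 1 ∧ s'.reg 16 = s.reg 16 ∧ s'.reg 17 = s.reg 17 ∧
      s'.reg 18 = s.reg 18 ∧ s'.reg 19 = s.reg 19 ∧ s'.mem = s.mem ∧ SameRegs 10 20 s s' := by
  simp only [encLit, at_cons, at_nil, and_true] at hl
  simp only [scanLitStep, runs_seq, runs_const, runs_load, runs_inc, runs_dec, runs_ifLt,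
    runs_copy, scanLit]
  rcases lt_trichotomy l.1.val st.1 with h | h | h
  · simp [hl, h, h11, h17]
  · simp [hl, h, h11]
  · simp [hl, h, h.not_gt, h11, h14]

theorem runs_scanClauseStep {c : ClauseExpr n} {st : ℕ × Bool} {s : State}
    (hc : At (s.mem 0) (s.reg 10) (encClause c)) (h11 : s.reg 11 = st.1)
    (h14 : s.reg 14 = st.2.toNat) (h18 : s.reg 18 = 2) (h19 : s.reg 19 = 0) :
    Runs scanClauseStep s fun t s' => t ≤ 10 * (encClause c).length ∧
      s'.reg 10 = s.reg 10 + (encClause c).length ∧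
      s'.reg 11 = (scanClause st c).1 ∧ s'.reg 14 = (scanClause st c).2.toNat ∧
      s'.reg 16 = s.reg 16 - 1 ∧ s'.reg 18 = 2 ∧ s'.reg 19 = 0 ∧ s'.mem = s.mem ∧
      SameRegs 10 20 s s' := by
  simp only [encClause, at_cons] at hc
  -- The three branches that set register `17` all run into the same loop, which is treated once for
  -- an arbitrary starting state.
  have hloop : ∀ s₀ : State, s₀.mem = s.mem → s₀.reg 10 = s.reg 10 + 1 →
      s₀.reg 12 = c.length → s₀.reg 11 = st.1 → s₀.reg 14 = st.2.toNat →
      s₀.reg 17 = (decide (c.length = 1)).toNat → s₀.reg 16 = s.reg 16 → s₀.reg 18 = 2 →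
      s₀.reg 19 = 0 → SameRegs 10 20 s s₀ →
      Runs (.whileLt 19 12 scanLitStep) s₀ fun t s' => t ≤ 11 * c.length + 1 ∧
        s'.reg 10 = s.reg 10 + (encClause c).length ∧
        s'.reg 11 = (scanClause st c).1 ∧ s'.reg 14 = (scanClause st c).2.toNat ∧
        s'.reg 16 = s.reg 16 ∧ s'.reg 18 = 2 ∧ s'.reg 19 = 0 ∧ s'.mem = s.mem ∧
        SameRegs 10 20 s s' := by
    intro s₀ hm e10 e12 e11 e14 e17 e16 e18 e19 hr
    refine (runs_while (σ := List (LitExpr n) × (ℕ × Bool))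
      (fun g s' => At (s'.mem 0) (s'.reg 10) (g.1.flatMap encLit) ∧ s'.reg 12 = g.1.length ∧
        s'.reg 11 = g.2.1 ∧ s'.reg 14 = g.2.2.toNat ∧
        g.1.foldl (scanLit (c.length = 1)) g.2 = scanClause st c ∧
        s'.reg 10 + (g.1.flatMap encLit).length = s.reg 10 + (encClause c).length ∧
        s'.reg 17 = (decide (c.length = 1)).toNat ∧ s'.reg 16 = s.reg 16 ∧ s'.reg 18 = 2 ∧
        s'.reg 19 = 0 ∧ s'.mem = s.mem ∧ SameRegs 10 20 s s')
      (fun g => 11 * g.1.length + 1) (fun g => by omega) ?_ (g := (c, st)) ?_).mono ?_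
    · rintro ⟨L, w⟩ s₁ ⟨h1, h2, h3, h4, h5, h6, h7, h8, h9, h10, h11, h12⟩ hlt
      cases L with
      | nil => simp [h2, h10] at hlt
      | cons l L =>
        simp only [List.flatMap_cons, at_append, List.length_append, List.length_cons] at *
        refine (runs_scanLitStep h1.1 h3 h4 h7).mono ?_
        rintro t s₂ ⟨k1, k2, k3, k4, k5, k6, k7, k8, k9, k10, k11⟩
        refine ⟨(L, scanLit (decide (c.length = 1)) w l), ⟨?_, by dsimp only; omega, k3, k4, h5,
          ?_, k7.trans h7, k6.trans h8, k8.trans h9, k9.trans h10, k10.trans h11,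
          h12.trans k11 le_rfl le_rfl⟩, by dsimp only; omega⟩
        · rw [k10, k2]
          exact h1.2
        · simp only [encLit, List.length_cons, List.length_nil] at *
          omega
    · refine ⟨by rw [hm, e10]; exact hc.2, e12, e11, e14, rfl, ?_, e17, e16, e18, e19, hm, hr⟩
      rw [e10, encClause, List.length_cons]
      dsimp only
      omega
    · rintro t s₁ ⟨⟨L, w⟩, ⟨h1, h2, h3, h4, h5, h6, h7, h8, h9, h10, h11, h12⟩, hlt, ht⟩
      obtain rfl : L = [] := by
        rw [← List.length_eq_zero_iff]
        simp only at *
        omega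
      simp only [List.foldl_nil] at h5
      subst h5
      exact ⟨ht, h6, h3, h4, h8, h9, h10, h11, h12⟩
  have hlen : (encClause c).length = 2 * c.length + 1 := by
    simp [List.length_flatMap, encClause, encLit, mul_comm]
  simp only [scanClauseStep, runs_seq, runs_const, runs_load, runs_inc, runs_ifLt, runs_dec]
  have hfin : ∀ k, k ≤ 6 → ∀ t s', (t ≤ 11 * c.length + 1 ∧
        s'.reg 10 = s.reg 10 + (encClause c).length ∧
        s'.reg 11 = (scanClause st c).1 ∧ s'.reg 14 = (scanClause st c).2.toNat ∧
        s'.reg 16 = s.reg 16 ∧ s'.reg 18 = 2 ∧ s'.reg 19 = 0 ∧ s'.mem = s.mem ∧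
        SameRegs 10 20 s s') → k + (t + 1) ≤ 10 * (encClause c).length ∧
      (s'.setReg 16 (s'.reg 16 - 1)).reg 10 = s.reg 10 + (encClause c).length ∧
      (s'.setReg 16 (s'.reg 16 - 1)).reg 11 = (scanClause st c).1 ∧
      (s'.setReg 16 (s'.reg 16 - 1)).reg 14 = (scanClause st c).2.toNat ∧
      (s'.setReg 16 (s'.reg 16 - 1)).reg 16 = s.reg 16 - 1 ∧
      (s'.setReg 16 (s'.reg 16 - 1)).reg 18 = 2 ∧
      (s'.setReg 16 (s'.reg 16 - 1)).reg 19 = 0 ∧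
      (s'.setReg 16 (s'.reg 16 - 1)).mem = s.mem ∧
      SameRegs 10 20 s (s'.setReg 16 (s'.reg 16 - 1)) := by
    rintro k hk t s' ⟨h1, h2, h3, h4, h5, h6, h7, h8, h9⟩
    refine ⟨by omega, ?_⟩
    simp [h2, h3, h4, h5, h6, h7, h8, h9]
  split_ifs with h2 h0
  · refine (hloop _ ?_ ?_ ?_ ?_ ?_ ?_ ?_ ?_ ?_ ?_).mono fun t s' h => ?_
    rotate_left 10
    · have := hfin 6 le_rfl t s' h
      simpa only [add_assoc, Nat.reduceAdd, ← add_assoc 1] using this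
    all_goals simp [hc, h11, h14, h18, h19] at h2 h0 ⊢
    simp [show c.length = 1 by omega]
  · refine (hloop _ ?_ ?_ ?_ ?_ ?_ ?_ ?_ ?_ ?_ ?_).mono fun t s' h => ?_
    rotate_left 10
    · have := hfin 6 le_rfl t s' h
      simpa only [add_assoc, Nat.reduceAdd, ← add_assoc 1] using this
    all_goals simp [hc, h11, h14, h18, h19] at h2 h0 ⊢
    simp [h0]
  · refine (hloop _ ?_ ?_ ?_ ?_ ?_ ?_ ?_ ?_ ?_ ?_).mono fun t s' h => ?_
    rotate_left 10
    · have := hfin 5 (by omega) t s' h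
      simpa only [add_assoc, Nat.reduceAdd, ← add_assoc 1] using this
    all_goals simp [hc, h11, h14, h18, h19] at h2 ⊢
    simp [show c.length ≠ 1 by omega]

theorem detects_detectShown (p : PolyExpr n) :
    Detects detectShown p (20 * (encPoly p).length)
      fun j => ∃ j' : Fin n, j'.val = j ∧ ShowsPivot p j' := by
  intro s hp hn h8
  simp only [encPoly, at_cons] at hp
  simp only [detectShown, runs_seq, runs_const, runs_load, runs_inc, runs_copy]
  refine (runs_while (σ := List (ClauseExpr n) × (ℕ × Bool))
    (fun g s' => At (s'.mem 0) (s'.reg 10) (g.1.flatMap encClause) ∧ s'.reg 16 = g.1.length ∧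
      s'.reg 11 = g.2.1 ∧ s'.reg 14 = g.2.2.toNat ∧
      g.1.foldl scanClause g.2 = p.foldl scanClause (n, false) ∧
      s'.reg 10 + (g.1.flatMap encClause).length = s.reg 10 + (encPoly p).length ∧
      s'.reg 18 = 2 ∧ s'.reg 19 = 0 ∧ s'.mem = s.mem ∧ SameRegs 10 20 s s')
    (fun g => 11 * (g.1.flatMap encClause).length + 1) (fun g => by omega) ?_
    (g := (p, (n, false))) ?_).mono ?_
  · rintro ⟨L, w⟩ s₁ ⟨h1, h2, h3, h4, h5, h6, h7, h8, h9, h10⟩ hlt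
    cases L with
    | nil => simp [h2, h8] at hlt
    | cons c L =>
      simp only [List.flatMap_cons, at_append, List.length_append, List.length_cons] at *
      refine (runs_scanClauseStep h1.1 h3 h4 h7 h8).mono ?_
      rintro t s₂ ⟨k1, k2, k3, k4, k5, k6, k7, k8, k9⟩
      refine ⟨(L, scanClause w c), ⟨?_, by dsimp only; omega, k3, k4, h5, by dsimp only; omega,
        k6, k7, k8.trans h9, h10.trans k9 le_rfl le_rfl⟩, ?_⟩
      · rw [k8, k2]
        exact h1.2
      · have : 1 ≤ (encClause c).length := by simp [encClause]
        simp only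
        omega
  · simp [hp, hn, encPoly]
    omega
  · rintro t s₁ ⟨⟨L, w⟩, ⟨h1, h2, h3, h4, h5, h6, h7, h8', h9, h10⟩, hlt, ht⟩
    obtain rfl : L = [] := by
      rw [← List.length_eq_zero_iff]
      simp only at *
      omega
    have hlen : (encPoly p).length = (p.flatMap encClause).length + 1 := by simp [encPoly]
    simp only [List.foldl_nil] at h5
    subst h5
    obtain ⟨_, _, hleads⟩ := leads_of_foldl_scanClause p
    simp only [runs_ifLt, runs_const, runs_copy]
    have e40 : s₁.reg 40 = n := by rw [h10 40 (by omega), hn]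
    simp only [List.flatMap_nil, List.length_nil, add_zero] at h3 h4 h6
    have hmem : SameMem [8] s s₁ := fun a _ => by rw [h9]
    have hregs := h10.mono (lo := 10) (hi := 30) le_rfl (by norm_num)
    dsimp only at ht
    rw [h8', h4]
    rcases hok : (p.foldl scanClause (n, false)).2 with _ | _
    · rw [if_neg (by simp)]
      refine ⟨by omega, by simpa using h6, by simp [e40], ?_, by simp [h9, h8],
        by simpa using hregs, by simpa using hmem⟩
      rintro _ ⟨j, rfl, hj⟩
      rw [foldl_scanClause_of_showsPivot hj] at hok
      cases hok
    · rw [if_pos (by simp)]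
      refine ⟨by omega, by simpa using h6, fun _ => by simpa [h3] using hleads hok, ?_,
        by simp [h9, h8], by simpa using hregs, by simpa using hmem⟩
      rintro _ ⟨j, rfl, hj⟩
      rw [foldl_scanClause_of_showsPivot hj] at h3
      simpa using h3

end RAM

/-! ### Leading variables of linear polynomials by counting occurrences -/

namespace SystemExpr

variable {n : ℕ}

theorem clauseCoef_of_le (c : ClauseExpr n) {i : ℕ} (hi : n ≤ i) : clauseCoef c i = 0 := by
  induction c with
  | nil => simp [clauseCoef]
  | cons l c ih =>
    unfold clauseCoef at *
    have := l.1.2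
    rw [List.map_cons, List.sum_cons, Pi.add_apply, ih, Pi.single_eq_of_ne (by omega), add_zero]

theorem polyCoef_of_le (p : PolyExpr n) {i : ℕ} (hi : n ≤ i) : polyCoef p i = 0 := by
  induction p with
  | nil => simp [polyCoef]
  | cons c p ih =>
    unfold polyCoef at *
    rw [List.map_cons, List.sum_cons, Pi.add_apply, ih, clauseCoef_of_le c hi, add_zero]

end SystemExpr

namespace RAM

open SystemExpr

variable {n : ℕ}

/-- Count the occurrences of the variable at position `10`, modulo `2`, in array `8`. -/
def countLitStep : Program :=
  .seq (.load 13 0 10) <| .seq (.inc 10) <| .seq (.inc 10) <| .seq (.load 14 8 13) <|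
  .seq (.ifLt 19 14 (.const 15 0) (.const 15 1)) <| .seq (.store 8 13 15) <| .dec 12

def countClauseStep : Program :=
  .seq (.load 12 0 10) <| .seq (.inc 10) <| .seq (.whileLt 19 12 countLitStep) <| .dec 16

/-- Count the occurrences of all variables in the polynomial at position `10`. -/
def countOccurrences : Program :=
  .seq (.const 19 0) <| .seq (.load 16 0 10) <| .seq (.inc 10) <| .whileLt 19 16 countClauseStep

/-- Find the first variable with an odd count, and clear the counts. -/
def firstOdd : Program :=
  .seq (.copy 20 40) <| .seq (.copy 11 40) <| .whileLt 19 20 <|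
  .seq (.dec 20) <| .seq (.load 14 8 20) <| .seq (.ifLt 19 14 (.copy 11 20) (.const 13 0)) <|
  .store 8 20 19

/-- Find the leading variable of a linear polynomial. -/
def detectLinear : Program := .seq countOccurrences firstOdd

theorem runs_countLitStep {l : LitExpr n} {h : ℕ → ZMod 2} {s : State}
    (hl : At (s.mem 0) (s.reg 10) (encLit l)) (h8 : s.mem 8 = fun i => (h i).val)
    (h19 : s.reg 19 = 0) :
    Runs countLitStep s fun t s' => t ≤ 10 ∧ s'.reg 10 = s.reg 10 + 2 ∧
      s'.mem 8 = (fun i => ((h + (Pi.single l.1.val 1 : ℕ → ZMod 2)) i).val) ∧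
      s'.reg 12 = s.reg 12 - 1 ∧ s'.reg 16 = s.reg 16 ∧ s'.reg 19 = 0 ∧
      SameRegs 10 20 s s' ∧ SameMem [8] s s' := by
  simp only [encLit, at_cons, at_nil, and_true] at hl
  simp only [countLitStep, runs_seq, runs_const, runs_load, runs_inc, runs_dec, runs_ifLt,
    runs_store]
  have key : ∀ v : ℕ, v = (h l.1 + 1).val → Function.update (fun i => (h i).val) l.1.val v =
      fun i => ((h + (Pi.single l.1.val 1 : ℕ → ZMod 2)) i).val := by
    rintro _ rfl
    ext i
    rw [Function.update_apply, Pi.add_apply, Pi.single_apply]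
    split_ifs with hi
    · rw [hi]
    · rw [add_zero]
  rcases ZMod.eq_zero_or_one (h l.1) with hv | hv
  · simp [hl, h8, h19, hv]
    exact key 1 (by rw [hv]; rfl)
  · simp [hl, h8, h19, hv]
    exact key 0 (by rw [hv]; rfl)

theorem runs_countClauseStep {c : ClauseExpr n} {h : ℕ → ZMod 2} {s : State}
    (hc : At (s.mem 0) (s.reg 10) (encClause c)) (h8 : s.mem 8 = fun i => (h i).val)
    (h19 : s.reg 19 = 0) :
    Runs countClauseStep s fun t s' => t ≤ 10 * (encClause c).length ∧
      s'.reg 10 = s.reg 10 + (encClause c).length ∧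
      s'.mem 8 = (fun i => ((h + clauseCoef c) i).val) ∧ s'.reg 16 = s.reg 16 - 1 ∧
      s'.reg 19 = 0 ∧ SameRegs 10 20 s s' ∧ SameMem [8] s s' := by
  simp only [encClause, at_cons] at hc
  simp only [countClauseStep, runs_seq, runs_load, runs_inc]
  refine (runs_while (σ := List (LitExpr n) × (ℕ → ZMod 2))
    (fun g s' => At (s.mem 0) (s'.reg 10) (g.1.flatMap encLit) ∧ s'.reg 12 = g.1.length ∧
      s'.mem 8 = (fun i => (g.2 i).val) ∧ g.2 + clauseCoef g.1 = h + clauseCoef c ∧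
      s'.reg 10 + (g.1.flatMap encLit).length = s.reg 10 + (encClause c).length ∧
      s'.reg 16 = s.reg 16 ∧ s'.reg 19 = 0 ∧ SameRegs 10 20 s s' ∧ SameMem [8] s s')
    (fun g => 11 * g.1.length + 1) (fun g => by omega) ?_ (g := (c, h)) ?_).mono ?_
  · rintro ⟨L, w⟩ s₁ ⟨h1, h2, h3, h4, h5, h6, h7, h8, h9⟩ hlt
    cases L with
    | nil => simp [h2, h7] at hlt
    | cons l L =>
      simp only [List.flatMap_cons, at_append, List.length_append, List.length_cons] at *
      refine (runs_countLitStep (by rw [h9 0 (by simp)]; exact h1.1) h3 h7).mono ?_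
      rintro t s₂ ⟨k1, k2, k3, k4, k5, k6, k7, k8⟩
      refine ⟨(L, w + Pi.single l.1.val 1), ⟨?_, by dsimp only; omega, k3, ?_, ?_, by omega, k6,
        h8.trans k7 le_rfl le_rfl, h9.trans k8 (by simp)⟩, by dsimp only; omega⟩
      · rw [k2]
        exact h1.2
      · rw [← h4]
        simp [clauseCoef, add_assoc]
      · simp only [encLit, List.length_cons, List.length_nil] at *
        omega
  · simp [hc, h8, h19, encClause]
    omega
  · rintro t s₁ ⟨⟨L, w⟩, ⟨h1, h2, h3, h4, h5, h6, h7, h8, h9⟩, hlt, ht⟩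
    obtain rfl : L = [] := by
      rw [← List.length_eq_zero_iff]
      simp only at *
      omega
    have hlen : (encClause c).length = 2 * c.length + 1 := by
      simp [List.length_flatMap, encClause, encLit, mul_comm]
    simp only [clauseCoef, List.map_nil, List.sum_nil, add_zero, List.flatMap_nil,
      List.length_nil] at h4 h5
    rw [runs_dec]
    refine ⟨by dsimp only at ht; omega, by simpa using h5, ?_, by simp [h6], by simpa using h7,
      by simpa using h8, by simpa using h9⟩
    rw [mem_setReg, h3, h4]
    rfl

theorem runs_countOccurrences {p : PolyExpr n} {s : State}
    (hp : At (s.mem 0) (s.reg 10) (encPoly p)) (h8 : s.mem 8 = fun _ => 0) :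
    Runs countOccurrences s fun t s' => t ≤ 20 * (encPoly p).length ∧
      s'.reg 10 = s.reg 10 + (encPoly p).length ∧
      s'.mem 8 = (fun i => (polyCoef p i).val) ∧ s'.reg 19 = 0 ∧
      SameRegs 10 20 s s' ∧ SameMem [8] s s' := by
  simp only [encPoly, at_cons] at hp
  simp only [countOccurrences, runs_seq, runs_const, runs_load, runs_inc]
  refine (runs_while (σ := List (ClauseExpr n) × (ℕ → ZMod 2))
    (fun g s' => At (s.mem 0) (s'.reg 10) (g.1.flatMap encClause) ∧ s'.reg 16 = g.1.length ∧
      s'.mem 8 = (fun i => (g.2 i).val) ∧ g.2 + polyCoef g.1 = polyCoef p ∧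
      s'.reg 10 + (g.1.flatMap encClause).length = s.reg 10 + (encPoly p).length ∧
      s'.reg 19 = 0 ∧ SameRegs 10 20 s s' ∧ SameMem [8] s s')
    (fun g => 11 * (g.1.flatMap encClause).length + 1) (fun g => by omega) ?_
    (g := (p, 0)) ?_).mono ?_
  · rintro ⟨L, w⟩ s₁ ⟨h1, h2, h3, h4, h5, h6, h7, h8⟩ hlt
    cases L with
    | nil => simp [h2, h6] at hlt
    | cons c L =>
      simp only [List.flatMap_cons, at_append, List.length_append, List.length_cons] at *
      refine (runs_countClauseStep (by rw [h8 0 (by simp)]; exact h1.1) h3 h6).mono ?_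
      rintro t s₂ ⟨k1, k2, k3, k4, k5, k6, k7⟩
      refine ⟨(L, w + clauseCoef c), ⟨?_, by dsimp only; omega, k3, ?_, by dsimp only; omega, k5,
        h7.trans k6 le_rfl le_rfl, h8.trans k7 (by simp)⟩, ?_⟩
      · rw [k2]
        exact h1.2
      · rw [← h4]
        simp [polyCoef, add_assoc]
      · have : 1 ≤ (encClause c).length := by simp [encClause]
        simp only
        omega
  · simp [hp, encPoly, h8]
    omega
  · rintro t s₁ ⟨⟨L, w⟩, ⟨h1, h2, h3, h4, h5, h6, h7, h8⟩, hlt, ht⟩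
    obtain rfl : L = [] := by
      rw [← List.length_eq_zero_iff]
      simp only at *
      omega
    have hlen : (encPoly p).length = (p.flatMap encClause).length + 1 := by simp [encPoly]
    simp only [polyCoef, List.map_nil, List.sum_nil, add_zero, List.flatMap_nil,
      List.length_nil] at h4 h5
    refine ⟨by dsimp only at ht; omega, h5, ?_, h6, h7, h8⟩
    rw [h3, h4]
    rfl

/-- The pass goes downwards and every odd count overwrites register `11`, so the least such index
remains. Clearing on the way makes array `8` ready for the next polynomial. -/
theorem runs_firstOdd {h : ℕ → ZMod 2} (hh : ∀ i, n ≤ i → h i = 0) {s : State}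
    (h8 : s.mem 8 = fun i => (h i).val) (h19 : s.reg 19 = 0) (hn : s.reg 40 = n) :
    Runs firstOdd s fun t s' => t ≤ 6 * n + 3 ∧ s'.reg 10 = s.reg 10 ∧
      s'.mem 8 = (fun _ => 0) ∧ (∀ i < s'.reg 11, h i = 0) ∧
      (s'.reg 11 < n → h (s'.reg 11) = 1) ∧ SameRegs 10 30 s s' ∧ SameMem [8] s s' := by
  simp only [firstOdd, runs_seq, runs_copy]
  refine (runs_while (σ := ℕ)
    (fun j s' => s'.reg 20 = j ∧ s'.reg 19 = 0 ∧ s'.reg 10 = s.reg 10 ∧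
      s'.mem 8 = (fun i => if i < j then (h i).val else 0) ∧
      (∀ i, j ≤ i → i < s'.reg 11 → h i = 0) ∧ (s'.reg 11 < n → h (s'.reg 11) = 1) ∧
      SameRegs 10 30 s s' ∧ SameMem [8] s s')
    (fun j => 6 * j + 1) (fun j => by omega) ?_ (g := n) ?_).mono ?_
  · rintro j s₁ ⟨h1, h2, h3, h4, h5, h6, h7, h8⟩ hlt
    obtain ⟨j, rfl⟩ : ∃ j', j = j' + 1 := ⟨j - 1, by omega⟩
    simp only [runs_seq, runs_dec, runs_load, runs_ifLt, runs_copy, runs_const, runs_store]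
    have hm : Function.update (fun i => if i ≤ j then (h i).val else 0) j 0 =
        fun i => if i < j then (h i).val else 0 := by
      ext i
      rw [Function.update_apply]
      split_ifs <;> first | rfl | omega
    rcases ZMod.eq_zero_or_one (h j) with hv | hv
    · rw [if_neg (by simp [h1, h4, hv])]
      refine ⟨j, ⟨by simp [h1], by simp [h2], by simp [h3], by simp [h1, h2, h4, hm], ?_,
        by simpa using h6, by simpa using h7, by simpa using h8⟩, by omega⟩
      intro i hi hi'
      rcases hi.eq_or_lt with rfl | hi
      exacts [hv, h5 i hi (by simpa using hi')]
    · rw [if_pos (by simp [h1, h2, h4, hv])]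
      refine ⟨j, ⟨by simp [h1], by simp [h2], by simp [h3], by simp [h1, h2, h4, hm], ?_,
        by simp [h1, hv], by simpa using h7, by simpa using h8⟩, by omega⟩
      intro i hi hi'
      simp [h1] at hi'
      omega
  · refine ⟨by simp [hn], by simp [h19], by simp, ?_, ?_, by simp [hn], by simp, by simp⟩
    · ext i
      simp only [mem_setReg, h8]
      split_ifs with hi
      · rfl
      · rw [hh i (by omega), ZMod.val_zero]
    · intro i hi hi'
      simp [hn] at hi'
      omega
  · rintro t s₁ ⟨j, ⟨h1, h2, h3, h4, h5, h6, h7, h8⟩, hlt, ht⟩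
    obtain rfl : j = 0 := by omega
    exact ⟨by omega, h3, by simpa using h4, fun i hi => h5 i (Nat.zero_le i) hi, h6, h7, h8⟩

/-- A leading variable has coefficient `1`, so some count is odd; the first variable with an odd
count leads, and leading variables are unique. Hence no special way of writing a linear polynomial
is needed. -/
theorem detects_detectLinear {p : PolyExpr n} (hp : ∀ c ∈ p, c.length ≤ 1) :
    Detects detectLinear p (20 * (encPoly p).length + 6 * n + 3) (Leads p) := by
  intro s hat hn h8
  rw [detectLinear, runs_seq]
  refine (runs_countOccurrences hat h8).mono ?_
  rintro t₁ s₁ ⟨h1, h2, h3, h4, h5, h6⟩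
  refine (runs_firstOdd (fun i hi => polyCoef_of_le p hi) h3 h4
    (by rw [h5 40 (by omega), hn])).mono ?_
  rintro t₂ s₂ ⟨k1, k2, k3, k4, k5, k6, k7⟩
  have hl : s₂.reg 11 < n → Leads p (s₂.reg 11) := fun hlt =>
    leads_of_polyCoef hp hlt (k5 hlt) k4
  refine ⟨by omega, by rw [k2, h2], hl, fun j hj => ?_, k3,
    (h5.mono le_rfl (by norm_num)).trans k6 le_rfl le_rfl, h6.trans k7 (by simp)⟩
  have h1 := polyCoef_eq_one_of_leads hp hj
  refine Leads.unique (hl ?_) hj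
  by_contra hlt
  have := k4 j (by have := hj.1; omega)
  rw [this] at h1
  exact zero_ne_one h1

end RAM

/-! ### Gaussian elimination over the field with two elements -/

/-- Vectors in echelon form: every vector comes with a position below `m` where it is `1` and where
the later vectors are `0`. -/
structure IsEchelon (m : ℕ) (bs : List ((ℕ → ZMod 2) × ℕ)) : Prop where
  one : ∀ b ∈ bs, b.1 b.2 = 1
  lt : ∀ b ∈ bs, b.2 < m
  supp : ∀ b ∈ bs, ∀ i, m < i → b.1 i = 0
  zero : bs.Pairwise fun b c => c.1 b.2 = 0

/-- Subtract multiples of the vectors in `bs` from `v` to clear the leading positions. -/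
def reduceVec (bs : List ((ℕ → ZMod 2) × ℕ)) (v : ℕ → ZMod 2) : ℕ → ZMod 2 :=
  bs.foldl (fun v b => v + v b.2 • b.1) v

/-- The span of the vectors in `bs`. -/
def listSpan (bs : List ((ℕ → ZMod 2) × ℕ)) : Submodule (ZMod 2) (ℕ → ZMod 2) :=
  Submodule.span (ZMod 2) {v | ∃ b ∈ bs, b.1 = v}

theorem listSpan_mono {bs cs : List ((ℕ → ZMod 2) × ℕ)} (h : bs ⊆ cs) :
    listSpan bs ≤ listSpan cs :=
  Submodule.span_mono fun _ ⟨b, hb, hv⟩ => ⟨b, h hb, hv⟩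

theorem mem_listSpan {bs : List ((ℕ → ZMod 2) × ℕ)} {b : (ℕ → ZMod 2) × ℕ} (hb : b ∈ bs) :
    b.1 ∈ listSpan bs := Submodule.subset_span ⟨b, hb, rfl⟩

theorem reduceVec_sub_mem (bs : List ((ℕ → ZMod 2) × ℕ)) (v : ℕ → ZMod 2) :
    reduceVec bs v - v ∈ listSpan bs := by
  induction bs generalizing v with
  | nil => simp [reduceVec]
  | cons b bs ih =>
    have h1 := listSpan_mono (List.subset_cons_self b bs) (ih (v + v b.2 • b.1))
    have h2 := (listSpan (b :: bs)).add_mem h1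
      ((listSpan (b :: bs)).smul_mem (v b.2) (mem_listSpan (List.mem_cons_self ..)))
    have h3 : reduceVec (b :: bs) v - v =
        reduceVec bs (v + v b.2 • b.1) - (v + v b.2 • b.1) + v b.2 • b.1 := by
      rw [show reduceVec (b :: bs) v = reduceVec bs (v + v b.2 • b.1) from rfl]
      abel
    rwa [h3]

theorem reduceVec_apply_of_zero {bs : List ((ℕ → ZMod 2) × ℕ)} {v : ℕ → ZMod 2} {i : ℕ}
    (h : ∀ b ∈ bs, b.1 i = 0) : reduceVec bs v i = v i := by
  induction bs generalizing v with
  | nil => rfl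
  | cons b bs ih =>
    have := ih (v := v + v b.2 • b.1) fun c hc => h c (by simp [hc])
    rw [show reduceVec (b :: bs) v = reduceVec bs (v + v b.2 • b.1) from rfl, this]
    simp [h b]

theorem IsEchelon.tail {m : ℕ} {b : (ℕ → ZMod 2) × ℕ} {bs : List ((ℕ → ZMod 2) × ℕ)}
    (h : IsEchelon m (b :: bs)) : IsEchelon m bs where
  one c hc := h.one c (by simp [hc])
  lt c hc := h.lt c (by simp [hc])
  supp c hc := h.supp c (by simp [hc])
  zero := (List.pairwise_cons.1 h.zero).2

/-- The step for `b` clears the entry at `b.2`, and the later vectors vanish there. -/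
theorem IsEchelon.reduceVec_apply {m : ℕ} {bs : List ((ℕ → ZMod 2) × ℕ)} (h : IsEchelon m bs)
    (v : ℕ → ZMod 2) : ∀ b ∈ bs, reduceVec bs v b.2 = 0 := by
  induction bs generalizing v with
  | nil => simp
  | cons b bs ih =>
    intro c hc
    rw [show reduceVec (b :: bs) v = reduceVec bs (v + v b.2 • b.1) from rfl]
    rcases List.mem_cons.1 hc with rfl | hc
    · rw [reduceVec_apply_of_zero (List.pairwise_cons.1 h.zero).1]
      simp [h.one c (by simp), CharTwo.add_self_eq_zero]
    · exact ih h.tail _ c hc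

theorem IsEchelon.append {m : ℕ} {bs : List ((ℕ → ZMod 2) × ℕ)} (h : IsEchelon m bs)
    {v : ℕ → ZMod 2} {x : ℕ} (hv : ∀ i, m < i → v i = 0) (hx : x < m)
    (h1 : reduceVec bs v x = 1) : IsEchelon m (bs ++ [(reduceVec bs v, x)]) where
  one b hb := by
    rcases List.mem_append.1 hb with hb | hb
    · exact h.one b hb
    · rw [List.mem_singleton.1 hb]
      exact h1
  lt b hb := by
    rcases List.mem_append.1 hb with hb | hb
    · exact h.lt b hb
    · rw [List.mem_singleton.1 hb]
      exact hx
  supp b hb i hi := by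
    rcases List.mem_append.1 hb with hb | hb
    · exact h.supp b hb i hi
    · rw [List.mem_singleton.1 hb]
      exact (reduceVec_apply_of_zero fun c hc => h.supp c hc i hi).trans (hv i hi)
  zero := by
    rw [List.pairwise_append]
    refine ⟨h.zero, List.pairwise_singleton .., fun b hb c hc => ?_⟩
    rw [List.mem_singleton.1 hc]
    exact h.reduceVec_apply v b hb

/-- At the position of the first vector all others vanish, so its coefficient is `0`; then the same
holds for the next one. In particular the unit vector at `m` is not in the span, because all
positions lie below `m`. -/
theorem IsEchelon.eq_zero {m : ℕ} {bs : List ((ℕ → ZMod 2) × ℕ)} (h : IsEchelon m bs)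
    {v : ℕ → ZMod 2} (hv : v ∈ listSpan bs) (h0 : ∀ i < m, v i = 0) : v = 0 := by
  induction bs with
  | nil => simpa [listSpan] using hv
  | cons b bs ih =>
    have hspan : listSpan (b :: bs) = Submodule.span (ZMod 2) {b.1} ⊔ listSpan bs := by
      unfold listSpan
      rw [← Submodule.span_union]
      congr 1
      ext w
      simp [eq_comm]
    rw [hspan, Submodule.mem_sup] at hv
    obtain ⟨u, hu, w, hw, rfl⟩ := hv
    obtain ⟨c, rfl⟩ := Submodule.mem_span_singleton.1 hu
    have hw0 : w b.2 = 0 := by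
      refine Submodule.span_induction (p := fun w _ => w b.2 = 0) ?_ rfl ?_ ?_ hw
      · rintro _ ⟨c, hc, rfl⟩
        exact (List.pairwise_cons.1 h.zero).1 c hc
      · intro x y _ _ hx hy
        rw [Pi.add_apply, hx, hy, add_zero]
      · intro r x _ hx
        rw [Pi.smul_apply, hx, smul_zero]
    have hc : c = 0 := by
      have := h0 b.2 (h.lt b (by simp))
      simpa [hw0, h.one b (by simp)] using this
    subst hc
    simp only [zero_smul, zero_add] at ih h0 ⊢
    exact ih h.tail hw

/-! ### Gaussian elimination on the machine -/

namespace RAM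

/-- The entries of `v` from the `i`-th one on. -/
def vecList (v : ℕ → ZMod 2) (i k : ℕ) : List ℕ := (List.range' i k).map fun i => (v i).val

@[simp] theorem length_vecList (v : ℕ → ZMod 2) (i k : ℕ) : (vecList v i k).length = k := by
  simp [vecList]

theorem vecList_succ (v : ℕ → ZMod 2) (i k : ℕ) :
    vecList v i (k + 1) = (v i).val :: vecList v (i + 1) k := by
  simp [vecList, List.range'_succ]

theorem vecList_succ' (v : ℕ → ZMod 2) (k : ℕ) :
    vecList v 0 (k + 1) = vecList v 0 k ++ [(v k).val] := by
  simp [vecList, List.range'_concat]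

theorem At.update {M : ℕ → ℕ} {p i a : ℕ} {l : List ℕ} (h : At M p l) (hi : p + l.length ≤ i) :
    At (Function.update M i a) p l := by
  induction l generalizing p with
  | nil => trivial
  | cons b l ih =>
    rw [List.length_cons] at hi
    exact ⟨by rw [Function.update_of_ne (by omega)]; exact h.1, ih h.2 (by omega)⟩

theorem At.update_end {M : ℕ → ℕ} {a : ℕ} {l : List ℕ} (h : At M 0 l) :
    At (Function.update M l.length a) 0 (l ++ [a]) := by
  rw [at_append]
  exact ⟨h.update (by simp), by simp⟩

/-- Array `6` holds the vectors of `bs`, of `m + 1` entries each, one after the other, and array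
`7` their leading positions. -/
structure Stores (m : ℕ) (bs : List ((ℕ → ZMod 2) × ℕ)) (s : State) : Prop where
  vec : At (s.mem 6) 0 (bs.flatMap fun b => vecList b.1 0 (m + 1))
  pos : At (s.mem 7) 0 (bs.map fun b => b.2)
  len : s.reg 41 = m
  len' : s.reg 47 = m + 1
  cnt : s.reg 45 = bs.length
  fin : s.reg 46 = (bs.flatMap fun b => vecList b.1 0 (m + 1)).length

theorem Stores.of_same {m : ℕ} {bs : List ((ℕ → ZMod 2) × ℕ)} {s s' : State}
    (h : Stores m bs s) {lo hi : ℕ} (hr : SameRegs lo hi s s') (hhi : hi ≤ 41) {A : List ℕ}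
    (hm : SameMem A s s') (h6 : 6 ∉ A) (h7 : 7 ∉ A) : Stores m bs s' where
  vec := by rw [hm 6 h6]; exact h.vec
  pos := by rw [hm 7 h7]; exact h.pos
  len := (hr 41 (by omega)).trans h.len
  len' := (hr 47 (by omega)).trans h.len'
  cnt := (hr 45 (by omega)).trans h.cnt
  fin := (hr 46 (by omega)).trans h.fin

/-- Add `y` times the vector at position `31` of array `6` to array `5`, where `y` is in
register `33`. -/
def addVec : Program :=
  .seq (.const 34 0) <| .whileLt 34 47 <|
  .seq (.load 35 6 31) <| .seq (.inc 31) <|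
  -- The vector is walked through even if the factor is `0`, because register `31` has to reach the
  -- next vector.
  .seq (.ifLt 39 35
    (.ifLt 39 33
      (.seq (.load 36 5 34) <| .ifLt 39 36 (.store 5 34 39) (.store 5 34 38))
      (.const 37 0))
    (.const 37 0)) <| .inc 34

/-- Reduce the vector in array `5`. -/
def reduceProg : Program :=
  .seq (.const 39 0) <| .seq (.const 38 1) <| .seq (.const 30 0) <| .seq (.const 31 0) <|
  .whileLt 30 45 <|
  .seq (.load 32 7 30) <| .seq (.load 33 5 32) <| .seq addVec <| .inc 30

/-- Append the vector in array `5` to the stored vectors if one of its entries, except the last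
one, is not `0`. Otherwise write `1` to register `0` if the last entry is not `0`. -/
def insertProg : Program :=
  .seq (.const 39 0) <| .seq (.const 34 0) <| .seq (.const 37 0) <|
  .seq (.whileLt 34 41 <|
    .seq (.load 35 5 34) <|
    .seq (.ifLt 39 35 (.seq (.copy 36 34) (.const 37 1)) (.const 38 0)) <| .inc 34) <|
  .ifLt 39 37
    (.seq (.store 7 45 36) <| .seq (.inc 45) <| .seq (.const 34 0) <|
      .whileLt 34 47 <|
      .seq (.load 35 5 34) <| .seq (.store 6 46 35) <| .seq (.inc 46) <| .inc 34)
    (.seq (.load 35 5 41) <| .ifLt 39 35 (.const 0 1) (.const 38 0))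

theorem runs_addVec {m : ℕ} {v w : ℕ → ZMod 2} (hw : ∀ i, m < i → w i = 0) {y : ZMod 2}
    {s : State} (hv : s.mem 5 = fun i => (v i).val)
    (hat : At (s.mem 6) (s.reg 31) (vecList w 0 (m + 1))) (hy : s.reg 33 = y.val)
    (h47 : s.reg 47 = m + 1) (h38 : s.reg 38 = 1) (h39 : s.reg 39 = 0) :
    Runs addVec s fun t s' => t ≤ 9 * (m + 1) + 2 ∧ s'.reg 31 = s.reg 31 + (m + 1) ∧
      s'.mem 5 = (fun i => ((v + y • w) i).val) ∧ s'.reg 30 = s.reg 30 ∧ s'.reg 38 = 1 ∧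
      s'.reg 39 = 0 ∧ SameRegs 30 40 s s' ∧ SameMem [5] s s' := by
  simp only [addVec, runs_seq, runs_const]
  refine (runs_while (σ := ℕ × ℕ)
    (fun g s' => g.1 + g.2 = m + 1 ∧ s'.reg 34 = g.1 ∧ s'.reg 31 = s.reg 31 + g.1 ∧
      At (s.mem 6) (s'.reg 31) (vecList w g.1 g.2) ∧
      s'.mem 5 = (fun i => if i < g.1 then (v i + y * w i).val else (v i).val) ∧
      s'.reg 30 = s.reg 30 ∧ s'.reg 33 = y.val ∧ s'.reg 38 = 1 ∧ s'.reg 39 = 0 ∧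
      SameRegs 30 40 s s' ∧ SameMem [5] s s')
    (fun g => 9 * g.2 + 1) (fun g => by omega) ?_ (g := (0, m + 1)) ?_).mono ?_
  · rintro ⟨i, k⟩ s₁ ⟨h1, h2, h3, h4, h5, h6, h7, h8, h9, h10, h11⟩ hlt
    dsimp only at *
    cases k with
    | zero =>
      rw [h2, h10 47 (by omega), h47] at hlt
      omega
    | succ k =>
      rw [vecList_succ, at_cons] at h4
      simp only [runs_seq, runs_load, runs_inc, runs_ifLt, runs_store, runs_const]
      have e6 : s₁.mem 6 = s.mem 6 := h11 6 (by simp)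
      have hstep : ∀ u : ℕ, u = (v i + y * w i).val →
          Function.update (fun l => if l < i then (v l + y * w l).val else (v l).val) i u =
            fun l => if l < i + 1 then (v l + y * w l).val else (v l).val := by
        rintro _ rfl
        ext l
        rw [Function.update_apply]
        split_ifs with c1 c2 c3 c4 <;> first | rfl | omega | rw [c1]
      have hskip : y * w i = 0 →
          (fun l => if l < i then (v l + y * w l).val else (v l).val) =
            fun l => if l < i + 1 then (v l + y * w l).val else (v l).val := fun h0 => by
        ext l
        split_ifs with c1 c2 <;> first | rfl | omega | skip
        rw [show l = i by omega, h0, add_zero]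
      rcases ZMod.eq_zero_or_one (w i) with hwi | hwi
      · rw [if_neg (by simp [e6, h4.1, hwi])]
        refine ⟨(i + 1, k), ⟨by omega, by simp [h2], by simp [h3, add_assoc],
          by simpa using h4.2, ?_, by simpa using h6, by simpa using h7, by simpa using h8,
          by simpa using h9, by simpa using h10, by simpa using h11⟩, by omega⟩
        simp only [mem_setReg, h5]
        exact hskip (by simp [hwi])
      · rw [if_pos (by simp [e6, h4.1, hwi, h9])]
        rcases ZMod.eq_zero_or_one y with hyi | hyi
        · rw [if_neg (by simp [h7, hyi])]
          refine ⟨(i + 1, k), ⟨by omega, by simp [h2], by simp [h3, add_assoc],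
            by simpa using h4.2, ?_, by simpa using h6, by simpa using h7, by simpa using h8,
            by simpa using h9, by simpa using h10, by simpa using h11⟩, by omega⟩
          simp only [mem_setReg, h5]
          exact hskip (by simp [hyi])
        · rw [if_pos (by simp [h7, hyi, h9])]
          rcases ZMod.eq_zero_or_one (v i) with hvi | hvi
          · rw [if_neg (by simp [h5, h2, hvi])]
            refine ⟨(i + 1, k), ⟨by omega, by simp [h2], by simp [h3, add_assoc],
              by simpa using h4.2, ?_, by simpa using h6, by simpa using h7, by simpa using h8,
              by simpa using h9, by simpa using h10, by simpa using h11⟩, by omega⟩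
            simpa [h2, h5, h8] using hstep 1 (by simp [hvi, hyi, hwi])
          · rw [if_pos (by simp [h5, h2, hvi, h9])]
            refine ⟨(i + 1, k), ⟨by omega, by simp [h2], by simp [h3, add_assoc],
              by simpa using h4.2, ?_, by simpa using h6, by simpa using h7, by simpa using h8,
              by simpa using h9, by simpa using h10, by simpa using h11⟩, by omega⟩
            simpa [h2, h5, h9] using
              hstep 0 (by simp [hvi, hyi, hwi, CharTwo.add_self_eq_zero])
  · exact ⟨by omega, by simp, by simp, by simpa using hat, by simpa using hv, by simp,
      by simpa using hy, by simpa using h38, by simpa using h39, by simp, by simp⟩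
  · rintro t s₁ ⟨⟨i, k⟩, ⟨h1, h2, h3, h4, h5, h6, h7, h8, h9, h10, h11⟩, hlt, ht⟩
    dsimp only at *
    rw [h2, h10 47 (by omega), h47] at hlt
    obtain rfl : i = m + 1 := by omega
    refine ⟨by omega, h3, ?_, h6, h8, h9, h10, h11⟩
    rw [h5]
    ext i
    simp only [Pi.add_apply, Pi.smul_apply, smul_eq_mul]
    split_ifs with hi
    · rfl
    · rw [hw i (by omega), mul_zero, add_zero]

theorem runs_reduceProg {m : ℕ} {bs : List ((ℕ → ZMod 2) × ℕ)} (hbs : IsEchelon m bs)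
    {v : ℕ → ZMod 2} {s : State} (hs : Stores m bs s) (hv : s.mem 5 = fun i => (v i).val) :
    Runs reduceProg s fun t s' => t ≤ bs.length * (9 * (m + 1) + 6) + 5 ∧
      s'.mem 5 = (fun i => (reduceVec bs v i).val) ∧ SameRegs 30 40 s s' ∧ SameMem [5] s s' := by
  simp only [reduceProg, runs_seq, runs_const]
  refine (runs_while (σ := ℕ × List ((ℕ → ZMod 2) × ℕ) × (ℕ → ZMod 2))
    (fun g s' => g.1 + g.2.1.length = bs.length ∧ s'.reg 30 = g.1 ∧ g.2.1 ⊆ bs ∧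
      At (s.mem 6) (s'.reg 31) (g.2.1.flatMap fun b => vecList b.1 0 (m + 1)) ∧
      At (s.mem 7) g.1 (g.2.1.map fun b => b.2) ∧
      s'.mem 5 = (fun i => (g.2.2 i).val) ∧ reduceVec g.2.1 g.2.2 = reduceVec bs v ∧
      s'.reg 38 = 1 ∧ s'.reg 39 = 0 ∧ SameRegs 30 40 s s' ∧ SameMem [5] s s')
    (fun g => g.2.1.length * (9 * (m + 1) + 6) + 1) (fun g => by omega) ?_
    (g := (0, bs, v)) ?_).mono ?_
  · rintro ⟨i, L, u⟩ s₁ ⟨h1, h2, h3, h4, h5, h6, h7, h8, h9, h10, h11⟩ hlt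
    dsimp only at *
    cases L with
    | nil =>
      rw [h2, h10 45 (by omega), hs.cnt] at hlt
      simp at h1
      omega
    | cons b L =>
      simp only [List.flatMap_cons, at_append, length_vecList, List.map_cons, at_cons] at h4 h5
      simp only [runs_seq, runs_load, runs_inc]
      have e6 : s₁.mem 6 = s.mem 6 := h11 6 (by simp)
      have e7 : s₁.mem 7 = s.mem 7 := h11 7 (by simp)
      refine (runs_addVec (m := m) (v := u) (w := b.1) (y := u b.2)
        (hbs.supp b (h3 (by simp))) (by simpa using h6) (by simpa [e6] using h4.1)
        (by simp [h2, e7, h5.1, h6]) (by simpa [h10 47] using hs.len')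
        (by simpa using h8) (by simpa using h9)).mono ?_
      rintro t s₂ ⟨k1, k2, k3, k4, k5, k6, k7, k8⟩
      simp only [reg_setReg] at k2 k4
      have hg : (L.length + 1) * (9 * (m + 1) + 6) =
        L.length * (9 * (m + 1) + 6) + (9 * (m + 1) + 6) := by ring
      refine ⟨(i + 1, L, u + u b.2 • b.1), ⟨?_, ?_, fun c hc => h3 (by simp [hc]), ?_, h5.2,
        by simpa using k3, h7, by simpa using k5, by simpa using k6, ?_, ?_⟩, ?_⟩
      · simp only [List.length_cons] at h1 ⊢
        omega
      · simp at k4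
        simp [k4, h2]
      · simp at k2
        simpa [k2] using h4.2
      · rw [sameRegs_setReg (by norm_num) (by norm_num)]
        exact SameRegs.trans (by simpa using h10) k7 le_rfl le_rfl
      · rw [sameMem_setReg]
        exact SameMem.trans (by simpa using h11) k8 (by simp)
      · simp only [List.length_cons]
        omega
  · refine ⟨by simp, by simp, fun _ h => h, by simpa using hs.vec, by simpa using hs.pos,
      by simpa using hv, rfl, by simp, by simp, by simp, by simp⟩
  · rintro t s₁ ⟨⟨i, L, u⟩, ⟨h1, h2, h3, h4, h5, h6, h7, h8, h9, h10, h11⟩, hlt, ht⟩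
    dsimp only at *
    rw [h2, h10 45 (by omega), hs.cnt] at hlt
    obtain rfl : L = [] := by
      rw [← List.length_eq_zero_iff]
      omega
    exact ⟨by omega, by rw [h6, ← h7]; rfl, h10, h11⟩

/-- Each nonzero entry overwrites register `36`, so the last one below `m` becomes the leading
position; any of them would do. The entry at `m` is excluded, since it tells affine from other
combinations. -/
theorem runs_insertProg {m : ℕ} {bs : List ((ℕ → ZMod 2) × ℕ)} {v : ℕ → ZMod 2} {s : State}
    (hs : Stores m bs s) (hv : s.mem 5 = fun i => (v i).val) :
    Runs insertProg s fun t s' => t ≤ 11 * (m + 1) + 15 ∧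
      ((∃ x < m, v x = 1 ∧ Stores m (bs ++ [(v, x)]) s' ∧ s'.reg 0 = s.reg 0) ∨
        ((∀ x < m, v x = 0) ∧ Stores m bs s' ∧
          s'.reg 0 = if v m = 1 then 1 else s.reg 0)) ∧
      (∀ r, 0 < r ∧ r < 30 ∨ 40 ≤ r ∧ r < 45 ∨ 47 ≤ r → s'.reg r = s.reg r) ∧
      SameMem [6, 7] s s' := by
  simp only [insertProg, runs_seq, runs_const]
  refine (runs_while (σ := ℕ)
    (fun i s' => i ≤ m ∧ s'.reg 34 = i ∧ s'.reg 39 = 0 ∧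
      (s'.reg 37 = 1 ∧ s'.reg 36 < m ∧ v (s'.reg 36) = 1 ∨
        s'.reg 37 = 0 ∧ ∀ x < i, v x = 0) ∧ SameRegs 30 40 s s' ∧ SameMem [] s s')
    (fun i => 6 * (m - i) + 1) (fun i => by omega) ?_ (g := 0) ?_).mono ?_
  · rintro i s₁ ⟨h1, h2, h3, h4, h5, h6⟩ hlt
    have e5 : s₁.mem 5 = s.mem 5 := h6 5 (by simp)
    have him : i < m := by rwa [h2, h5 41 (by omega), hs.len] at hlt
    simp only [runs_seq, runs_load, runs_ifLt, runs_copy, runs_const, runs_inc]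
    rcases ZMod.eq_zero_or_one (v i) with hvi | hvi
    · rw [if_neg (by simp [h2, e5, hv, hvi])]
      refine ⟨i + 1, ⟨him, by simp [h2], by simpa using h3, ?_, by simpa using h5,
        by simpa using h6⟩, by omega⟩
      refine h4.imp (fun h => by simpa using h) fun h => ⟨by simpa using h.1, fun x hx => ?_⟩
      rcases (Nat.lt_succ_iff.1 hx).eq_or_lt with rfl | hx
      exacts [hvi, h.2 x hx]
    · rw [if_pos (by simp [h2, e5, hv, hvi, h3])]
      exact ⟨i + 1, ⟨him, by simp [h2], by simpa using h3, Or.inl (by simp [h2, him, hvi]),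
        by simpa using h5, by simpa using h6⟩, by omega⟩
  · simp
  · rintro t s₁ ⟨i, ⟨h1, h2, h3, h4, h5, h6⟩, hlt, ht⟩
    have e5 : s₁.mem 5 = s.mem 5 := h6 5 (by simp)
    have hs₁ := hs.of_same h5 (by omega) h6 (by simp) (by simp)
    rw [h2, h5 41 (by omega), hs.len] at hlt
    obtain rfl : i = m := by omega
    simp only [runs_seq, runs_load, runs_ifLt, runs_const, runs_store, runs_inc]
    rcases h4 with ⟨h37, h36, h1'⟩ | ⟨h37, h0⟩
    · rw [if_pos (by omega)]
      refine (runs_while (σ := ℕ)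
        (fun j s' => j ≤ i + 1 ∧ s'.reg 34 = j ∧ s'.reg 45 = bs.length + 1 ∧
          s'.reg 46 = (bs.flatMap fun b => vecList b.1 0 (i + 1)).length + j ∧
          At (s'.mem 6) 0 ((bs.flatMap fun b => vecList b.1 0 (i + 1)) ++ vecList v 0 j) ∧
          s'.mem 7 = Function.update (s.mem 7) bs.length (s₁.reg 36) ∧
          (∀ r, r < 30 ∨ 40 ≤ r ∧ r < 45 ∨ 47 ≤ r → s'.reg r = s.reg r) ∧
          SameMem [6, 7] s s')
        (fun j => 5 * (i + 1 - j) + 1) (fun i => by omega) ?_ (g := 0) ?_).mono ?_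
      · rintro j s₂ ⟨k1, k2, k3, k4, k5, k6, k7, k8⟩ hlt'
        have e5' : s₂.mem 5 = s.mem 5 := k8 5 (by simp)
        rw [k2, k7 47 (by omega), hs.len'] at hlt'
        simp only [runs_seq, runs_load, runs_store, runs_inc]
        refine ⟨j + 1, ⟨hlt', by simp [k2], by simpa using k3, by simp [k4, add_assoc], ?_,
          by simpa using k6, ?_, by simpa using k8⟩, by omega⟩
        · have := k5.update_end (a := (v j).val)
          rw [vecList_succ', ← List.append_assoc]
          rw [List.length_append, length_vecList, ← k4] at this
          simpa [k2, e5', hv] using this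
        · intro r hr
          simp only [reg_setReg, reg_setMem]
          rw [if_neg (by omega), if_neg (by omega), if_neg (by omega), k7 r hr]
      · refine ⟨by omega, by simp, by simp [hs₁.cnt], by simp [hs₁.fin],
          by simpa [vecList] using hs₁.vec, by simp [hs₁.cnt, h6 7], ?_, ?_⟩
        · intro r hr
          simp only [reg_setReg, reg_setMem]
          rw [if_neg (by omega), if_neg (by omega), h5 r (by omega)]
        · intro a ha
          simp at ha
          simp [ha, h6 a]
      · rintro t' s₂ ⟨j, ⟨k1, k2, k3, k4, k5, k6, k7, k8⟩, hlt', ht'⟩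
        rw [k2, k7 47 (by omega), hs.len'] at hlt'
        obtain rfl : j = i + 1 := by omega
        refine ⟨by omega, Or.inl ⟨s₁.reg 36, h36, h1', ⟨?_, ?_, ?_, ?_, ?_, ?_⟩,
          k7 0 (by omega)⟩, fun r hr => k7 r (by omega), k8⟩
        · simpa using k5
        · have := hs.pos.update_end (a := s₁.reg 36)
          rw [List.length_map] at this
          simpa [k6] using this
        · rw [k7 41 (by omega), hs.len]
        · rw [k7 47 (by omega), hs.len']
        · simp [k3]
        · simp only [List.flatMap_append, List.length_append, List.flatMap_cons, List.flatMap_nil,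
            List.append_nil, length_vecList, k4]
    · rw [if_neg (by omega)]
      have hfr : ∀ (a b x y : ℕ), 30 ≤ a → a < 40 → (b = 0 ∨ 30 ≤ b ∧ b < 40) →
          ∀ r, 0 < r ∧ r < 30 ∨ 40 ≤ r ∧ r < 45 ∨ 47 ≤ r →
            ((s₁.setReg a x).setReg b y).reg r = s.reg r := fun a b x y ha ha' hb r hr => by
        rw [reg_setReg, if_neg (by omega), reg_setReg, if_neg (by omega), h5 r (by omega)]
      have hst : ∀ (a b x y : ℕ), 30 ≤ a → a < 40 → (b = 0 ∨ 30 ≤ b ∧ b < 40) →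
          Stores i bs ((s₁.setReg a x).setReg b y) := fun a b x y ha ha' hb =>
        ⟨by simpa using hs₁.vec, by simpa using hs₁.pos,
          by rw [hfr a b x y ha ha' hb 41 (by omega), hs.len],
          by rw [hfr a b x y ha ha' hb 47 (by omega), hs.len'],
          by rw [reg_setReg, if_neg (by omega), reg_setReg, if_neg (by omega), hs₁.cnt],
          by rw [reg_setReg, if_neg (by omega), reg_setReg, if_neg (by omega), hs₁.fin]⟩
      have hmem : SameMem [6, 7] s s₁ := fun a _ => h6 a (by simp)
      rcases ZMod.eq_zero_or_one (v i) with hvi | hvi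
      · rw [if_neg (by simp [e5, hv, hs₁.len, hvi])]
        refine ⟨by omega, Or.inr ⟨h0, hst _ _ _ _ (by omega) (by omega) (by omega), ?_⟩,
          hfr _ _ _ _ (by omega) (by omega) (by omega), by simpa using hmem⟩
        simp [hvi, h5 0]
      · rw [if_pos (by simp [e5, hv, hs₁.len, hvi, h3])]
        refine ⟨by omega, Or.inr ⟨h0, hst _ _ _ _ (by omega) (by omega) (by omega), ?_⟩,
          hfr _ _ _ _ (by omega) (by omega) (by omega), by simpa using hmem⟩
        simp [hvi]

end RAM

/-! ### Affine combinations of points and the vectors of their values -/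

namespace SystemExpr

variable {n : ℕ}

/-- All clauses have at most one literal. -/
def IsLinear (S : SystemExpr n) : Prop := ∀ p ∈ S, ∀ c ∈ p, c.length ≤ 1

/-- The values of the polynomials of a system, followed by a `1`. -/
def valuesVec (S : SystemExpr n) (a : ℕ → ZMod 2) : ℕ → ZMod 2 := fun i =>
  if i < S.length then polyEval a (S.getD i []) else if i = S.length then 1 else 0

theorem valuesVec_congr {S : SystemExpr n} {a b : ℕ → ZMod 2} (h : ∀ i < n, a i = b i) :
    valuesVec S a = valuesVec S b := by
  ext i
  unfold valuesVec
  rw [polyEval_congr h]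

/-- Weights with sum `1` reproduce the constant term, so affine functions respect such combinations.
-/
theorem polyEval_sum_of_linear {p : PolyExpr n} (hp : ∀ c ∈ p, c.length ≤ 1) {ι : Type*}
    (s : Finset ι) (w : ι → ZMod 2) (hw : ∑ c ∈ s, w c = 1) (a : ι → ℕ → ZMod 2) :
    polyEval (∑ c ∈ s, w c • a c) p = ∑ c ∈ s, w c * polyEval (a c) p := by
  have h : ∀ c ∈ s, w c * polyEval (a c) p =
      w c * polyEval 0 p + w c * ∑ i ∈ Finset.range n, polyCoef p i * a c i := fun c _ => by
    rw [polyEval_eq_of_linear hp (a c), mul_add]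
  rw [polyEval_eq_of_linear hp, Finset.sum_congr rfl h, Finset.sum_add_distrib, ← Finset.sum_mul,
    hw, one_mul]
  congr 1
  simp only [Finset.sum_apply, Pi.smul_apply, smul_eq_mul, Finset.mul_sum]
  rw [Finset.sum_comm]
  exact Finset.sum_congr rfl fun c _ => Finset.sum_congr rfl fun i _ => by ring

theorem valuesVec_sum {S : SystemExpr n} (hS : IsLinear S) {ι : Type*}
    (s : Finset ι) (w : ι → ZMod 2) (hw : ∑ c ∈ s, w c = 1) (a : ι → ℕ → ZMod 2) :
    valuesVec S (∑ c ∈ s, w c • a c) = ∑ c ∈ s, w c • valuesVec S (a c) := by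
  ext i
  simp only [Finset.sum_apply, Pi.smul_apply, smul_eq_mul]
  unfold valuesVec
  split_ifs with h1 h2
  · refine polyEval_sum_of_linear (hS _ ?_) s w hw a
    rw [List.getD_eq_getElem _ _ h1]
    exact List.getElem_mem h1
  · simp [hw]
  · simp

/-- `a` is the solution of `g 0 = ⋯ = g (R - 1) = 0` with the free variables equal to `0`, except
for the `c`-th one. -/
def IsPoint (R : ℕ) (g : ℕ → PolyExpr n) (c : ℕ) (a : ℕ → ZMod 2) : Prop :=
  (∀ i, R ≤ i → i < n → a i = if i = c then 1 else 0) ∧ ∀ j < R, polyEval a (g j) = 0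

/-- The values of the system at the points with numbers in `[R, c)`. -/
def pointValues (S : SystemExpr n) (R : ℕ) (g : ℕ → PolyExpr n) (c : ℕ) : Set (ℕ → ZMod 2) :=
  {v | ∃ c', R ≤ c' ∧ c' < c ∧ ∃ a, IsPoint R g c' a ∧ v = valuesVec S a}

/-- By `eq_of_leads`, all points with number `c` agree on the variables, so they contribute only one
vector. -/
theorem mem_pointValues_succ {S : SystemExpr n} {R : ℕ} {g : ℕ → PolyExpr n}
    (hg : ∀ j < R, Leads (g j) j) {c : ℕ} (hc : R ≤ c) {a : ℕ → ZMod 2} (ha : IsPoint R g c a)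
    {v : ℕ → ZMod 2} : v ∈ pointValues S R g (c + 1) ↔
      v ∈ pointValues S R g c ∨ v = valuesVec S a := by
  constructor
  · rintro ⟨c', h1, h2, b, hb, rfl⟩
    rcases (Nat.lt_succ_iff.1 h2).eq_or_lt with rfl | h2
    · refine Or.inr (valuesVec_congr (eq_of_leads hg hb.2 ha.2 fun i hi hin => ?_))
      rw [hb.1 i hi hin, ha.1 i hi hin]
    · exact Or.inl ⟨c', h1, h2, b, hb, rfl⟩
  · rintro (⟨c', h1, h2, b, hb, rfl⟩ | rfl)
    · exact ⟨c', h1, h2.trans (Nat.lt_succ_self c), b, hb, rfl⟩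
    · exact ⟨c, hc, Nat.lt_succ_self c, a, ha, rfl⟩

/-- A solution is the affine combination of the points whose weights are its own free coordinates:
both solve the triangular equations and have the same free part. Its vector of values is the unit
vector at `S.length`. -/
theorem mem_span_pointValues_of_satisfiable {S : SystemExpr n} (hS : IsLinear S) {R : ℕ}
    {g : ℕ → PolyExpr n} (hg : ∀ j < R, Leads (g j) j) (hgS : ∀ j < R, g j ∈ S)
    (hR : R ≤ n) (hpt : ∀ c, R ≤ c → c < n + 1 → ∃ a, IsPoint R g c a) (hsat : S.Satisfiable) :
    Pi.single S.length 1 ∈ Submodule.span (ZMod 2) (pointValues S R g (n + 1)) := by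
  obtain ⟨β, hβ⟩ := satisfiable_iff.1 hsat
  choose! α hα using hpt
  -- The number `n` belongs to the point with all free variables `0`; its weight brings the sum to
  -- `1`.
  let w : ℕ → ZMod 2 := fun c => if c < n then β c else 1 + ∑ i ∈ Finset.Ico R n, β i
  have hw : ∑ c ∈ Finset.Ico R (n + 1), w c = 1 := by
    have h2 := CharTwo.add_self_eq_zero (∑ i ∈ Finset.Ico R n, β i)
    rw [Finset.sum_Ico_succ_top hR, Finset.sum_congr rfl (g := β) fun c hc => by
      simp [w, (Finset.mem_Ico.1 hc).2]]
    simp only [w, lt_irrefl, if_false]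
    linear_combination h2
  have hsingle : Pi.single S.length 1 = ∑ c ∈ Finset.Ico R (n + 1), w c • valuesVec S (α c) := by
    rw [← valuesVec_sum hS _ w hw, valuesVec_congr (b := β)]
    · ext i
      rw [Pi.single_apply]
      unfold valuesVec
      split_ifs with h1 h2 h2
      · omega
      · rfl
      · rw [List.getD_eq_getElem _ _ h2, hβ _ (List.getElem_mem h2)]
      · rfl
    · refine eq_of_leads hg (fun j hj => ?_) (fun j hj => hβ _ (hgS j hj)) fun i hi hin => ?_
      · rw [polyEval_sum_of_linear (hS _ (hgS j hj)) _ w hw]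
        refine Finset.sum_eq_zero fun c hc => ?_
        rw [Finset.mem_Ico] at hc
        rw [(hα c hc.1 hc.2).2 j hj, mul_zero]
      · simp only [Finset.sum_apply, Pi.smul_apply, smul_eq_mul]
        rw [Finset.sum_eq_single i]
        · rw [(hα i hi (by omega)).1 i hi hin]
          simp [w, hin]
        · intro c hc hci
          rw [Finset.mem_Ico] at hc
          rw [(hα c hc.1 hc.2).1 i hi hin, if_neg hci.symm, mul_zero]
        · intro h
          simp only [Finset.mem_Ico] at h
          omega
  rw [hsingle]
  refine Submodule.sum_mem _ fun c hc => Submodule.smul_mem _ _ (Submodule.subset_span ?_)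
  rw [Finset.mem_Ico] at hc
  exact ⟨c, hc.1, hc.2, α c, hα c hc.1 hc.2, rfl⟩

theorem valuesVec_add_add {S : SystemExpr n} (hS : IsLinear S) (a b c : ℕ → ZMod 2) :
    valuesVec S (a + b + c) = valuesVec S a + valuesVec S b + valuesVec S c := by
  have := valuesVec_sum hS (Finset.univ : Finset (Fin 3)) (fun _ => 1) (by decide) ![a, b, c]
  simpa [Fin.sum_univ_three] using this

/-- A sum of an odd number of vectors of values is the vector at the sum of the points. So each
element of the span is one such vector or a sum of two; the latter has last entry `1 + 1 = 0`, which
rules it out here. -/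
theorem satisfiable_of_mem_span {S : SystemExpr n} (hS : IsLinear S) {P : Set (ℕ → ZMod 2)}
    (hP : ∀ v ∈ P, ∃ a, v = valuesVec S a)
    (h : Pi.single S.length 1 ∈ Submodule.span (ZMod 2) P) : S.Satisfiable := by
  have hlast : ∀ a, valuesVec S a S.length = 1 := fun a => by simp [valuesVec]
  have hself : ∀ v : ℕ → ZMod 2, v + v = 0 := fun v => by
    ext i
    exact CharTwo.add_self_eq_zero _
  have key : ∀ v ∈ Submodule.span (ZMod 2) P, (∃ a, v = valuesVec S a) ∨
      ∃ a b, v = valuesVec S a + valuesVec S b := by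
    intro v hv
    induction hv using Submodule.span_induction with
    | mem v hv => exact Or.inl (hP v hv)
    | zero => exact Or.inr ⟨0, 0, (hself _).symm⟩
    | add u v _ _ hu hv =>
      rcases hu with ⟨a, rfl⟩ | ⟨a, b, rfl⟩ <;> rcases hv with ⟨c, rfl⟩ | ⟨c, d, rfl⟩
      · exact Or.inr ⟨a, c, rfl⟩
      · exact Or.inl ⟨a + c + d, by rw [valuesVec_add_add hS, add_assoc]⟩
      · exact Or.inl ⟨a + b + c, by rw [valuesVec_add_add hS]⟩
      · exact Or.inr ⟨a + b + c, d, by rw [valuesVec_add_add hS]; abel⟩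
    | smul r v _ hv =>
      rcases ZMod.eq_zero_or_one r with rfl | rfl
      · exact Or.inr ⟨0, 0, by rw [hself, zero_smul]⟩
      · rwa [one_smul]
  rcases key _ h with ⟨a, ha⟩ | ⟨a, b, hab⟩
  · refine satisfiable_iff.2 ⟨a, fun p hp => ?_⟩
    obtain ⟨i, hi, rfl⟩ := List.mem_iff_getElem.1 hp
    have := congrFun ha i
    rw [Pi.single_eq_of_ne hi.ne] at this
    simpa [valuesVec, hi] using this.symm
  · have := congrFun hab S.length
    rw [Pi.single_eq_same, Pi.add_apply, hlast, hlast] at this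
    exact absurd this (by decide)

end SystemExpr

/-! ### Deciding linear systems -/

namespace RAM

open SystemExpr

variable {n : ℕ}

/-- Decide a linear system by elimination among its values at affinely independent points. -/
def solveLinear : Program :=
  .seq (.const 0 0) <| .seq (.const 45 0) <| .seq (.const 46 0) <| .seq (.copy 47 41) <|
  .seq (.inc 47) <| .seq (.copy 43 40) <| .seq (.inc 43) <| .seq (.const 48 1) <|
  .seq (.const 49 0) <| .seq (.copy 44 42) <| .whileLt 44 43 <|
  -- In the last round register `44` holds `n`, which is not a variable, so this round treats the
  -- point with all free variables `0`. The entry `1` at the end of array `5` is the additional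
  -- coordinate.
  .seq (.store 3 44 48) <| .seq evalAt <| .seq (.store 5 41 48) <| .seq reduceProg <|
  .seq insertProg <| .seq (.store 3 44 49) <| .inc 44

/-- The vectors in `bs` and the answer `r` agree with the vectors in `P` treated so far. -/
structure Eliminated (m : ℕ) (P : Set (ℕ → ZMod 2)) (bs : List ((ℕ → ZMod 2) × ℕ)) (r : ℕ) :
    Prop where
  ech : IsEchelon m bs
  le : listSpan bs ≤ Submodule.span (ZMod 2) P
  ans : r = 0 ∧ P ⊆ listSpan bs ∨ r = 1 ∧ Pi.single m 1 ∈ Submodule.span (ZMod 2) P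

theorem Eliminated.insert {m : ℕ} {P P' : Set (ℕ → ZMod 2)} {bs : List ((ℕ → ZMod 2) × ℕ)}
    {r : ℕ} (h : Eliminated m P bs r) {v : ℕ → ZMod 2} (hv : ∀ i, m < i → v i = 0)
    (hP : ∀ w, w ∈ P' ↔ w ∈ P ∨ w = v) {x : ℕ} (hx : x < m) (h1 : reduceVec bs v x = 1) :
    Eliminated m P' (bs ++ [(reduceVec bs v, x)]) r := by
  have hPP : P ⊆ P' := fun w hw => (hP w).2 (Or.inl hw)
  have hle := h.le.trans (Submodule.span_mono hPP)
  have hsub : listSpan bs ≤ listSpan (bs ++ [(reduceVec bs v, x)]) :=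
    listSpan_mono (List.subset_append_left ..)
  refine ⟨h.ech.append hv hx h1, ?_, h.ans.imp ?_ ?_⟩
  · refine Submodule.span_le.2 ?_
    rintro _ ⟨b, hb, rfl⟩
    rcases List.mem_append.1 hb with hb | hb
    · exact hle (mem_listSpan hb)
    · rw [List.mem_singleton.1 hb]
      have := Submodule.add_mem _ (hle (reduceVec_sub_mem bs v))
        (Submodule.subset_span ((hP v).2 (Or.inr rfl)))
      simpa using this
  · rintro ⟨hr, hs⟩
    refine ⟨hr, fun w hw => ?_⟩
    rcases (hP w).1 hw with hw | rfl
    · exact hsub (hs hw)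
    · have := Submodule.sub_mem _ (mem_listSpan (b := (reduceVec bs w, x))
        (List.mem_append_right bs (by simp))) (hsub (reduceVec_sub_mem bs w))
      simpa using this
  · exact fun ⟨hr, he⟩ => ⟨hr, Submodule.span_mono hPP he⟩

/-- The reduced vector is a multiple of the unit vector at `m`: if it is `0`, then `v` is in the
span already, and otherwise the unit vector is in the span of `P'`. -/
theorem Eliminated.skip {m : ℕ} {P P' : Set (ℕ → ZMod 2)} {bs : List ((ℕ → ZMod 2) × ℕ)}
    {r : ℕ} (h : Eliminated m P bs r) {v : ℕ → ZMod 2} (hv : ∀ i, m < i → v i = 0)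
    (hP : ∀ w, w ∈ P' ↔ w ∈ P ∨ w = v) (h0 : ∀ x < m, reduceVec bs v x = 0) :
    Eliminated m P' bs (if reduceVec bs v m = 1 then 1 else r) := by
  have hPP : P ⊆ P' := fun w hw => (hP w).2 (Or.inl hw)
  have hle := h.le.trans (Submodule.span_mono hPP)
  have hred : reduceVec bs v = Pi.single m (reduceVec bs v m) := by
    ext i
    rw [Pi.single_apply]
    rcases lt_trichotomy i m with hi | rfl | hi
    · rw [h0 i hi, if_neg hi.ne]
    · rw [if_pos rfl]
    · rw [if_neg hi.ne', reduceVec_apply_of_zero fun b hb => h.ech.supp b hb i hi, hv i hi]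
  have hsub := reduceVec_sub_mem bs v
  refine ⟨h.ech, hle, ?_⟩
  rcases ZMod.eq_zero_or_one (reduceVec bs v m) with hm | hm
  · rw [if_neg (by simp [hm])]
    refine h.ans.imp (fun ⟨hr, hs⟩ => ⟨hr, fun w hw => ?_⟩) fun ⟨hr, he⟩ =>
      ⟨hr, Submodule.span_mono hPP he⟩
    rcases (hP w).1 hw with hw | rfl
    · exact hs hw
    · rw [hred, hm, Pi.single_zero, zero_sub] at hsub
      simpa using hsub
  · rw [if_pos hm]
    refine Or.inr ⟨rfl, ?_⟩
    have := Submodule.add_mem _ (hle hsub) (Submodule.subset_span ((hP v).2 (Or.inr rfl)))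
    rw [sub_add_cancel, hred, hm] at this
    exact this

theorem runs_solveLinear {S : SystemExpr n} {R : ℕ} {g : ℕ → PolyExpr n} {s : State} {E : ℕ}
    (hlin : IsLinear S)
    (hm : 1 ≤ S.length) (hE1 : 1 ≤ E) (hE : ∀ p ∈ S, (encPoly p).length ≤ E)
    (hs : Ready S R g s) (hn : s.reg 40 = n) (ha : s.mem 3 = fun _ => 0)
    (hz5 : s.mem 5 = fun _ => 0) :
    Runs solveLinear s fun t s' =>
      t ≤ (n + 1 - R) *
        (60 * (S.length * E) + n * (9 * (S.length + 1) + 6) + 11 * (S.length + 1) + 30) + 11 ∧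
      (S.Satisfiable → s'.reg 0 = 1) ∧ (¬ S.Satisfiable → s'.reg 0 = 0) := by
  set K := 60 * (S.length * E) + n * (9 * (S.length + 1) + 6) + 11 * (S.length + 1) + 30 with hK
  have hRn := hs.le
  simp only [solveLinear, runs_seq, runs_const, runs_copy, runs_inc]
  refine (runs_while (σ := ℕ × List ((ℕ → ZMod 2) × ℕ) × (ℕ → ZMod 2))
    (fun g' s' => R ≤ g'.1 ∧ g'.1 ≤ n + 1 ∧ s'.reg 44 = g'.1 ∧ s'.reg 43 = n + 1 ∧
      s'.reg 48 = 1 ∧ s'.reg 49 = 0 ∧ Ready S R g s' ∧ Stores S.length g'.2.1 s' ∧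
      -- Each point adds at most one vector, so there are at most `n` whenever a new one is reduced.
      -- Between rounds only the free variables have to be `0`; back substitution overwrites the
      -- others.
      g'.2.1.length + R ≤ g'.1 ∧ s'.mem 3 = (fun i => (g'.2.2 i).val) ∧
      (∀ i, R ≤ i → g'.2.2 i = 0) ∧ (∀ i, S.length < i → s'.mem 5 i = 0) ∧
      -- The existence of the points is not shown separately; the run of the program provides them.
      (∀ c, R ≤ c → c < g'.1 → ∃ a, IsPoint R g c a) ∧
      Eliminated S.length (pointValues S R g g'.1) g'.2.1 (s'.reg 0))
    (fun g' => (n + 1 - g'.1) * K + 1) (fun g' => by omega) ?_ (g := (R, [], 0)) ?_).mono ?_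
  · rintro ⟨c, bs, a⟩ s₁ ⟨h1, h2, h3, h4, h5, h6, h7, h8, h9, h10, h11, h12, h13, h14⟩ hlt
    dsimp only at *
    have hc : c < n + 1 := by omega
    simp only [runs_seq, runs_store, runs_inc]
    refine (runs_evalAt (g := g) (a := Function.update a c 1) hm hE1 hE
      (h7.of_same (by simp) (by simp) (by simp) (by simp)) ?_).mono ?_
    · ext i
      simp [h3, h5, h10, Function.update_apply]
      split_ifs <;> simp
    rintro t₁ s₂ ⟨k1, b, k2, k3, k4, k5, k6, -, k8, k9⟩
    rw [mem_setMem, if_neg (by norm_num)] at k6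
    have e2 : ∀ r, r < 10 ∨ 30 ≤ r → s₂.reg r = s₁.reg r := fun r hr => k8 r hr
    have e41 : s₂.reg 41 = S.length := by rw [e2 41 (by omega), h7.len]
    have e48 : s₂.reg 48 = 1 := by rw [e2 48 (by omega), h5]
    have m2 : ∀ x, x ≠ 3 → x ≠ 5 → s₂.mem x = s₁.mem x := fun x hx hx' => by
      rw [k9 x (by simp [hx, hx']), mem_setMem, if_neg hx]
    have hpt : IsPoint R g c b := by
      refine ⟨fun i hi hin => ?_, k4⟩
      rw [k3 i hi, Function.update_apply, h11 i hi]
    have hvec : (s₂.setMem 5 (s₂.reg 41) (s₂.reg 48)).mem 5 =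
        fun i => (valuesVec S b i).val := by
      ext i
      rw [mem_setMem, if_pos rfl, e41, e48, Function.update_apply]
      unfold valuesVec
      split_ifs with c1 c2 c3
      · omega
      · rfl
      · exact k5 i c3
      · rw [k6 i (by omega), h12 i (by omega), ZMod.val_zero]
    have hst₂ : Stores S.length bs (s₂.setMem 5 (s₂.reg 41) (s₂.reg 48)) := by
      refine ⟨?_, ?_, ?_, ?_, ?_, ?_⟩
      · simpa [m2 6] using h8.vec
      · simpa [m2 7] using h8.pos
      · exact e41
      · exact (e2 47 (by omega)).trans h8.len'
      · exact (e2 45 (by omega)).trans h8.cnt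
      · exact (e2 46 (by omega)).trans h8.fin
    refine (runs_reduceProg h14.ech hst₂ hvec).mono ?_
    rintro t₂ s₃ ⟨l1, l2, l3, l4⟩
    have hst₃ := hst₂.of_same l3 (by omega) l4 (by simp) (by simp)
    have e3 : ∀ r, r < 10 ∨ 40 ≤ r → s₃.reg r = s₁.reg r := fun r hr => by
      rw [l3 r (by omega), reg_setMem, e2 r (by omega)]
    have m3 : ∀ x, x ≠ 5 → s₃.mem x = s₂.mem x := fun x hx' => by
      rw [l4 x (by simp [hx']), mem_setMem, if_neg hx']
    refine (runs_insertProg hst₃ l2).mono ?_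
    rintro t₃ s₄ ⟨q1, q2, q3, q4⟩
    have e4 : ∀ r, 40 ≤ r ∧ r < 45 ∨ 47 ≤ r → s₄.reg r = s₁.reg r := fun r hr => by
      rw [q3 r (by omega), e3 r (by omega)]
    have m4 : ∀ x, x ≠ 5 → x ≠ 6 → x ≠ 7 → s₄.mem x = s₂.mem x := fun x h5 h6 h7 => by
      rw [q4 x (by simp [h6, h7]), m3 x h5]
    have e0 : s₃.reg 0 = s₁.reg 0 := e3 0 (by omega)
    have hready : Ready S R g ((s₄.setMem 3 (s₄.reg 44) (s₄.reg 49)).setReg 44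
        ((s₄.setMem 3 (s₄.reg 44) (s₄.reg 49)).reg 44 + 1)) :=
      h7.of_same (by simp [e4]) (by simp [e4]) (by simp [m4, m2]) (by simp [m4, m2])
    have hsupp : ∀ i, S.length < i → valuesVec S b i = 0 := fun i hi => by
      unfold valuesVec
      rw [if_neg (by omega), if_neg (by omega)]
    have hP : ∀ w, w ∈ pointValues S R g (c + 1) ↔
      w ∈ pointValues S R g c ∨ w = valuesVec S b := fun w =>
        mem_pointValues_succ h7.leads h1 hpt
    have hz : ∀ i, S.length < i → s₄.mem 5 i = 0 := fun i hi => by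
      rw [q4 5 (by simp), l2]
      dsimp only
      rw [reduceVec_apply_of_zero fun d hd => h14.ech.supp d hd i hi, hsupp i hi, ZMod.val_zero]
    have hmem3 : Function.update (s₄.mem 3) c 0 = fun i => (Function.update b c 0 i).val := by
      rw [m4 3 (by omega) (by omega) (by omega), k2]
      ext i
      rw [Function.update_apply, Function.update_apply]
      split_ifs <;> simp
    have hb0 : ∀ i, R ≤ i → Function.update b c 0 i = 0 := fun i hi => by
      rw [Function.update_apply]
      split_ifs with hic
      · rfl
      · rw [k3 i hi, Function.update_of_ne hic, h11 i hi]
    have hpts : ∀ c', R ≤ c' → c' < c + 1 → ∃ a, IsPoint R g c' a := fun c' hc' hlt' => by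
      rcases (Nat.lt_succ_iff.1 hlt').eq_or_lt with rfl | hlt'
      exacts [⟨b, hpt⟩, h13 c' hc' hlt']
    have hlen : bs.length * (9 * (S.length + 1) + 6) ≤ n * (9 * (S.length + 1) + 6) :=
      Nat.mul_le_mul_right _ (by omega)
    have hKc : (n + 1 - c) * K = (n + 1 - (c + 1)) * K + K := by
      rw [show n + 1 - c = (n + 1 - (c + 1)) + 1 by omega, add_mul, one_mul]
    have e44 : s₄.reg 44 = c := by rw [e4 44 (by omega), h3]
    have e49 : s₄.reg 49 = 0 := by rw [e4 49 (by omega), h6]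
    rcases q2 with ⟨x, hx, hx1, hst, h0⟩ | ⟨hx, hst, h0⟩
    · refine ⟨(c + 1, bs ++ [(reduceVec bs (valuesVec S b), x)], Function.update b c 0),
        ⟨by dsimp only; omega, hc, by simp [e44], by simp [e4, h4], by simp [e4, h5],
          by simp [e49], hready,
          ⟨by simpa using hst.vec, by simpa using hst.pos, by simpa using hst.len,
            by simpa using hst.len', by simpa using hst.cnt, by simpa using hst.fin⟩,
          by simp; omega, by simpa [e44, e49] using hmem3, hb0, by simpa using hz, hpts, ?_⟩, ?_⟩
      · have := h14.insert hsupp hP hx hx1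
        simpa [h0, e0] using this
      · dsimp only
        omega
    · refine ⟨(c + 1, bs, Function.update b c 0),
        ⟨by dsimp only; omega, hc, by simp [e44], by simp [e4, h4], by simp [e4, h5],
          by simp [e49], hready,
          ⟨by simpa using hst.vec, by simpa using hst.pos, by simpa using hst.len,
            by simpa using hst.len', by simpa using hst.cnt, by simpa using hst.fin⟩,
          by dsimp only; omega, by simpa [e44, e49] using hmem3, hb0, by simpa using hz, hpts,
          ?_⟩, ?_⟩
      · have := h14.skip hsupp hP hx
        simpa [h0, e0] using this
      · dsimp only
        omega
  · refine ⟨le_rfl, by dsimp only; omega, by simp [hs.cnt], by simp [hn], by simp, by simp,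
      hs.of_same (by simp) (by simp) (by simp) (by simp),
      ⟨by simp, by simp, by simp [hs.len], by simp [hs.len], by simp, by simp⟩,
      by simp, by simp [ha], by simp, by simp [hz5], fun c hc hc' => by dsimp only at hc'; omega,
      ⟨⟨by simp, by simp, by simp, List.Pairwise.nil⟩, by simp [listSpan], Or.inl ⟨by simp, ?_⟩⟩⟩
    rintro v ⟨c, hc, hc', _⟩
    dsimp only at hc'
    omega
  · rintro t s₁ ⟨⟨c, bs, a⟩, ⟨h1, h2, h3, h4, h5, h6, h7, h8, h9, h10, h11, h12, h13, h14⟩, hlt, ht⟩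
    dsimp only at *
    obtain rfl : c = n + 1 := by omega
    refine ⟨by omega, fun hsat => ?_, fun hsat => ?_⟩
    · rcases h14.ans with ⟨-, hsub⟩ | ⟨h, -⟩
      · have he := mem_span_pointValues_of_satisfiable hlin h7.leads h7.mem hRn h13 hsat
        have := h14.ech.eq_zero (Submodule.span_le.2 hsub he) fun i hi => by simp [hi.ne]
        have := congrFun this S.length
        simp at this
      · exact h
    · rcases h14.ans with ⟨h, -⟩ | ⟨-, he⟩
      · exact h
      · refine absurd (satisfiable_of_mem_span hlin ?_ he) hsat
        rintro v ⟨_, _, _, a, _, rfl⟩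
        exact ⟨a, rfl⟩

end RAM

/-! ### Adding up the running times -/

namespace SystemExpr

variable {n : ℕ}

theorem length_encPoly_le {p : PolyExpr n} {d k : ℕ} (hd : p.length ≤ d)
    (hk : ∀ c ∈ p, c.length ≤ k) : (encPoly p).length ≤ d * (2 * k + 1) + 1 := by
  have h : ∀ c ∈ p, (encClause c).length ≤ 2 * k + 1 := fun c hc => by
    have := hk c hc
    simp only [encClause, List.length_cons, List.length_flatMap, encLit, List.length_nil,
      List.map_const', List.sum_replicate, smul_eq_mul]
    omega
  have h' : (p.flatMap encClause).length ≤ p.length * (2 * k + 1) := by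
    rw [List.length_flatMap]
    have := List.sum_le_card_nsmul (p.map fun c => (encClause c).length) (2 * k + 1) (by simpa)
    simpa using this
  have := Nat.mul_le_mul_right (2 * k + 1) hd
  rw [encPoly, List.length_cons]
  omega

end SystemExpr

namespace RAM

open SystemExpr

variable {n : ℕ}

theorem Runs.decidesWithin {P : Program} {A B : List ℕ} {Q : Prop} {T T' : ℕ}
    (h : Runs P (init A B) fun t s => t ≤ T ∧ (Q → s.reg 0 = 1) ∧ (¬ Q → s.reg 0 = 0))
    (hT : T ≤ T') : DecidesWithin P A B Q T' := by
  obtain ⟨t, s, he, ht, h1, h0⟩ := h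
  exact ⟨t, s, he, ht.trans hT, h1, h0⟩

theorem runs_countPivots_search {S : SystemExpr n} {R E : ℕ} {s : State} (hm : 1 ≤ S.length)
    (hE1 : 1 ≤ E) (hE : ∀ p ∈ S, (encPoly p).length ≤ E) (hR : R ≤ n) (hs : Found S R s) :
    Runs (.seq countPivots search) s fun t s' => R ≤ S.length ∧
      t ≤ 6 * S.length + 14 + 100 * (S.length * E) * 2 ^ (n - R) ∧
      (S.Satisfiable → s'.reg 0 = 1) ∧ (¬ S.Satisfiable → s'.reg 0 = 0) := by
  rw [runs_seq]
  refine (runs_countPivots hR hs).mono ?_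
  rintro t s₁ ⟨h1, h2, h3, -, R', g, h4, h5, h6⟩
  refine (runs_search (q := n - R') hm hE1 hE h6 h2 (by omega) h3).mono ?_
  rintro t' s₂ ⟨k1, k2⟩
  -- The program may have found more leading variables than promised, which only shortens the
  -- search.
  have hpow : 2 ^ (n - R') ≤ 2 ^ (n - R) := Nat.pow_le_pow_right (by norm_num) (by omega)
  have := Nat.mul_le_mul_left (100 * (S.length * E)) hpow
  exact ⟨h4.trans h6.cnt_le, by omega, k2⟩

theorem decidesWithin_of_positions {S : SystemExpr n} {d k R : ℕ} (hR : R ≤ n)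
    {f : Fin R → Fin S.length} (hm : 1 ≤ S.length) (hd : 1 ≤ d) (hk : 1 ≤ k)
    (hS : S.Bounded d k) (hf : ∀ j, Leads (S.get (f j)) j) :
    DecidesWithin (.seq indexPolys (.seq loadPivots (.seq countPivots search))) S.enc
      (encIndices f) S.Satisfiable (600 * (d * k * S.length * 2 ^ (n - R))) := by
  have hdk : 1 ≤ d * k := Nat.mul_pos hd hk
  -- For `d, k ≥ 1` the length `d * (2 * k + 1) + 1` is at most `4 * (d * k)`.
  have hE : ∀ p ∈ S, (encPoly p).length ≤ 4 * (d * k) := fun p hp => by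
    refine (length_encPoly_le (hS p hp).1 (hS p hp).2).trans ?_
    have := Nat.le_mul_of_pos_right d hk
    rw [mul_add, mul_left_comm]
    omega
  have hmdk : S.length ≤ d * k * S.length := Nat.le_mul_of_pos_left _ hdk
  have hpow : d * k * S.length ≤ d * k * S.length * 2 ^ (n - R) :=
    Nat.le_mul_of_pos_right _ (by positivity)
  refine Runs.decidesWithin (T := S.length * (20 * (4 * (d * k)) + 3) + 7 + (6 * S.length + 4) +
    (6 * S.length + 14 + 100 * (S.length * (4 * (d * k))) * 2 ^ (n - R))) ?_ ?_
  · simp only [runs_seq]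
    refine (runs_indexPolys hE (at_init _ _) (by ext; simp [init])).mono ?_
    rintro t s₁ ⟨h1, h2, h3, h4, h5⟩
    refine (runs_loadPivots (f := f) h2 h3 ?_ ?_ ?_ ?_ ?_ hf).mono ?_
    · rw [h4 0 (by simp)]
      exact (at_init _ _).of_enc.2.2
    · rw [h4 3 (by simp)]
      ext
      simp [init]
    · intro i
      rw [h4 4 (by simp)]
      simp [init]
    · intro i
      rw [h4 1 (by simp)]
      simp [init]
    · rw [h4 0 (by simp)]
      exact h5
    rintro t' s₂ ⟨k1, k2⟩
    have := runs_countPivots_search hm (by omega) hE hR k2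
    rw [runs_seq] at this
    refine this.mono fun t₁ s₃ h => h.mono fun t₂ s₄ h' => ?_
    exact ⟨by have := h'.1; have := h'.2.1; omega, h'.2.2⟩
  · rw [show S.length * (20 * (4 * (d * k)) + 3) = 80 * (d * k * S.length) + 3 * S.length by
      ring, show 100 * (S.length * (4 * (d * k))) * 2 ^ (n - R) =
        400 * (d * k * S.length * 2 ^ (n - R)) by ring]
    omega

theorem decidesWithin_of_shows {S : SystemExpr n} {d k R : ℕ} (hR : R ≤ n)
    {f : Fin R → Fin S.length} (hm : 1 ≤ S.length) (hd : 1 ≤ d) (hk : 1 ≤ k)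
    (hS : S.Bounded d k) (hf : ∀ j, ShowsPivot (S.get (f j)) (Fin.castLE hR j)) :
    DecidesWithin (.seq (findPivots detectShown) (.seq countPivots search)) S.enc []
      S.Satisfiable (600 * (d * k * S.length * 2 ^ (n - R))) := by
  have hdk : 1 ≤ d * k := Nat.mul_pos hd hk
  have hE : ∀ p ∈ S, (encPoly p).length ≤ 4 * (d * k) := fun p hp => by
    refine (length_encPoly_le (hS p hp).1 (hS p hp).2).trans ?_
    have := Nat.le_mul_of_pos_right d hk
    rw [mul_add, mul_left_comm]
    omega
  have hmdk : S.length ≤ d * k * S.length := Nat.le_mul_of_pos_left _ hdk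
  have hpow : d * k * S.length ≤ d * k * S.length * 2 ^ (n - R) :=
    Nat.le_mul_of_pos_right _ (by positivity)
  refine Runs.decidesWithin (T := S.length * (20 * (4 * (d * k)) + 6) + 7 +
    (6 * S.length + 14 + 100 * (S.length * (4 * (d * k))) * 2 ^ (n - R))) ?_ ?_
  · rw [runs_seq]
    refine (runs_findPivots (R := R) (T := 20 * (4 * (d * k)))
      (W := fun p j => ∃ j' : Fin n, j'.val = j ∧ ShowsPivot p j') (fun p hp s h1 h2 h3 =>
        (detects_detectShown p s h1 h2 h3).mono fun t s' h =>
          ⟨h.1.trans (Nat.mul_le_mul_left 20 (hE p hp)), h.2⟩)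
      hR (fun j hj => ⟨S.get (f ⟨j, hj⟩), List.get_mem _ _, _, rfl, hf ⟨j, hj⟩⟩)
      (at_init _ _) (by ext; simp [init]) (by ext; simp [init]) (by ext; simp [init])).mono ?_
    rintro t s₁ ⟨h1, h2, -⟩
    refine (runs_countPivots_search hm (by omega) hE hR h2).mono ?_
    rintro t' s₂ ⟨-, k2, k3⟩
    exact ⟨by omega, k3⟩
  · rw [show S.length * (20 * (4 * (d * k)) + 6) = 80 * (d * k * S.length) + 6 * S.length by
      ring, show 100 * (S.length * (4 * (d * k))) * 2 ^ (n - R) =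
        400 * (d * k * S.length * 2 ^ (n - R)) by ring]
    omega

theorem decidesWithin_of_linear {S : SystemExpr n} {R : ℕ} (hR : R ≤ n)
    {f : Fin R → Fin S.length} (hm : 1 ≤ S.length) (hn : 1 ≤ n)
    (hS : S.Bounded n 1) (hf : ∀ j, Leads (S.get (f j)) j) :
    DecidesWithin (.seq (findPivots detectLinear) (.seq countPivots solveLinear)) S.enc []
      S.Satisfiable (600 * (S.length * n * (n + 1 - R))) := by
  have hE : ∀ p ∈ S, (encPoly p).length ≤ 4 * n := fun p hp => by
    refine (length_encPoly_le (hS p hp).1 (hS p hp).2).trans ?_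
    omega
  have hmn : S.length ≤ S.length * n := Nat.le_mul_of_pos_right _ hn
  have hmR : S.length * n ≤ S.length * n * (n + 1 - R) :=
    Nat.le_mul_of_pos_right _ (by omega)
  refine Runs.decidesWithin (T := S.length * ((20 * (4 * n) + 6 * n + 3) + 6) + 7 +
    (6 * S.length + 10 + ((n + 1 - R) * (60 * (S.length * (4 * n)) +
      n * (9 * (S.length + 1) + 6) + 11 * (S.length + 1) + 30) + 11))) ?_ ?_
  · simp only [runs_seq]
    refine (runs_findPivots (R := R) (T := 20 * (4 * n) + 6 * n + 3)
      (W := fun p j => Leads p j) (fun p hp s h1 h2 h3 =>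
        (detects_detectLinear (hS p hp).2 s h1 h2 h3).mono fun t s' h =>
          ⟨h.1.trans (by have := hE p hp; omega), h.2⟩)
      hR (fun j hj => ⟨S.get (f ⟨j, hj⟩), List.get_mem _ _, hf ⟨j, hj⟩⟩)
      (at_init _ _) (by ext; simp [init]) (by ext; simp [init]) (by ext; simp [init])).mono ?_
    rintro t s₁ ⟨h1, h2, h5⟩
    refine (runs_countPivots hR h2).mono ?_
    rintro t' s₂ ⟨k1, k2, k3, k4, R', g, k5, k6, k7⟩
    refine (runs_solveLinear (fun p hp => (hS p hp).2) hm (by omega) hE k7 k2 k3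
      (by rw [k4, h5]; ext; simp [init])).mono ?_
    rintro t₃ s₃ ⟨l1, l2⟩
    refine ⟨?_, l2⟩
    have := Nat.mul_le_mul_right (60 * (S.length * (4 * n)) +
      n * (9 * (S.length + 1) + 6) + 11 * (S.length + 1) + 30)
      (show n + 1 - R' ≤ n + 1 - R by omega)
    omega
  -- For each point, evaluation, reduction and insertion are all of order `S.length * n`; lower
  -- terms are absorbed since both factors are at least `1`.
  · have hK : 60 * (S.length * (4 * n)) + n * (9 * (S.length + 1) + 6) + 11 * (S.length + 1) + 30 ≤
        400 * (S.length * n) := by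
      have hnm : n ≤ S.length * n := Nat.le_mul_of_pos_left _ hm
      rw [show 60 * (S.length * (4 * n)) = 240 * (S.length * n) by ring,
        show n * (9 * (S.length + 1) + 6) = 9 * (S.length * n) + 15 * n by ring]
      omega
    have := Nat.mul_le_mul_left (n + 1 - R) hK
    rw [show (n + 1 - R) * (400 * (S.length * n)) = 400 * (S.length * n * (n + 1 - R)) by ring]
      at this
    rw [show S.length * (20 * (4 * n) + 6 * n + 3 + 6) = 86 * (S.length * n) + 9 * S.length by
      ring]
    omega

end RAM

/-- Part (i) comes in two forms. In the first one the input tells which polynomials are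
`f_1, …, f_R`. In the second one the input is the system alone, and the expressions of the `f_j`
show their leading variables. In part (ii) the input is the system alone. -/
theorem corollary2 :
    (∃ (P : RAM.Program) (C : ℕ), ∀ (n : ℕ) (S : SystemExpr n) (d k R : ℕ) (hR : R ≤ n)
        (f : Fin R → Fin S.length),
      1 ≤ S.length → 1 ≤ d → 1 ≤ k → S.Bounded d k →
      (∀ j : Fin R, BoolPoly.IsPivot d (SystemExpr.polyVal (S.get (f j))) (Fin.castLE hR j)) →
      RAM.DecidesWithin P S.enc (SystemExpr.encIndices f) S.Satisfiable
        (C * (d * k * S.length * 2 ^ (n - R)))) ∧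
    (∃ (P : RAM.Program) (C : ℕ), ∀ (n : ℕ) (S : SystemExpr n) (d k R : ℕ) (hR : R ≤ n)
        (f : Fin R → Fin S.length),
      1 ≤ S.length → 1 ≤ d → 1 ≤ k → S.Bounded d k →
      (∀ j : Fin R, BoolPoly.IsPivot d (SystemExpr.polyVal (S.get (f j))) (Fin.castLE hR j)) →
      (∀ j : Fin R, SystemExpr.ShowsPivot (S.get (f j)) (Fin.castLE hR j)) →
      RAM.DecidesWithin P S.enc [] S.Satisfiable
        (C * (d * k * S.length * 2 ^ (n - R)))) ∧
    (∃ (P : RAM.Program) (C : ℕ), ∀ (n : ℕ) (S : SystemExpr n) (R : ℕ) (hR : R ≤ n)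
        (f : Fin R → Fin S.length),
      1 ≤ S.length → 1 ≤ n → S.Bounded n 1 →
      (∀ j : Fin R, BoolPoly.IsPivot n (SystemExpr.polyVal (S.get (f j))) (Fin.castLE hR j)) →
      RAM.DecidesWithin P S.enc [] S.Satisfiable
        (C * (S.length * n * (n + 1 - R)))) := by
  refine ⟨⟨_, 600, fun n S d k R hR f hm hd hk hS hf =>
      RAM.decidesWithin_of_positions hR hm hd hk hS fun j => SystemExpr.leads_of_isPivot (hf j)⟩,
    ⟨_, 600, fun n S d k R hR f hm hd hk hS _ hf =>
      RAM.decidesWithin_of_shows hR hm hd hk hS hf⟩,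
    ⟨_, 600, fun n S R hR f hm hn hS hf =>
      RAM.decidesWithin_of_linear hR hm hn hS fun j => SystemExpr.leads_of_isPivot (hf j)⟩⟩
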